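/- Let $d\ge 1$, ${\cal H}=[-\tfrac12,\tfrac12)^d$, and let $f_x$ be a probability density on ${\cal H}$ (measurable, $f_x\ge 0$, $\int_{\cal H} f_x=1$). For $n,m\ge 1$ let ${\bf x}_1,\dots,{\bf x}_m$ be i.i.d. random points of ${\cal H}$ with density $f_x$, let $\beta_{n,m}=n^d/m$, and let ${\bf V}$ be the $n^d\times m$ random $d$-fold Vandermonde matrix with entries ${\bf V}_{\boldsymbol\ell,q}=m^{-1/2}\exp(-2\pi i\,\boldsymbol\ell^{T}{\bf x}_q)$, $\boldsymbol\ell\in\{0,\dots,n-1\}^d$, $1\le q\le m$. For $s\ge 0$ put $$\eta^{(n,m)}(s)=\mathbb E\Big[\tfrac1{n^d}\operatorname{Tr}\big(s{\bf V}{\bf V}^{H}+{\bf I}\big)^{-1}\Big].$$ Let $\sigma_a,\sigma_n>0$, $\gamma=\sigma_a^2/\sigma_n^2$, and let $\mathrm{MSE}^{(n,m)}$ be the mean square error per component, divided by $\sigma_a^2$ and averaged over the sampling points, of the linear MMSE estimate $\hat{\bf a}=\mathbb E[{\bf a}{\bf p}^H]\,\mathbb E[{\bf p}{\bf p}^H]^{-1}{\bf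 p}$ (second moments given the sampling points) of the field spectrum ${\bf a}\in\mathbb C^{n^d}$ from the noisy samples ${\bf p}=\beta_{n,m}^{-1/2}{\bf V}^H{\bf a}+{\bf n}$, where ${\bf a}$ and ${\bf n}$ are centred and uncorrelated, with covariance matrices $\sigma_a^2{\bf I}$ and $\sigma_n^2{\bf I}$. Let ${\cal A}=\{{\bf z}\in{\cal H}: f_x({\bf z})>0\}$ and let $|\cdot|$ denote Lebesgue measure. Then: 1. For all $\beta>0$ and $s\ge 0$ the limit $\eta_x(d,\beta,s)$ of $\eta^{(n,m)}(s)$ as $n,m\to\infty$ with $n^d/m\to\beta$ exists, and in the same limit $\mathrm{MSE}^{(n,m)}\to\eta_x(d,\beta,\gamma/\beta)$, the asymptotic MSE. 2. $\displaystyle\lim_{\beta\to 0^+}\eta_x(d,\beta,\gamma/\beta)=1-|{\cal A}|$. 3. The number $1-|{\cal A}|=|\{{\bf z}\in{\cal H}:f_x({\bf z})=0\}|$, the measure of the region with zero sensor density, is the minimal achievable asymptotic MSE in the following sense: $\eta_x(d,\beta,\gamma/\beta)>1-|{\cal A}|$ for every $\beta>0$, and $\inf_{\beta>0}\eta_x(d,\beta,\gamma/\beta)=1-|{\cal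 A}|$. -/

import Mathlib

open MeasureTheory Filter Topology
open scoped Matrix

noncomputable section

/-- The hypercube `[-1/2, 1/2)^d`. -/
def hypercube (d : ℕ) : Set (Fin d → ℝ) :=
  Set.univ.pi fun _ => Set.Ico (-1 / 2 : ℝ) (1 / 2)

/-- The law of one sampling point: density `f` with respect to Lebesgue measure on the
hypercube. -/
def pointLaw (d : ℕ) (f : (Fin d → ℝ) → ℝ) : Measure (Fin d → ℝ) :=
  (volume.restrict (hypercube d)).withDensity fun z => ENNReal.ofReal (f z)

/-- The joint law of `m` i.i.d. sampling points of density `f`. -/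
def pointsLaw (d m : ℕ) (f : (Fin d → ℝ) → ℝ) : Measure (Fin m → Fin d → ℝ) :=
  Measure.pi fun _ => pointLaw d f

/-- The set where the density of the sampling points is strictly positive. -/
def coveredSet (d : ℕ) (f : (Fin d → ℝ) → ℝ) : Set (Fin d → ℝ) :=
  {z | z ∈ hypercube d ∧ 0 < f z}

/-- The set where the density of the sampling points vanishes. -/
def uncoveredSet (d : ℕ) (f : (Fin d → ℝ) → ℝ) : Set (Fin d → ℝ) :=
  {z | z ∈ hypercube d ∧ f z = 0}

/-- The aspect ratio `n^d / m`. -/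
def aspectRatio (d n m : ℕ) : ℝ := (n : ℝ) ^ d / (m : ℝ)

/-- The `d`-fold Vandermonde matrix with `n^d` rows and `m` columns. Its rows are indexed by the
integer vectors `ℓ` with entries in `{0, …, n-1}` (instead of by the number of `ℓ` in an
enumeration of these vectors). -/
def vandermondeFold (d n m : ℕ) (x : Fin m → Fin d → ℝ) :
    Matrix (Fin d → Fin n) (Fin m) ℂ :=
  Matrix.of fun l q =>
    (((Real.sqrt m)⁻¹ : ℝ) : ℂ) *
      Complex.exp (-2 * Real.pi * Complex.I * ∑ j, ((l j : ℕ) : ℂ) * ((x q j : ℝ) : ℂ))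

/-- The `η`-transform of `V Vᴴ` at finite size: the expected normalized trace of
`(γ V Vᴴ + 1)⁻¹`. -/
def etaFinite (d n m : ℕ) (f : (Fin d → ℝ) → ℝ) (γ : ℝ) : ℝ :=
  ∫ x, (((γ : ℂ) • (vandermondeFold d n m x * (vandermondeFold d n m x)ᴴ) + 1)⁻¹).trace.re
    / (n : ℝ) ^ d ∂(pointsLaw d m f)

/-- The matrix `S = β_{n,m}^{-1/2} Vᴴ` of the observation model `p = S a + noise`. -/
def samplingMatrix (d n m : ℕ) (x : Fin m → Fin d → ℝ) :
    Matrix (Fin m) (Fin d → Fin n) ℂ :=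
  (((Real.sqrt (aspectRatio d n m))⁻¹ : ℝ) : ℂ) • (vandermondeFold d n m x)ᴴ

/-- The LMMSE filter `E[a pᴴ] E[p pᴴ]⁻¹`, where `p = S a + noise`, the spectrum `a` and the noise
are uncorrelated, centred, with covariance matrices `σa² I` and `σn² I`. -/
def lmmseFilter (d n m : ℕ) (σa σn : ℝ) (x : Fin m → Fin d → ℝ) :
    Matrix (Fin d → Fin n) (Fin m) ℂ :=
  (((σa ^ 2 : ℝ) : ℂ) • (samplingMatrix d n m x)ᴴ) *
    (((σa ^ 2 : ℝ) : ℂ) • (samplingMatrix d n m x * (samplingMatrix d n m x)ᴴ)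
      + ((σn ^ 2 : ℝ) : ℂ) • (1 : Matrix (Fin m) (Fin m) ℂ))⁻¹

/-- The covariance matrix of the error `a - W p = (1 - W S) a - W noise` of a linear estimator
`W p`, in the same model. -/
def errorCovariance (d n m : ℕ) (σa σn : ℝ) (x : Fin m → Fin d → ℝ)
    (W : Matrix (Fin d → Fin n) (Fin m) ℂ) :
    Matrix (Fin d → Fin n) (Fin d → Fin n) ℂ :=
  ((σa ^ 2 : ℝ) : ℂ) • ((1 - W * samplingMatrix d n m x) * (1 - W * samplingMatrix d n m x)ᴴ)
    + ((σn ^ 2 : ℝ) : ℂ) • (W * Wᴴ)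

/-- The mean square error of the LMMSE reconstruction at finite size: the error power per
component of `a`, divided by `σa²`, averaged over the sampling points. -/
def mseFinite (d n m : ℕ) (f : (Fin d → ℝ) → ℝ) (σa σn : ℝ) : ℝ :=
  ∫ x, (σa ^ 2)⁻¹ *
    ((errorCovariance d n m σa σn x (lmmseFilter d n m σa σn x)).trace.re / (n : ℝ) ^ d)
    ∂(pointsLaw d m f)

/-- The asymptotic regime `n, m → ∞` with `n^d / m → β`. -/
def growthRegime (d : ℕ) (β : ℝ) : Filter (ℕ × ℕ) :=
  (atTop ×ˢ atTop) ⊓ comap (fun nm : ℕ × ℕ => aspectRatio d nm.1 nm.2) (𝓝 β)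

/-- The regime is not void, so limits along it are unique. -/
theorem growthRegime_neBot {d : ℕ} (hd : 0 < d) {β : ℝ} (hβ : 0 < β) :
    (growthRegime d β).NeBot := by
  have hk : Tendsto (fun k : ℕ => (k : ℝ) ^ d / β) atTop atTop :=
    ((tendsto_pow_atTop hd.ne').comp tendsto_natCast_atTop_atTop).atTop_div_const hβ
  have h : Tendsto (fun k : ℕ => (k, ⌈(k : ℝ) ^ d / β⌉₊)) atTop (growthRegime d β) := by
    refine tendsto_inf.2 ⟨tendsto_id.prodMk (tendsto_nat_ceil_atTop.comp hk),
      tendsto_comap_iff.2 ?_⟩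
    have h1 := ((tendsto_nat_ceil_div_atTop (R := ℝ)).comp hk).inv₀ one_ne_zero
    have h2 := h1.const_mul β
    rw [inv_one, mul_one] at h2
    refine h2.congr fun k => ?_
    simp only [Function.comp, aspectRatio, inv_div]
    field_simp
  exact h.neBot

/-- The asymptotic `η`-transform `η_x(d, β, γ)` of `V Vᴴ`. -/
def etaLimit (d : ℕ) (f : (Fin d → ℝ) → ℝ) (β γ : ℝ) : ℝ :=
  limUnder (growthRegime d β) fun nm => etaFinite d nm.1 nm.2 f γ

end

/-! ### Trace inequalities for resolvents of positive semidefinite matrices. -/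

section MatrixLemmas

open Matrix

open scoped ComplexOrder

set_option linter.unusedSectionVars false

variable {ι κ : Type*} [Fintype ι] [DecidableEq ι] [Fintype κ] [DecidableEq κ]

/-! Write `e_z` for the vector of exponentials at `z` and `A` for the matrix with columns `e_{x_q}`.
Every quantity is an expected normalized trace of `(1 + τ A Aᴴ)⁻¹` with `τ = s / m`. At finite size
the LMMSE error is exactly such a trace, with `s = γ / aspectRatio d n m` (`mseFinite_eq`), and the
transform is Lipschitz in `s`. Three further facts are therefore needed: existence of the limit, an
upper bound for small `β`, and a strict lower bound for every `β`.

Existence. Moving one point is a rank-one removal followed by a rank-one addition and changes the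
trace by at most one. Replacing the density `f` by `g` thus costs at most `m / n^d` times their L¹
distance (`abs_etaFinite_sub_density_le`), and the density may be taken continuous and bounded. The
Gram matrix of the exponentials is a product of Dirichlet kernels, whose squared modulus has mass
`n^d` concentrated at distances of order `1/n` (`exists_offCell_mass_le`). Cut the cube into `k^d`
cells with `k = n / R`. Discarding the Gram entries between different cells changes the trace by at
most their squared Hilbert–Schmidt norm (`abs_trace_resolvent_sub_blocks_le`), which in expectation
is a small multiple of `n^d` when `R` is large. The remaining cells contribute separately. The
number of points in a cell is binomial with a Poisson limit, the density is nearly constant on it,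
and the rescaled Gram matrix converges. The sum over cells hence tends to an integral of a Poisson
series in the local density (`tendsto_sum_cellTrace`). The limits obtained for different `R` are
never computed or compared: convergent approximations with arbitrarily small error already give the
Cauchy property (`exists_tendsto_of_approx`).

Upper bound. The trace is the least error of a linear estimator, so any filter bounds it. Weighting
the samples by `1/f` where `f > δ` makes the mean of `(1/m) ∑ w(x_q) e e^H` equal to the integral of
`e_z e_z^H` over `{f > δ}`. The error is then at most `1 - |{f > δ}|` plus a term of order `β / δ`
(`etaFinite_le`). Letting `β → 0` first and `δ → 0` afterwards gives `1 - |A|`, where `A` is now the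
covered set.

Lower bound. Since the `e_z` resolve the identity, the trace of the resolvent is the integral over
`z` of its diagonal values at `e_z`, and each of these is bounded below by a tangent line with a
free slope. Slope 1 is used where `f = 0`: the penalty there is the kernel mass leaking from the
sampling points into that region, and it is negligible (`IsDensity.leakage_le`). A constant slope
`t` is used elsewhere, and the best `t` leaves the strictly positive surplus `a² / (a + s)` with `a
= |A|` (`lt_etaLimit`). -/

theorem Matrix.PosSemidef.posDef_one_add {T : Matrix ι ι ℂ} (hT : T.PosSemidef) :
    (1 + T).PosDef :=
  PosDef.one.add_posSemidef hT

theorem Matrix.PosSemidef.isUnit_det_one_add {T : Matrix ι ι ℂ} (hT : T.PosSemidef) :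
    IsUnit (1 + T).det :=
  (isUnit_iff_isUnit_det _).1 hT.posDef_one_add.isUnit

theorem posSemidef_resolvent {T : Matrix ι ι ℂ} (hT : T.PosSemidef) :
    ((1 + T)⁻¹).PosSemidef :=
  hT.posDef_one_add.posSemidef.inv

/-- `1 - (1 + T)⁻¹ ≥ 0`. -/
theorem posSemidef_one_sub_resolvent {T : Matrix ι ι ℂ} (hT : T.PosSemidef) :
    (1 - (1 + T)⁻¹).PosSemidef := by
  have hu := hT.isUnit_det_one_add
  have hZ := (posSemidef_resolvent hT).isHermitian
  set Z := (1 + T)⁻¹ with hZdef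
  have h1 : Z * (1 + T) = 1 := nonsing_inv_mul _ hu
  have h2 : (1 + T) * Z = 1 := mul_nonsing_inv _ hu
  have hTT : (T + Tᴴ * T).PosSemidef := hT.add (posSemidef_conjTranspose_mul_self T)
  have h := hTT.conjTranspose_mul_mul_same Z
  rw [hZ.eq, hT.isHermitian.eq] at h
  have e : 1 - Z = Z * (T + T * T) * Z := by
    have : T + T * T = (1 + T) * (1 + T) - (1 + T) := by noncomm_ring
    rw [this, mul_sub, sub_mul, ← mul_assoc, h1, one_mul, h2, one_mul]
  rwa [e]

/-- `1 - (1 + T)⁻² ≥ 0`. -/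
theorem posSemidef_one_sub_resolvent_sq {T : Matrix ι ι ℂ} (hT : T.PosSemidef) :
    (1 - (1 + T)⁻¹ * (1 + T)⁻¹).PosSemidef := by
  have hu := hT.isUnit_det_one_add
  have hZ := (posSemidef_resolvent hT).isHermitian
  have hS := posSemidef_one_sub_resolvent hT
  set Z := (1 + T)⁻¹ with hZdef
  have h2 : (1 + T) * Z = 1 := mul_nonsing_inv _ hu
  have h := hT.conjTranspose_mul_mul_same Z
  rw [hZ.eq] at h
  have e : 1 - Z * Z = (1 - Z) + Z * T * Z := by
    have : T * Z = 1 - Z := by rw [← h2]; noncomm_ring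
    rw [mul_assoc, this]; noncomm_ring
  rw [e]
  exact hS.add h

theorem Matrix.PosSemidef.trace_re_nonneg {T : Matrix ι ι ℂ} (hT : T.PosSemidef) :
    0 ≤ T.trace.re :=
  (Complex.le_def.1 hT.trace_nonneg).1

theorem trace_resolvent_nonneg {T : Matrix ι ι ℂ} (hT : T.PosSemidef) :
    0 ≤ ((1 + T)⁻¹).trace.re :=
  (posSemidef_resolvent hT).trace_re_nonneg

theorem trace_resolvent_le_card {T : Matrix ι ι ℂ} (hT : T.PosSemidef) :
    ((1 + T)⁻¹).trace.re ≤ Fintype.card ι := by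
  have h := (posSemidef_one_sub_resolvent hT).trace_re_nonneg
  rw [trace_sub, trace_one, Complex.sub_re, Complex.natCast_re] at h
  linarith

/-- Passing from `A Aᴴ` to `Aᴴ A`. -/
theorem trace_resolvent_comm (A : Matrix ι κ ℂ) {τ : ℝ} (hτ : 0 ≤ τ) :
    ((1 + (τ : ℂ) • (A * Aᴴ))⁻¹).trace - (Fintype.card ι : ℂ)
      = ((1 + (τ : ℂ) • (Aᴴ * A))⁻¹).trace - (Fintype.card κ : ℂ) := by
  have hτ' : (0 : ℂ) ≤ (τ : ℂ) := by exact_mod_cast hτ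
  have hu1 := ((posSemidef_self_mul_conjTranspose A).smul hτ').isUnit_det_one_add
  have hu2 := ((posSemidef_conjTranspose_mul_self A).smul hτ').isUnit_det_one_add
  set X := (1 + (τ : ℂ) • (A * Aᴴ))⁻¹ with hX
  set Y := (1 + (τ : ℂ) • (Aᴴ * A))⁻¹ with hY
  have h1 : (1 + (τ : ℂ) • (A * Aᴴ)) * X = 1 := mul_nonsing_inv _ hu1
  have h1' : X * (1 + (τ : ℂ) • (A * Aᴴ)) = 1 := nonsing_inv_mul _ hu1
  have h2 : (1 + (τ : ℂ) • (Aᴴ * A)) * Y = 1 := mul_nonsing_inv _ hu2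
  -- Push-through identity. It turns `1 - X` and `1 - Y` into `τ` times `A Y Aᴴ` and `Aᴴ A Y`, whose
  -- traces agree by cyclicity.
  have hXA : X * A = A * Y := by
    have : (1 + (τ : ℂ) • (A * Aᴴ)) * A = A * (1 + (τ : ℂ) • (Aᴴ * A)) := by
      simp [Matrix.add_mul, Matrix.mul_add, Matrix.mul_assoc]
    calc X * A = X * (A * ((1 + (τ : ℂ) • (Aᴴ * A)) * Y)) := by rw [h2, Matrix.mul_one]
      _ = X * ((1 + (τ : ℂ) • (A * Aᴴ)) * A) * Y := by rw [this]; simp only [Matrix.mul_assoc]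
      _ = A * Y := by rw [← Matrix.mul_assoc X, h1', Matrix.one_mul]
  have e1 : X - 1 = -((τ : ℂ) • (X * A * Aᴴ)) := by
    have : X + (τ : ℂ) • (X * A * Aᴴ) = 1 := by
      rw [← h1', mul_add, mul_one, Matrix.mul_smul, Matrix.mul_assoc]
    rw [← this]; abel
  have e2 : Y - 1 = -((τ : ℂ) • (Aᴴ * A * Y)) := by
    have : Y + (τ : ℂ) • (Aᴴ * A * Y) = 1 := by
      rw [← h2, add_mul, one_mul, Matrix.smul_mul]
    rw [← this]; abel
  have t1 := congrArg trace e1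
  have t2 := congrArg trace e2
  rw [trace_sub, trace_one, trace_neg, trace_smul] at t1 t2
  rw [t1, t2, hXA, Matrix.mul_assoc Aᴴ A Y, trace_mul_comm (A * Y)]

/-- Pinching: if `T - T'` is trace-orthogonal to `(1 + T')⁻²`, the traces of the resolvents differ
by at most the squared Hilbert–Schmidt norm of `T - T'`. -/
theorem trace_resolvent_sub_mem {T T' : Matrix ι ι ℂ} (hT : T.PosSemidef) (hT' : T'.PosSemidef)
    (h0 : ((1 + T')⁻¹ * (1 + T')⁻¹ * (T - T')).trace = 0) :
    |((1 + T)⁻¹).trace.re - ((1 + T')⁻¹).trace.re| ≤ ((T - T') * (T - T')).trace.re := by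
  have hu := hT.isUnit_det_one_add
  have hu' := hT'.isUnit_det_one_add
  have hZ := posSemidef_resolvent hT
  have hZ' := posSemidef_resolvent hT'
  have hS := posSemidef_one_sub_resolvent hT
  have hS' := posSemidef_one_sub_resolvent_sq hT'
  set Z := (1 + T)⁻¹
  set Z' := (1 + T')⁻¹
  have h1 : Z * (1 + T) = 1 := nonsing_inv_mul _ hu
  have h1' : Z' * (1 + T') = 1 := nonsing_inv_mul _ hu'
  have h2 : (1 + T) * Z = 1 := mul_nonsing_inv _ hu
  have h2' : (1 + T') * Z' = 1 := mul_nonsing_inv _ hu'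
  set D := T - T' with hD
  have hDH : Dᴴ = D := by rw [hD, conjTranspose_sub, hT.isHermitian.eq, hT'.isHermitian.eq]
  have e1 : Z = Z' - Z' * D * Z := by
    have : D = (1 + T) - (1 + T') := by rw [hD]; abel
    rw [this, mul_sub, sub_mul, h1', mul_assoc, h2]; simp
  have e2 : Z = Z' - Z * D * Z' := by
    have : D = (1 + T) - (1 + T') := by rw [hD]; abel
    rw [this, mul_sub, sub_mul, h1, mul_assoc, h2']; simp
  -- Second-order resolvent expansion. The linear term is traceless by `h0`, and the quadratic
  -- remainder is positive semidefinite.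
  have e3 : Z - Z' = -(Z' * D * Z') + (D * Z')ᴴ * Z * (D * Z') := by
    rw [conjTranspose_mul, hDH, hZ'.isHermitian.eq]
    calc Z - Z' = -(Z' * D * Z) := by nth_rw 1 [e1]; abel
      _ = -(Z' * D * (Z' - Z * D * Z')) := by rw [← e2]
      _ = _ := by noncomm_ring
  clear_value D
  have t0 : (Z' * D * Z').trace = 0 := by
    rw [trace_mul_comm, ← mul_assoc, h0]
  have t1 : Z.trace.re - Z'.trace.re = ((D * Z')ᴴ * Z * (D * Z')).trace.re := by
    rw [← Complex.sub_re, ← trace_sub, e3, trace_add, trace_neg, t0, neg_zero, zero_add]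
  have n1 := (hZ.conjTranspose_mul_mul_same (D * Z')).trace_re_nonneg
  -- The remainder `Z' D Z D Z'` grows in trace when `Z` is replaced by 1, and again when the outer
  -- `Z'` are.
  have n2 := (hS.conjTranspose_mul_mul_same (D * Z')).trace_re_nonneg
  have n3 := (hS'.conjTranspose_mul_mul_same D).trace_re_nonneg
  rw [mul_sub, sub_mul, trace_sub, Complex.sub_re, mul_one] at n2 n3
  have t2 : ((D * Z')ᴴ * (D * Z')).trace = (Dᴴ * (Z' * Z') * D).trace := by
    rw [conjTranspose_mul, hDH, hZ'.isHermitian.eq, trace_mul_comm]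
    simp only [mul_assoc]
  rw [t1, abs_of_nonneg n1]
  rw [t2] at n2
  rw [hDH] at n3 n2
  linarith

/-- Adding a rank one term to `T` lowers the trace of the resolvent by at most one. -/
theorem trace_resolvent_rank_one {T : Matrix ι ι ℂ} (hT : T.PosSemidef) (v : ι → ℂ) {τ : ℝ}
    (hτ : 0 ≤ τ) :
    ((1 + (T + (τ : ℂ) • vecMulVec v (star v)))⁻¹).trace.re ≤ ((1 + T)⁻¹).trace.re ∧
    ((1 + T)⁻¹).trace.re ≤ ((1 + (T + (τ : ℂ) • vecMulVec v (star v)))⁻¹).trace.re + 1 := by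
  have hτ' : (0 : ℂ) ≤ (τ : ℂ) := by exact_mod_cast hτ
  have hT2 : (T + (τ : ℂ) • vecMulVec v (star v)).PosSemidef :=
    hT.add ((posSemidef_vecMulVec_self_star v).smul hτ')
  have hu := hT.isUnit_det_one_add
  have hu' := hT2.isUnit_det_one_add
  have hZ := posSemidef_resolvent hT
  have hZ' := posSemidef_resolvent hT2
  set Z := (1 + T)⁻¹ with hZd
  set Z' := (1 + (T + (τ : ℂ) • vecMulVec v (star v)))⁻¹
  have h1 : Z * (1 + T) = 1 := nonsing_inv_mul _ hu
  have h2 : (1 + T) * Z = 1 := mul_nonsing_inv _ hu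
  have h1' : Z' * (1 + (T + (τ : ℂ) • vecMulVec v (star v))) = 1 := nonsing_inv_mul _ hu'
  set w := Z *ᵥ v with hw
  set a : ℂ := star v ⬝ᵥ w with ha
  have ha0 : 0 ≤ a := hZ.dotProduct_mulVec_nonneg v
  -- Sherman–Morrison: the perturbed resolvent sends `v` to `w / (1 + τ a)`, so the trace drops by
  -- `τ ⟨w, w⟩ / (1 + τ a)`.
  have hP : (1 + (T + (τ : ℂ) • vecMulVec v (star v))) *ᵥ w = (1 + τ * a) • v := by
    rw [← add_assoc, add_mulVec, hw, mulVec_mulVec, h2, one_mulVec, ← hw, smul_mulVec,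
      vecMulVec_mulVec, ← ha, add_smul, one_smul, mul_smul]
    simp
  have hZ'v : (1 + τ * a) • (Z' *ᵥ v) = w := by
    rw [← mulVec_smul, ← hP, mulVec_mulVec, h1', one_mulVec]
  have e : Z - Z' = (τ : ℂ) • (Z' * vecMulVec v (star v) * Z) := by
    have : (τ : ℂ) • (Z' * vecMulVec v (star v) * Z)
        = Z' * ((1 + (T + (τ : ℂ) • vecMulVec v (star v))) - (1 + T)) * Z := by
      rw [show (1 + (T + (τ : ℂ) • vecMulVec v (star v))) - (1 + T)
        = (τ : ℂ) • vecMulVec v (star v) by abel]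
      simp
    rw [this, mul_sub, sub_mul, h1', mul_assoc Z', h2]; simp
  have hZv : star v ᵥ* Z = star w := by
    rw [hw, star_mulVec, hZ.isHermitian.eq]
  have t : Z.trace - Z'.trace = τ * (star w ⬝ᵥ (Z' *ᵥ v)) := by
    rw [← trace_sub, e, trace_smul, mul_vecMulVec, vecMulVec_mul, hZv, trace_vecMulVec,
      dotProduct_comm, smul_eq_mul]
  -- Here `a = ⟨w, (1 + T) w⟩`. This bound keeps the drop of the trace below `τ a / (1 + τ a) ≤ 1`.
  have hww : star w ⬝ᵥ w ≤ a := by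
    have hPw : star w ⬝ᵥ ((1 + T) *ᵥ w) = a := by
      rw [hw, mulVec_mulVec, h2, one_mulVec, ← hw, ha, hw, star_mulVec, hZ.isHermitian.eq,
        ← dotProduct_mulVec]
    rw [← hPw, add_mulVec, dotProduct_add, one_mulVec]
    exact le_add_of_nonneg_right (hT.dotProduct_mulVec_nonneg w)
  have hww0 : 0 ≤ star w ⬝ᵥ w := dotProduct_star_self_nonneg w
  have t' : (1 + τ * a) * (Z.trace - Z'.trace) = τ * (star w ⬝ᵥ w) := by
    rw [t]
    nth_rw 3 [← hZ'v]
    rw [dotProduct_smul, smul_eq_mul]; ring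
  obtain ⟨ar, har, har'⟩ : ∃ r : ℝ, 0 ≤ r ∧ a = r :=
    ⟨a.re, (Complex.le_def.1 ha0).1, Complex.ext rfl (Complex.le_def.1 ha0).2.symm⟩
  obtain ⟨b, hb, hb'⟩ : ∃ r : ℝ, 0 ≤ r ∧ star w ⬝ᵥ w = r :=
    ⟨_, (Complex.le_def.1 hww0).1, Complex.ext rfl (Complex.le_def.1 hww0).2.symm⟩
  rw [har', hb'] at hww t'
  have hba : b ≤ ar := by exact_mod_cast hww
  have t'' := congrArg Complex.re t'
  have hmul : (1 + τ * ar) * (Z.trace.re - Z'.trace.re) = τ * b := by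
    simpa using t''
  have hpos : 0 < 1 + τ * ar := by positivity
  have hle : τ * b ≤ τ * ar := by gcongr
  constructor
  · by_contra! h
    have : (1 + τ * ar) * (Z.trace.re - Z'.trace.re) < 0 :=
      mul_neg_of_pos_of_neg hpos (by linarith)
    have : 0 ≤ τ * b := by positivity
    linarith
  · by_contra! h
    have : (1 + τ * ar) * 1 < (1 + τ * ar) * (Z.trace.re - Z'.trace.re) :=
      mul_lt_mul_of_pos_left (by linarith) hpos
    linarith

/-- The tangent-line lower bound for a diagonal value of the resolvent. -/
theorem resolvent_quadratic_lower {T : Matrix ι ι ℂ} (hT : T.PosSemidef) (u : ι → ℂ) (y : ℝ) :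
    2 * y * (star u ⬝ᵥ u).re - y ^ 2 * (star u ⬝ᵥ ((1 + T) *ᵥ u)).re
      ≤ (star u ⬝ᵥ ((1 + T)⁻¹ *ᵥ u)).re := by
  have hu := hT.isUnit_det_one_add
  have hZ := posSemidef_resolvent hT
  set Z := (1 + T)⁻¹ with hZd
  have h1 : Z * (1 + T) = 1 := nonsing_inv_mul _ hu
  have h2 : (1 + T) * Z = 1 := mul_nonsing_inv _ hu
  -- Expanding the form of `1 + T` at `Z u - y u` completes the square; equality would mean `Z u = y
  -- u`.
  have h := hT.posDef_one_add.posSemidef.dotProduct_mulVec_nonneg (Z *ᵥ u - (y : ℂ) • u)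
  have e : star (Z *ᵥ u - (y : ℂ) • u) ⬝ᵥ ((1 + T) *ᵥ (Z *ᵥ u - (y : ℂ) • u))
      = star u ⬝ᵥ (Z *ᵥ u) - 2 * y * (star u ⬝ᵥ u)
        + y ^ 2 * (star u ⬝ᵥ ((1 + T) *ᵥ u)) := by
    have h3 : star (Z *ᵥ u) ⬝ᵥ ((1 + T) *ᵥ u) = star u ⬝ᵥ u := by
      rw [star_mulVec, hZ.isHermitian.eq, ← dotProduct_mulVec, mulVec_mulVec, h1, one_mulVec]
    have h4 : star (Z *ᵥ u) ⬝ᵥ u = star u ⬝ᵥ (Z *ᵥ u) := by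
      rw [star_mulVec, hZ.isHermitian.eq, ← dotProduct_mulVec]
    rw [mulVec_sub, mulVec_smul, mulVec_mulVec, h2, one_mulVec, star_sub, star_smul,
      sub_dotProduct, dotProduct_sub, dotProduct_sub, dotProduct_smul, smul_dotProduct,
      smul_dotProduct, dotProduct_smul, h3, h4]
    simp only [Complex.star_def, Complex.conj_ofReal, smul_eq_mul]
    ring
  rw [e] at h
  have hre := (Complex.le_def.1 h).1
  have e' : (star u ⬝ᵥ (Z *ᵥ u) - 2 * y * (star u ⬝ᵥ u)
        + y ^ 2 * (star u ⬝ᵥ ((1 + T) *ᵥ u))).re = (star u ⬝ᵥ (Z *ᵥ u)).re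
        - 2 * y * (star u ⬝ᵥ u).re + y ^ 2 * (star u ⬝ᵥ ((1 + T) *ᵥ u)).re := by
    rw [Complex.add_re, Complex.sub_re]
    rw [show (2 * y : ℂ) = ((2 * y : ℝ) : ℂ) by push_cast; ring,
      show (y ^ 2 : ℂ) = ((y ^ 2 : ℝ) : ℂ) by push_cast; ring, Complex.re_ofReal_mul,
      Complex.re_ofReal_mul]
  rw [e', Complex.zero_re] at hre
  linarith

/-- The tangent inequality for the convex function `T ↦ Tr (1 + T)⁻¹`. -/
theorem trace_resolvent_tangent {T T' : Matrix ι ι ℂ} (hT : T.PosSemidef) (hT' : T'.PosSemidef) :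
    ((1 + T')⁻¹ * (T' - T) * (1 + T')⁻¹).trace.re
      ≤ ((1 + T)⁻¹).trace.re - ((1 + T')⁻¹).trace.re := by
  have hu := hT.isUnit_det_one_add
  have hu' := hT'.isUnit_det_one_add
  have hZ := posSemidef_resolvent hT
  have hZ' := posSemidef_resolvent hT'
  set Z := (1 + T)⁻¹
  set Y := (1 + T')⁻¹
  have h1 : Z * (1 + T) = 1 := nonsing_inv_mul _ hu
  have h2 : (1 + T) * Z = 1 := mul_nonsing_inv _ hu
  have h2' : (1 + T') * Y = 1 := mul_nonsing_inv _ hu'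
  -- Convexity as a square: `(Z - Y)(1 + T)(Z - Y)` is the gap between `Z` and its tangent at `T'`.
  have h := (hT.posDef_one_add.posSemidef.conjTranspose_mul_mul_same (Z - Y)).trace_re_nonneg
  have e : (Z - Y)ᴴ * (1 + T) * (Z - Y) = Z - Y - Y * (T' - T) * Y := by
    rw [conjTranspose_sub, hZ.isHermitian.eq, hZ'.isHermitian.eq]
    calc (Z - Y) * (1 + T) * (Z - Y)
        = Z * (1 + T) * Z - Z * (1 + T) * Y - Y * ((1 + T) * Z) + Y * (1 + T) * Y := by
          noncomm_ring
      _ = Z - Y - Y * ((1 + T') * Y) + Y * (1 + T) * Y := by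
          rw [h1, h2, h2']; simp
      _ = _ := by noncomm_ring
  rw [e, trace_sub, trace_sub, Complex.sub_re, Complex.sub_re] at h
  linarith

/-- Controls the derivative of the trace in the scaling parameter; the upper bound comes from `(1 +
T')⁻² ≤ 0 + 1` after cycling the trace. -/
theorem trace_resolvent_mul_le (A : Matrix ι κ ℂ) {T' : Matrix ι ι ℂ} (hT' : T'.PosSemidef) :
    0 ≤ ((1 + T')⁻¹ * (A * Aᴴ) * (1 + T')⁻¹).trace.re ∧
    ((1 + T')⁻¹ * (A * Aᴴ) * (1 + T')⁻¹).trace.re ≤ (A * Aᴴ).trace.re := by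
  have hZ' := posSemidef_resolvent hT'
  have hS := (posSemidef_one_sub_resolvent_sq hT').conjTranspose_mul_mul_same A
  set Y := (1 + T')⁻¹
  have h0 := ((posSemidef_self_mul_conjTranspose A).conjTranspose_mul_mul_same Y).trace_re_nonneg
  rw [hZ'.isHermitian.eq] at h0
  refine ⟨h0, ?_⟩
  have h := hS.trace_re_nonneg
  rw [Matrix.mul_sub, Matrix.sub_mul, Matrix.mul_one, trace_sub, Complex.sub_re,
    trace_mul_comm Aᴴ A, trace_mul_comm _ A, ← Matrix.mul_assoc A, ← mul_assoc,
    trace_mul_comm _ Y, ← mul_assoc] at h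
  linarith

/-- The trace of the resolvent is Lipschitz in the parameter. -/
theorem abs_trace_resolvent_smul_sub_le (A : Matrix ι κ ℂ) {τ τ' : ℝ} (hτ : 0 ≤ τ)
    (hτ' : 0 ≤ τ') :
    |((1 + (τ : ℂ) • (A * Aᴴ))⁻¹).trace.re - ((1 + (τ' : ℂ) • (A * Aᴴ))⁻¹).trace.re|
      ≤ |τ - τ'| * (A * Aᴴ).trace.re := by
  -- The tangent inequality bounds the difference from one side only; exchanging the two parameters
  -- gives the other side.
  have key : ∀ {a b : ℝ}, 0 ≤ a → 0 ≤ b →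
      -(|a - b| * (A * Aᴴ).trace.re) ≤
      ((1 + (a : ℂ) • (A * Aᴴ))⁻¹).trace.re - ((1 + (b : ℂ) • (A * Aᴴ))⁻¹).trace.re := by
    intro a b ha hb
    have hT := (posSemidef_self_mul_conjTranspose A).smul
      (by exact_mod_cast ha : (0 : ℂ) ≤ (a : ℂ))
    have hT' := (posSemidef_self_mul_conjTranspose A).smul
      (by exact_mod_cast hb : (0 : ℂ) ≤ (b : ℂ))
    refine le_trans ?_ (trace_resolvent_tangent hT hT')
    obtain ⟨h0, h1⟩ := trace_resolvent_mul_le A hT'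
    have e : (1 + (b : ℂ) • (A * Aᴴ))⁻¹ * ((b : ℂ) • (A * Aᴴ) - (a : ℂ) • (A * Aᴴ)) *
        (1 + (b : ℂ) • (A * Aᴴ))⁻¹ = ((b - a : ℝ) : ℂ) • ((1 + (b : ℂ) • (A * Aᴴ))⁻¹ * (A * Aᴴ) *
        (1 + (b : ℂ) • (A * Aᴴ))⁻¹) := by
      rw [← sub_smul, Matrix.mul_smul, Matrix.smul_mul, Complex.ofReal_sub]
    rw [e, trace_smul, smul_eq_mul, Complex.re_ofReal_mul]
    set t := ((1 + (b : ℂ) • (A * Aᴴ))⁻¹ * (A * Aᴴ) * (1 + (b : ℂ) • (A * Aᴴ))⁻¹).trace.re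
    have h2 : |a - b| * t ≤ |a - b| * (A * Aᴴ).trace.re :=
      mul_le_mul_of_nonneg_left h1 (abs_nonneg _)
    have h3 : -(|a - b| * t) ≤ (b - a) * t := by
      rw [← neg_mul]
      exact mul_le_mul_of_nonneg_right (by linarith [le_abs_self (a - b)]) h0
    linarith
  rw [abs_le]
  refine ⟨key hτ hτ', ?_⟩
  have := key hτ' hτ
  rw [abs_sub_comm] at this
  linarith

/-- Upper bound for the trace of the resolvent by the error of the linear estimator with the
diagonal weights `w`. -/
theorem trace_resolvent_le_estimator (A : Matrix ι κ ℂ) {τ : ℝ} (hτ : 0 ≤ τ) (w : κ → ℝ) :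
    ((1 + (τ : ℂ) • (A * Aᴴ))⁻¹).trace.re ≤ Fintype.card ι
      - 2 * (τ * ∑ q, w q * ((Aᴴ * A) q q).re)
      + τ ^ 2 * ∑ q, ∑ r, w q * w r * ‖(Aᴴ * A) q r‖ ^ 2
      + τ * ∑ q, w q ^ 2 * ((Aᴴ * A) q q).re := by
  -- The square root of `τ` is absorbed into the matrix, so that the observation is `Uᴴ a` plus unit
  -- noise and the estimator is `U D`.
  obtain ⟨c, hc⟩ : ∃ c : ℝ, τ = c * c := ⟨Real.sqrt τ, (Real.mul_self_sqrt hτ).symm⟩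
  set U : Matrix ι κ ℂ := (c : ℂ) • A with hU
  set D : Matrix κ κ ℂ := diagonal fun q => (w q : ℂ) with hD
  have hUU : U * Uᴴ = (τ : ℂ) • (A * Aᴴ) := by
    rw [hU, conjTranspose_smul, Matrix.smul_mul, Matrix.mul_smul, smul_smul, hc]
    simp
  have hUU' : Uᴴ * U = (τ : ℂ) • (Aᴴ * A) := by
    rw [hU, conjTranspose_smul, Matrix.smul_mul, Matrix.mul_smul, smul_smul, hc]
    simp
  have hDH : Dᴴ = D := by
    rw [hD, diagonal_conjTranspose]
    congr 1
    ext q; simp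
  rw [← hUU]
  have hT := posSemidef_self_mul_conjTranspose U
  have hu := hT.isUnit_det_one_add
  have hZ := (posSemidef_resolvent hT).isHermitian
  set Z := (1 + U * Uᴴ)⁻¹
  have h1 : Z * (1 + U * Uᴴ) = 1 := nonsing_inv_mul _ hu
  have h2 : (1 + U * Uᴴ) * Z = 1 := mul_nonsing_inv _ hu
  have hR : ((1 : Matrix κ κ ℂ) + Uᴴ * U).PosSemidef :=
    (posSemidef_conjTranspose_mul_self U).posDef_one_add.posSemidef
  -- The optimal filter is `Z U = U (1 + Uᴴ U)⁻¹`. This nonnegative trace is the excess error of `U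
  -- D` over it.
  have hpos := (hR.mul_mul_conjTranspose_same (U * D - Z * U)).trace_re_nonneg
  have e : (U * D - Z * U) * (1 + Uᴴ * U) * (U * D - Z * U)ᴴ
      = U * D * D * Uᴴ + U * D * Uᴴ * (U * D * Uᴴ) - U * D * Uᴴ - U * D * Uᴴ + (1 - Z) := by
    rw [conjTranspose_sub, conjTranspose_mul, conjTranspose_mul, hDH, hZ.eq]
    have p1 : (1 + Uᴴ * U) * Uᴴ * Z = Uᴴ := by
      have : (1 + Uᴴ * U) * Uᴴ = Uᴴ * (1 + U * Uᴴ) := by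
        rw [Matrix.add_mul, Matrix.mul_add, Matrix.one_mul, Matrix.mul_one, Matrix.mul_assoc]
      rw [this, Matrix.mul_assoc, h2, Matrix.mul_one]
    have p2 : Z * U * (1 + Uᴴ * U) = U := by
      have : U * (1 + Uᴴ * U) = (1 + U * Uᴴ) * U := by
        rw [Matrix.add_mul, Matrix.mul_add, Matrix.one_mul, Matrix.mul_one, Matrix.mul_assoc]
      rw [Matrix.mul_assoc, this, ← Matrix.mul_assoc, h1, Matrix.one_mul]
    have p3 : U * Uᴴ * Z = 1 - Z := by
      rw [← h2, Matrix.add_mul, Matrix.one_mul, add_sub_cancel_left]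
    rw [Matrix.sub_mul, p2, Matrix.mul_sub, Matrix.sub_mul, Matrix.sub_mul, ← Matrix.mul_assoc U,
      ← Matrix.mul_assoc U Uᴴ, p3, Matrix.mul_assoc (U * D) (1 + Uᴴ * U) (Uᴴ * Z),
      ← Matrix.mul_assoc (1 + Uᴴ * U) Uᴴ Z, p1, Matrix.mul_add (U * D), Matrix.add_mul,
      Matrix.mul_one]
    simp only [Matrix.mul_assoc]
    abel
  rw [e] at hpos
  simp only [trace_add, trace_sub, trace_one, Complex.add_re, Complex.sub_re,
    Complex.natCast_re] at hpos
  have t1 : (U * D * Uᴴ).trace.re = τ * ∑ q, w q * ((Aᴴ * A) q q).re := by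
    rw [trace_mul_comm, ← Matrix.mul_assoc, hUU', Matrix.smul_mul, trace_smul, smul_eq_mul,
      Complex.re_ofReal_mul]
    congr 1
    rw [trace, Complex.re_sum]
    refine Finset.sum_congr rfl fun q _ => ?_
    rw [diag_apply, hD, mul_diagonal, Complex.re_mul_ofReal, mul_comm]
  have t2 : (U * D * D * Uᴴ).trace.re = τ * ∑ q, w q ^ 2 * ((Aᴴ * A) q q).re := by
    rw [Matrix.mul_assoc U D D, trace_mul_comm, ← Matrix.mul_assoc, hUU', Matrix.smul_mul,
      trace_smul, smul_eq_mul, Complex.re_ofReal_mul]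
    congr 1
    rw [trace, Complex.re_sum]
    refine Finset.sum_congr rfl fun q _ => ?_
    rw [diag_apply, hD, diagonal_mul_diagonal, mul_diagonal, ← Complex.ofReal_mul,
      Complex.re_mul_ofReal, mul_comm, sq]
  have t3 : (U * D * Uᴴ * (U * D * Uᴴ)).trace.re
      = τ ^ 2 * ∑ q, ∑ r, w q * w r * ‖(Aᴴ * A) q r‖ ^ 2 := by
    have e1 : (U * D * Uᴴ * (U * D * Uᴴ)).trace = ((Uᴴ * U * D) * (Uᴴ * U * D)).trace := by
      simp only [Matrix.mul_assoc]
      rw [trace_mul_comm U]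
      simp only [Matrix.mul_assoc]
      rw [trace_mul_comm D]
      simp only [Matrix.mul_assoc]
    have hG := (isHermitian_conjTranspose_mul_self A)
    rw [e1, hUU', Matrix.smul_mul, Matrix.smul_mul, Matrix.mul_smul, smul_smul, trace_smul,
      smul_eq_mul, ← Complex.ofReal_mul, Complex.re_ofReal_mul, ← sq]
    congr 1
    rw [trace, Complex.re_sum]
    refine Finset.sum_congr rfl fun q _ => ?_
    rw [diag_apply, mul_apply, Complex.re_sum]
    refine Finset.sum_congr rfl fun r _ => ?_
    rw [hD, mul_diagonal, mul_diagonal, ← hG.apply r q]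
    rw [show (Aᴴ * A) q r * (w r : ℂ) * (star ((Aᴴ * A) q r) * (w q : ℂ))
      = ((w q * w r : ℝ) : ℂ) * ((Aᴴ * A) q r * star ((Aᴴ * A) q r)) by push_cast; ring,
      Complex.star_def, Complex.mul_conj, Complex.re_ofReal_mul, Complex.ofReal_re,
      Complex.normSq_eq_norm_sq]
  rw [t1, t2, t3] at hpos
  linarith

/-- With `A B = 0` the matrix `1 + A + B` factors as `(1 + A)(1 + B)`, and the defects `1 - X`, `1 -
Y` of the two resolvents multiply to zero. The trace of the defect is therefore additive. -/
theorem trace_resolvent_add_of_mul_eq_zero {A B : Matrix ι ι ℂ} (hA : A.PosSemidef)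
    (hB : B.PosSemidef) (hAB : A * B = 0) :
    (Fintype.card ι : ℝ) - ((1 + (A + B))⁻¹).trace.re
      = (Fintype.card ι - ((1 + A)⁻¹).trace.re) + (Fintype.card ι - ((1 + B)⁻¹).trace.re) := by
  have huA := hA.isUnit_det_one_add
  have huB := hB.isUnit_det_one_add
  have e : (1 : Matrix ι ι ℂ) + (A + B) = (1 + A) * (1 + B) := by
    rw [mul_add, add_mul, mul_one, add_mul, hAB]; simp; abel
  rw [e, Matrix.mul_inv_rev]
  set X := (1 + A)⁻¹
  set Y := (1 + B)⁻¹
  have h1 : X * (1 + A) = 1 := nonsing_inv_mul _ huA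
  have h2 : (1 + A) * X = 1 := mul_nonsing_inv _ huA
  have h3 : Y * (1 + B) = 1 := nonsing_inv_mul _ huB
  have h4 : (1 + B) * Y = 1 := mul_nonsing_inv _ huB
  have eX : 1 - X = X * A := by
    rw [← h1]; noncomm_ring
  have eY : 1 - Y = B * Y := by
    rw [← h4]; noncomm_ring
  have hz : (1 - X) * (1 - Y) = 0 := by
    rw [eX, eY, mul_assoc, ← mul_assoc A, hAB, zero_mul, mul_zero]
  have ht := congrArg trace hz
  have hex : (1 - X) * (1 - Y) = 1 - X - Y + X * Y := by noncomm_ring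
  rw [hex, trace_add, trace_sub, trace_sub, trace_one, trace_zero] at ht
  have hre := congrArg Complex.re ht
  simp only [Complex.add_re, Complex.sub_re, Complex.natCast_re, Complex.zero_re] at hre
  rw [trace_mul_comm]
  linarith

theorem trace_resolvent_sum_orthogonal {I : Type*} [DecidableEq I] (S : Finset I)
    {A : I → Matrix ι ι ℂ} (hA : ∀ i, (A i).PosSemidef) (hAB : ∀ i j, i ≠ j → A i * A j = 0) :
    (Fintype.card ι : ℝ) - ((1 + ∑ i ∈ S, A i)⁻¹).trace.re
      = ∑ i ∈ S, (Fintype.card ι - ((1 + A i)⁻¹).trace.re) := by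
  induction S using Finset.induction_on with
  | empty => simp
  | insert a S ha ih =>
    rw [Finset.sum_insert ha, Finset.sum_insert ha, ← ih]
    refine trace_resolvent_add_of_mul_eq_zero (hA a) (posSemidef_sum _ fun i _ => hA i) ?_
    rw [Finset.mul_sum]
    exact Finset.sum_eq_zero fun i hi => hAB a i fun h => ha (h ▸ hi)

theorem trace_mul_self_hermitian {D : Matrix ι ι ℂ} (hD : D.IsHermitian) :
    (D * D).trace.re = ∑ i, ∑ j, ‖D i j‖ ^ 2 := by
  simp only [trace, diag_apply, mul_apply, Complex.re_sum]
  refine Finset.sum_congr rfl fun i _ => Finset.sum_congr rfl fun j _ => ?_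
  rw [← hD.apply j i, ← Complex.normSq_eq_norm_sq, Complex.star_def, Complex.mul_conj,
    Complex.ofReal_re]

/-! ### Pinching a matrix to its diagonal blocks. -/

section Blocks

variable {I : Type*} [Fintype I] [DecidableEq I]

theorem diagonal_mul_mul_diagonal_posSemidef {T : Matrix ι ι ℂ} (hT : T.PosSemidef)
    (p : ι → ℝ) :
    (diagonal (fun q => (p q : ℂ)) * T * diagonal (fun q => (p q : ℂ))).PosSemidef := by
  have h := hT.conjTranspose_mul_mul_same (diagonal (fun q => (p q : ℂ)))
  rwa [diagonal_conjTranspose, show star (fun q => (p q : ℂ)) = fun q => (p q : ℂ) by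
    ext q; simp] at h

/-- Replacing `T` by its block-diagonal part changes the trace of the resolvent by at most the
squared Hilbert–Schmidt norm of the removed entries, and the trace of the resolvent of the
block-diagonal part is a sum over the blocks. -/
theorem abs_trace_resolvent_sub_blocks_le {T : Matrix ι ι ℂ} (hT : T.PosSemidef)
    (p : I → ι → ℝ) (hp : ∀ i j q, p i q * p j q = if i = j then p i q else 0)
    (hp1 : ∀ q, ∑ i, p i q = 1) :
    |((1 + T)⁻¹).trace.re - (Fintype.card ι - ∑ i, (Fintype.card ι -
      ((1 + diagonal (fun q => (p i q : ℂ)) * T * diagonal (fun q => (p i q : ℂ)))⁻¹).trace.re))|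
      ≤ ∑ q, ∑ r, (1 - ∑ i, p i q * p i r) ^ 2 * ‖T q r‖ ^ 2 := by
  set P : I → Matrix ι ι ℂ := fun i => diagonal (fun q => (p i q : ℂ)) with hP
  have hPP : ∀ i j, P i * P j = if i = j then P i else 0 := by
    intro i j
    rw [hP]
    simp only [diagonal_mul_diagonal, ← Complex.ofReal_mul, hp]
    split_ifs <;> simp
  have hPs : ∑ i, P i = 1 := by
    ext q r
    rw [Matrix.sum_apply, one_apply]
    by_cases h : q = r
    · subst h; simp [hP]; exact_mod_cast hp1 q
    · simp [hP, h]
  set A : I → Matrix ι ι ℂ := fun i => P i * T * P i with hA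
  have hApos : ∀ i, (A i).PosSemidef := fun i => diagonal_mul_mul_diagonal_posSemidef hT _
  have hAA : ∀ i j, i ≠ j → A i * A j = 0 := by
    intro i j hij
    simp only [hA]
    rw [mul_assoc (P i * T), ← mul_assoc (P i) (P j * T), ← mul_assoc (P i) (P j), hPP,
      if_neg hij]
    simp
  have hadd := trace_resolvent_sum_orthogonal Finset.univ hApos hAA
  change |_ - (_ - ∑ i, (_ - ((1 + A i)⁻¹).trace.re))| ≤ _
  rw [← hadd, sub_sub_cancel]
  set T' := ∑ i, A i with hT'
  have hT'pos : T'.PosSemidef := posSemidef_sum _ fun i _ => hApos i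
  have hcomm : ∀ i, P i * T' = T' * P i := by
    intro i
    rw [hT', Finset.mul_sum, Finset.sum_mul]
    refine Finset.sum_congr rfl fun j _ => ?_
    simp only [hA]
    rw [← mul_assoc, ← mul_assoc, hPP, mul_assoc (P j * T), hPP]
    by_cases h : i = j
    · simp [h]
    · simp [h, Ne.symm h]
  have hu' := hT'pos.isUnit_det_one_add
  have hZcomm : ∀ i, P i * (1 + T')⁻¹ = (1 + T')⁻¹ * P i := by
    intro i
    set Z' := (1 + T')⁻¹
    have h1' : Z' * (1 + T') = 1 := nonsing_inv_mul _ hu'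
    have h2' : (1 + T') * Z' = 1 := mul_nonsing_inv _ hu'
    have hc : P i * (1 + T') = (1 + T') * P i := by rw [mul_add, add_mul, hcomm]; simp
    calc P i * Z' = Z' * (1 + T') * P i * Z' := by rw [h1', one_mul]
      _ = Z' * (P i * (1 + T')) * Z' := by rw [hc, ← mul_assoc]
      _ = Z' * P i := by rw [mul_assoc, mul_assoc, h2', mul_one]
  -- `(1 + T')⁻²` commutes with every block projection, so its trace against `T` sees only the
  -- diagonal blocks of `T`.
  have h0 : ((1 + T')⁻¹ * (1 + T')⁻¹ * (T - T')).trace = 0 := by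
    set W := (1 + T')⁻¹ * (1 + T')⁻¹ with hW
    have hWc : ∀ i, P i * W = W * P i := by
      intro i
      rw [hW, ← mul_assoc, hZcomm, mul_assoc, hZcomm, mul_assoc]
    have : (W * T').trace = (W * T).trace := by
      rw [hT', Finset.mul_sum, trace_sum]
      calc ∑ i, (W * A i).trace = ∑ i, (W * P i * T).trace := by
            refine Finset.sum_congr rfl fun i _ => ?_
            simp only [hA]
            rw [← mul_assoc, trace_mul_comm, ← mul_assoc, ← mul_assoc, hWc, mul_assoc W, hPP,
              if_pos rfl]
        _ = (W * T).trace := by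
            rw [← trace_sum, ← Finset.sum_mul, ← Finset.mul_sum, hPs, mul_one]
    rw [mul_sub, trace_sub, this, sub_self]
  refine (trace_resolvent_sub_mem hT hT'pos h0).trans (le_of_eq ?_)
  rw [trace_mul_self_hermitian (hT.isHermitian.sub hT'pos.isHermitian)]
  refine Finset.sum_congr rfl fun q _ => Finset.sum_congr rfl fun r _ => ?_
  have : (T - T') q r = ((1 - ∑ i, p i q * p i r : ℝ) : ℂ) * T q r := by
    rw [Matrix.sub_apply, hT', Matrix.sum_apply]
    simp only [hA, hP, mul_diagonal, diagonal_mul]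
    push_cast
    rw [sub_mul, Finset.sum_mul, one_mul]
    congr 1
    exact Finset.sum_congr rfl fun i _ => by ring
  rw [this, norm_mul, mul_pow, Complex.norm_real, Real.norm_eq_abs, sq_abs]

end Blocks

end MatrixLemmas

/-! ### The Dirichlet kernel: mass, decay, and concentration on grid cells. -/

section FourierKernel

open Complex (exp I)

/-- The one-dimensional Dirichlet sum `∑_{l < n} e^{-2πi l u}`. -/
noncomputable def dirichletSum (n : ℕ) (u : ℝ) : ℂ :=
  ∑ l : Fin n, exp (-2 * Real.pi * I * (l : ℕ) * u)

/-- The vector of the exponentials at a sampling point. -/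
noncomputable def fourierVec (d n : ℕ) (x : Fin d → ℝ) (l : Fin d → Fin n) : ℂ :=
  exp (-2 * Real.pi * I * ∑ j, ((l j : ℕ) : ℂ) * ((x j : ℝ) : ℂ))

/-- The Gram kernel of the exponentials. -/
noncomputable def fourierKernel (d n : ℕ) (x y : Fin d → ℝ) : ℂ :=
  star (fourierVec d n x) ⬝ᵥ fourierVec d n y

variable {d n : ℕ}

theorem star_fourierVec (x : Fin d → ℝ) (l : Fin d → Fin n) :
    star (fourierVec d n x l) = exp (2 * Real.pi * I * ∑ j, ((l j : ℕ) : ℂ) * ((x j : ℝ) : ℂ)) := by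
  rw [fourierVec, Complex.star_def, ← Complex.exp_conj]
  congr 1
  simp [map_ofNat]

theorem continuous_fourierVec (l : Fin d → Fin n) : Continuous fun x => fourierVec d n x l := by
  unfold fourierVec
  fun_prop

theorem fourierKernel_eq_prod (x y : Fin d → ℝ) :
    fourierKernel d n x y = ∏ j, dirichletSum n (y j - x j) := by
  have h : ∀ l : Fin d → Fin n, star (fourierVec d n x) l * fourierVec d n y l
      = ∏ j, exp (-2 * Real.pi * I * (l j : ℕ) * (y j - x j : ℝ)) := by
    intro l
    rw [Pi.star_apply, star_fourierVec, fourierVec, ← Complex.exp_add, ← Complex.exp_sum,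
      Finset.mul_sum, Finset.mul_sum, ← Finset.sum_add_distrib]
    congr 1
    refine Finset.sum_congr rfl fun j _ => ?_
    push_cast; ring
  simp only [fourierKernel, dotProduct, h, dirichletSum]
  rw [Finset.prod_univ_sum, Fintype.piFinset_univ]

theorem fourierKernel_self (x : Fin d → ℝ) : fourierKernel d n x x = (n : ℂ) ^ d := by
  simp [fourierKernel_eq_prod, dirichletSum]

/-- Translation invariance, by which all grid cells can be moved to the same place. -/
theorem fourierKernel_eq_of_sub_eq {x y x' y' : Fin d → ℝ} (h : y - x = y' - x') :
    fourierKernel d n x y = fourierKernel d n x' y' := by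
  simp only [fourierKernel_eq_prod]
  exact Finset.prod_congr rfl fun j _ => by rw [← Pi.sub_apply, h, Pi.sub_apply]

theorem star_fourierKernel (x y : Fin d → ℝ) :
    star (fourierKernel d n x y) = fourierKernel d n y x := by
  rw [fourierKernel, fourierKernel, Matrix.star_dotProduct, star_star, dotProduct_comm]

theorem continuous_dirichletSum : Continuous (dirichletSum n) := by
  unfold dirichletSum
  fun_prop

theorem continuous_fourierKernel :
    Continuous fun p : (Fin d → ℝ) × (Fin d → ℝ) => fourierKernel d n p.1 p.2 := by
  simp only [fourierKernel_eq_prod]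
  exact continuous_finsetProd _ fun j _ => continuous_dirichletSum.comp (by fun_prop)

theorem norm_dirichletSum_le (u : ℝ) : ‖dirichletSum n u‖ ≤ n := by
  refine (norm_sum_le _ _).trans ?_
  have : ∀ l : Fin n, ‖exp (-2 * Real.pi * I * (l : ℕ) * u)‖ = 1 := by
    intro l
    rw [show (-2 * Real.pi * I * (l : ℕ) * u : ℂ) = ((-2 * Real.pi * l * u : ℝ) : ℂ) * I by
      push_cast; ring]
    exact Complex.norm_exp_ofReal_mul_I _
  simp only [this]
  simp

theorem norm_fourierKernel_le (x y : Fin d → ℝ) : ‖fourierKernel d n x y‖ ≤ (n : ℝ) ^ d := by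
  rw [fourierKernel_eq_prod, norm_prod]
  refine (Finset.prod_le_prod (fun _ _ => norm_nonneg _)
    fun j _ => norm_dirichletSum_le _).trans ?_
  simp

theorem norm_sq_fourierKernel (x y : Fin d → ℝ) :
    ‖fourierKernel d n x y‖ ^ 2 = ∏ j, ‖dirichletSum n (y j - x j)‖ ^ 2 := by
  rw [fourierKernel_eq_prod, norm_prod, Finset.prod_pow]

theorem integral_exp_int_mul (k : ℤ) :
    ∫ t in Set.Ico (-1 / 2 : ℝ) (1 / 2), exp (2 * Real.pi * I * k * t)
      = if k = 0 then 1 else 0 := by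
  rw [integral_Ico_eq_integral_Ioc, ← intervalIntegral.integral_of_le (by norm_num)]
  split_ifs with h
  · subst h; simp; norm_num
  · have hc : (2 * Real.pi * I * k : ℂ) ≠ 0 := by
      simp [Real.pi_ne_zero, h]
    rw [integral_exp_mul_complex hc, div_eq_zero_iff]
    left
    rw [sub_eq_zero, Complex.exp_eq_exp_iff_exists_int]
    exact ⟨k, by push_cast; ring⟩

theorem norm_sq_dirichletSum (u : ℝ) :
    ((‖dirichletSum n u‖ ^ 2 : ℝ) : ℂ)
      = ∑ l : Fin n, ∑ l' : Fin n, exp (2 * Real.pi * I * (((l' : ℕ) - (l : ℕ) : ℤ) : ℂ) * u) := by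
  rw [← Complex.normSq_eq_norm_sq, ← Complex.mul_conj, dirichletSum, map_sum, Finset.sum_mul_sum]
  refine Finset.sum_congr rfl fun l _ => Finset.sum_congr rfl fun l' _ => ?_
  rw [← Complex.exp_conj, ← Complex.exp_add]
  congr 1
  simp [map_ofNat]
  ring

/-- Parseval over one period. The shift `x` enters only through a phase that is 1 on the diagonal
terms, the only ones that survive. -/
theorem integral_norm_sq_dirichletSum (x : ℝ) :
    ∫ y in Set.Ico (-1 / 2 : ℝ) (1 / 2), ‖dirichletSum n (y - x)‖ ^ 2 = n := by
  have h : ((∫ y in Set.Ico (-1 / 2 : ℝ) (1 / 2), ‖dirichletSum n (y - x)‖ ^ 2 : ℝ) : ℂ) = n := by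
    rw [← integral_complex_ofReal]
    simp only [norm_sq_dirichletSum]
    have e : ∀ (l l' : Fin n) (y : ℝ),
        exp (2 * Real.pi * I * (((l' : ℕ) - (l : ℕ) : ℤ) : ℂ) * (y - x : ℝ))
        = exp (2 * Real.pi * I * (((l' : ℕ) - (l : ℕ) : ℤ) : ℂ) * (-x : ℝ)) *
          exp (2 * Real.pi * I * (((l' : ℕ) - (l : ℕ) : ℤ) : ℂ) * y) := by
      intro l l' y
      rw [← Complex.exp_add]; congr 1; push_cast; ring
    have hint : ∀ (c k : ℂ), IntegrableOn (fun y : ℝ => c * exp (2 * Real.pi * I * k * y))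
        (Set.Ico (-1 / 2 : ℝ) (1 / 2)) := by
      intro c k
      exact (Continuous.integrableOn_Icc (by fun_prop)).mono_set Set.Ico_subset_Icc_self
    simp only [e]
    rw [integral_finsetSum _ fun l _ => integrable_finsetSum _ fun l' _ => hint _ _]
    have : ∀ l : Fin n, ∫ y in Set.Ico (-1 / 2 : ℝ) (1 / 2), ∑ l' : Fin n,
        exp (2 * Real.pi * I * (((l' : ℕ) - (l : ℕ) : ℤ) : ℂ) * (-x : ℝ)) *
          exp (2 * Real.pi * I * (((l' : ℕ) - (l : ℕ) : ℤ) : ℂ) * y) = 1 := by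
      intro l
      rw [integral_finsetSum _ fun l' _ => hint _ _]
      simp only [integral_const_mul, integral_exp_int_mul]
      rw [Finset.sum_eq_single l]
      · simp
      · intro l' _ hl
        rw [if_neg, mul_zero]
        have : (l' : ℕ) ≠ (l : ℕ) := fun h => hl (Fin.ext h)
        omega
      · simp
    simp only [this]
    simp
  exact_mod_cast h

theorem volume_restrict_hypercube (d : ℕ) :
    (volume : Measure (Fin d → ℝ)).restrict (hypercube d)
      = Measure.pi fun _ => volume.restrict (Set.Ico (-1 / 2 : ℝ) (1 / 2)) := by
  rw [hypercube, volume_pi, Measure.restrict_pi_pi]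

theorem measurableSet_hypercube (d : ℕ) : MeasurableSet (hypercube d) :=
  MeasurableSet.univ_pi fun _ => measurableSet_Ico

theorem volume_hypercube (d : ℕ) : volume (hypercube d) = 1 := by
  rw [hypercube, volume_pi_pi]
  simp only [Real.volume_Ico]
  norm_num

instance isProbabilityMeasure_restrict_hypercube :
    IsProbabilityMeasure ((volume : Measure (Fin d → ℝ)).restrict (hypercube d)) :=
  ⟨by rw [Measure.restrict_apply_univ, volume_hypercube]⟩

theorem integral_hypercube_prod {𝕜 : Type*} [RCLike 𝕜] (g : Fin d → ℝ → 𝕜) :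
    ∫ y in hypercube d, ∏ j, g j (y j)
      = ∏ j, ∫ t in Set.Ico (-1 / 2 : ℝ) (1 / 2), g j t := by
  rw [volume_restrict_hypercube]
  exact integral_fintype_prod_eq_prod g

/-- The kernel has mass `n^d` in each variable. -/
theorem integral_norm_sq_fourierKernel (x : Fin d → ℝ) :
    ∫ y in hypercube d, ‖fourierKernel d n x y‖ ^ 2 = (n : ℝ) ^ d := by
  simp only [norm_sq_fourierKernel]
  rw [integral_hypercube_prod (fun j t => ‖dirichletSum n (t - x j)‖ ^ 2)]
  simp only [integral_norm_sq_dirichletSum]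
  simp

theorem norm_fourierKernel_comm (x y : Fin d → ℝ) :
    ‖fourierKernel d n x y‖ = ‖fourierKernel d n y x‖ := by
  rw [← star_fourierKernel, norm_star]

theorem integral_norm_sq_fourierKernel' (y : Fin d → ℝ) :
    ∫ x in hypercube d, ‖fourierKernel d n x y‖ ^ 2 = (n : ℝ) ^ d := by
  simp only [norm_fourierKernel_comm _ y]
  exact integral_norm_sq_fourierKernel y

/-- The exponentials resolve the identity. -/
theorem integral_fourierVec_mul_star (l l' : Fin d → Fin n) :
    ∫ z in hypercube d, fourierVec d n z l * star (fourierVec d n z l')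
      = if l = l' then 1 else 0 := by
  have e : ∀ z : Fin d → ℝ, fourierVec d n z l * star (fourierVec d n z l')
      = ∏ j, exp (2 * Real.pi * I * (((l' j : ℕ) - (l j : ℕ) : ℤ) : ℂ) * z j) := by
    intro z
    rw [star_fourierVec, fourierVec, ← Complex.exp_add, ← Complex.exp_sum, Finset.mul_sum,
      Finset.mul_sum, ← Finset.sum_add_distrib]
    congr 1
    refine Finset.sum_congr rfl fun j _ => ?_
    push_cast; ring
  simp only [e]
  rw [integral_hypercube_prod
    (fun j t => exp (2 * Real.pi * I * (((l' j : ℕ) - (l j : ℕ) : ℤ) : ℂ) * (t : ℝ)))]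
  simp only [integral_exp_int_mul]
  split_ifs with h
  · subst h; simp
  · obtain ⟨j, hj⟩ := Function.ne_iff.1 h
    refine Finset.prod_eq_zero (Finset.mem_univ j) (if_neg ?_)
    have : (l j : ℕ) ≠ (l' j : ℕ) := fun h => hj (Fin.ext h)
    omega

/-! ### Localization of the kernel -/

/-- The geometric sum has modulus at most `2 / |w - 1|`, and `|w - 1| = 2 |sin (π u)| ≥ 4 |u|` by
Jordan's inequality on the half period. -/
theorem norm_sq_dirichletSum_le {u : ℝ} (h0 : u ≠ 0) (h1 : |u| ≤ 1 / 2) :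
    ‖dirichletSum n u‖ ^ 2 ≤ (4 * u ^ 2)⁻¹ := by
  set w : ℂ := exp (((-2 * Real.pi * u : ℝ) : ℂ) * I) with hw
  have hsum : dirichletSum n u = ∑ l ∈ Finset.range n, w ^ l := by
    rw [dirichletSum, Finset.sum_range]
    refine Finset.sum_congr rfl fun l _ => ?_
    rw [hw, ← Complex.exp_nat_mul]
    congr 1; push_cast; ring
  have hmul : dirichletSum n u * (w - 1) = w ^ n - 1 := by
    rw [hsum, geom_sum_mul]
  have hwn : ‖w‖ = 1 := Complex.norm_exp_ofReal_mul_I _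
  have h2 : ‖w ^ n - 1‖ ≤ 2 := by
    refine (norm_sub_le _ _).trans ?_
    rw [norm_pow, hwn]; norm_num
  have h4 : 4 * |u| ≤ ‖w - 1‖ := by
    have hn : ‖w - 1‖ = ‖2 * Real.sin (-2 * Real.pi * u / 2)‖ := by
      rw [hw, mul_comm _ I, Complex.norm_exp_I_mul_ofReal_sub_one]
    rw [hn, Real.norm_eq_abs, abs_mul, abs_of_pos (by norm_num : (0 : ℝ) < 2)]
    have : |Real.sin (-2 * Real.pi * u / 2)| = |Real.sin (Real.pi * |u|)| := by
      rw [show -2 * Real.pi * u / 2 = -(Real.pi * u) by ring, Real.sin_neg, abs_neg]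
      rcases abs_choice u with h | h <;> rw [h]
      rw [mul_neg, Real.sin_neg, abs_neg]
    rw [this]
    have hj := Real.mul_le_sin (x := Real.pi * |u|) (by positivity)
      (by nlinarith [Real.pi_pos])
    have : 2 / Real.pi * (Real.pi * |u|) = 2 * |u| := by field_simp
    rw [this] at hj
    linarith [le_abs_self (Real.sin (Real.pi * |u|))]
  have hu : 0 < |u| := abs_pos.2 h0
  have h5 : ‖dirichletSum n u‖ * (4 * |u|) ≤ 2 := by
    calc ‖dirichletSum n u‖ * (4 * |u|) ≤ ‖dirichletSum n u‖ * ‖w - 1‖ := by gcongr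
      _ = ‖w ^ n - 1‖ := by rw [← norm_mul, hmul]
      _ ≤ 2 := h2
  have h6 : ‖dirichletSum n u‖ ≤ (2 * |u|)⁻¹ := by
    rw [← one_div, le_div_iff₀ (by positivity)]; linarith
  calc ‖dirichletSum n u‖ ^ 2 ≤ ((2 * |u|)⁻¹) ^ 2 := by gcongr
    _ = (4 * u ^ 2)⁻¹ := by rw [inv_pow, mul_pow, sq_abs]; norm_num

/-- Of the total mass `n` over a period, each of the two tails takes at most `(ρ⁻¹ - 2) / 4` by the
quadratic decay. The bound drops the constant term. -/
theorem integral_norm_sq_dirichletSum_near {ρ : ℝ} (h0 : 0 < ρ) (h1 : ρ ≤ 1 / 2) :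
    n - (2 * ρ)⁻¹ ≤ ∫ u in -ρ..ρ, ‖dirichletSum n u‖ ^ 2 := by
  have hc : Continuous fun u => ‖dirichletSum n u‖ ^ 2 := continuous_dirichletSum.norm.pow 2
  have htot : ∫ u in (-1 / 2 : ℝ)..(1 / 2), ‖dirichletSum n u‖ ^ 2 = n := by
    have := integral_norm_sq_dirichletSum (n := n) 0
    rw [integral_Ico_eq_integral_Ioc, ← intervalIntegral.integral_of_le (by norm_num)] at this
    simpa using this
  have hsplit := intervalIntegral.integral_add_adjacent_intervals
    (hc.intervalIntegrable (μ := volume) (-1 / 2) (-ρ)) (hc.intervalIntegrable (-ρ) ρ)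
  have hsplit2 := intervalIntegral.integral_add_adjacent_intervals
    (hc.intervalIntegrable (μ := volume) (-1 / 2) ρ) (hc.intervalIntegrable ρ (1 / 2))
  have hpow : ∫ u in ρ..(1 / 2), (4 * u ^ 2)⁻¹ = (ρ⁻¹ - 2) / 4 := by
    have : ∀ u : ℝ, (4 * u ^ 2)⁻¹ = (1 / 4) * u ^ (-2 : ℤ) := by
      intro u; rw [mul_inv, zpow_neg]; norm_cast; norm_num
    simp only [this]
    rw [intervalIntegral.integral_const_mul, integral_zpow]
    · rw [show (-2 : ℤ) + 1 = -1 by norm_num, zpow_neg_one, zpow_neg_one]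
      norm_num; ring
    · right
      refine ⟨by norm_num, ?_⟩
      rw [Set.uIcc_of_le h1]
      exact fun h => absurd h.1 (not_le.2 h0)
  have hci : IntervalIntegrable (fun u : ℝ => (4 * u ^ 2)⁻¹) volume ρ (1 / 2) := by
    refine ContinuousOn.intervalIntegrable ?_
    rw [Set.uIcc_of_le h1]
    refine ContinuousOn.inv₀ (by fun_prop) fun u hu => ?_
    have : 0 < u := h0.trans_le hu.1
    positivity
  have hR : ∫ u in ρ..(1 / 2), ‖dirichletSum n u‖ ^ 2 ≤ (ρ⁻¹ - 2) / 4 := by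
    rw [← hpow]
    refine intervalIntegral.integral_mono_on h1 (hc.intervalIntegrable _ _) hci fun u hu => ?_
    have : 0 < u := h0.trans_le hu.1
    exact norm_sq_dirichletSum_le this.ne' (by rw [abs_of_pos this]; exact hu.2)
  have hL : ∫ u in (-1 / 2)..(-ρ), ‖dirichletSum n u‖ ^ 2 ≤ (ρ⁻¹ - 2) / 4 := by
    rw [← hpow]
    have e := intervalIntegral.integral_comp_neg (a := ρ) (b := 1 / 2)
      (fun u => ‖dirichletSum n u‖ ^ 2)
    rw [show (-1 / 2 : ℝ) = -(1 / 2) by norm_num, ← e]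
    refine intervalIntegral.integral_mono_on h1
      (Continuous.intervalIntegrable (hc.comp continuous_neg) _ _) hci fun u hu => ?_
    have : 0 < u := h0.trans_le hu.1
    have h := norm_sq_dirichletSum_le (n := n) (u := -u) (by simpa using this.ne')
      (by rw [abs_neg, abs_of_pos this]; exact hu.2)
    rwa [neg_sq] at h
  have : (2 * ρ)⁻¹ = ρ⁻¹ / 2 := by rw [mul_inv]; ring
  rw [this]
  linarith

/-- The `i`-th of the `k` intervals of length `1/k` that partition `[-1/2, 1/2)`. -/
def gridInterval (k : ℕ) (i : Fin k) : Set ℝ :=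
  Set.Ico (-1 / 2 + (i : ℕ) / (k : ℝ)) (-1 / 2 + (i : ℕ) / (k : ℝ) + 1 / k)

/-- The `k^d` cubes of side `1/k` that partition the hypercube. -/
def gridCell (d k : ℕ) (i : Fin d → Fin k) : Set (Fin d → ℝ) :=
  Set.univ.pi fun j => gridInterval k (i j)

/-- The indicator function of a cell. -/
noncomputable def cellInd (d k : ℕ) (i : Fin d → Fin k) : (Fin d → ℝ) → ℝ :=
  (gridCell d k i).indicator fun _ => 1

variable {k : ℕ}

theorem measurableSet_gridCell (i : Fin d → Fin k) : MeasurableSet (gridCell d k i) :=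
  MeasurableSet.univ_pi fun _ => measurableSet_Ico

/-- Membership as a floor equation yields both the covering and the disjointness of the grid. -/
theorem mem_gridInterval_iff {i : Fin k} {t : ℝ} (hk : 0 < k) :
    t ∈ gridInterval k i ↔ ⌊(t + 1 / 2) * k⌋ = (i : ℕ) := by
  have hk' : (0 : ℝ) < k := by exact_mod_cast hk
  rw [Int.floor_eq_iff, gridInterval, Set.mem_Ico]
  push_cast
  have e1 : (-1 / 2 + (i : ℕ) / (k : ℝ) ≤ t) ↔ ((i : ℕ) : ℝ) ≤ (t + 1 / 2) * k := by
    rw [← div_le_iff₀ hk']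
    constructor <;> intro h <;> linarith
  have e2 : (t < -1 / 2 + (i : ℕ) / (k : ℝ) + 1 / k) ↔ (t + 1 / 2) * k < ((i : ℕ) : ℝ) + 1 := by
    rw [← lt_div_iff₀ hk', add_div]
    constructor <;> intro h <;> linarith
  rw [e1, e2]

theorem gridInterval_subset (i : Fin k) : gridInterval k i ⊆ Set.Ico (-1 / 2 : ℝ) (1 / 2) := by
  have hk : (0 : ℝ) < k := by exact_mod_cast (Fin.pos i)
  have hi : ((i : ℕ) : ℝ) + 1 ≤ k := by exact_mod_cast i.2
  refine Set.Ico_subset_Ico ?_ ?_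
  · have : (0 : ℝ) ≤ (i : ℕ) / (k : ℝ) := by positivity
    linarith
  · have : ((i : ℕ) : ℝ) / k + 1 / k ≤ 1 := by rw [← add_div, div_le_one hk]; exact hi
    linarith

theorem gridCell_subset (i : Fin d → Fin k) : gridCell d k i ⊆ hypercube d :=
  Set.pi_mono fun _ _ => gridInterval_subset _

theorem exists_mem_gridCell (hk : 0 < k) {x : Fin d → ℝ} (hx : x ∈ hypercube d) :
    ∃ i, x ∈ gridCell d k i := by
  have hk' : (0 : ℝ) < k := by exact_mod_cast hk
  have h : ∀ j, ∃ i : Fin k, x j ∈ gridInterval k i := by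
    intro j
    have hj := hx j (Set.mem_univ j)
    have h0 : 0 ≤ (x j + 1 / 2) * k := mul_nonneg (by linarith [hj.1]) hk'.le
    have h1 : (x j + 1 / 2) * k < k := by nlinarith [hj.2]
    have hf0 : 0 ≤ ⌊(x j + 1 / 2) * k⌋ := Int.floor_nonneg.2 h0
    have hf1 : ⌊(x j + 1 / 2) * k⌋ < k := Int.floor_lt.2 (by exact_mod_cast h1)
    refine ⟨⟨⌊(x j + 1 / 2) * k⌋.toNat, by omega⟩, ?_⟩
    rw [mem_gridInterval_iff hk]
    exact (Int.toNat_of_nonneg hf0).symm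
  choose i hi using h
  exact ⟨i, fun j _ => hi j⟩

theorem gridCell_inj {i i' : Fin d → Fin k} {x : Fin d → ℝ} (h : x ∈ gridCell d k i)
    (h' : x ∈ gridCell d k i') : i = i' := by
  ext j
  have hk : 0 < k := Fin.pos (i j)
  have h1 := (mem_gridInterval_iff hk).1 (h j (Set.mem_univ j))
  have h2 := (mem_gridInterval_iff hk).1 (h' j (Set.mem_univ j))
  rw [h1] at h2
  exact_mod_cast h2

theorem cellInd_mul_cellInd (i i' : Fin d → Fin k) (x : Fin d → ℝ) :
    cellInd d k i x * cellInd d k i' x = if i = i' then cellInd d k i x else 0 := by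
  unfold cellInd
  split_ifs with h
  · subst h
    by_cases hx : x ∈ gridCell d k i <;> simp [hx]
  · by_cases hx : x ∈ gridCell d k i
    · have : x ∉ gridCell d k i' := fun h' => h (gridCell_inj hx h')
      simp [this]
    · simp [hx]

theorem sum_cellInd (hk : 0 < k) {x : Fin d → ℝ} (hx : x ∈ hypercube d) :
    ∑ i, cellInd d k i x = 1 := by
  obtain ⟨i, hi⟩ := exists_mem_gridCell hk hx
  rw [Finset.sum_eq_single i]
  · simp [cellInd, hi]
  · intro i' _ h
    have : x ∉ gridCell d k i' := fun h' => h (gridCell_inj h' hi)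
    simp [cellInd, this]
  · simp

theorem measurable_cellInd (i : Fin d → Fin k) : Measurable (cellInd d k i) :=
  measurable_const.indicator (measurableSet_gridCell i)

theorem cellInd_nonneg (i : Fin d → Fin k) (x : Fin d → ℝ) : 0 ≤ cellInd d k i x :=
  Set.indicator_nonneg (fun _ _ => zero_le_one) _

theorem cellInd_le_one (i : Fin d → Fin k) (x : Fin d → ℝ) : cellInd d k i x ≤ 1 :=
  Set.indicator_le_self' (fun _ _ => zero_le_one) _

/-- The indicator of the event that two points lie in the same cell. -/
noncomputable def sameCell (d k : ℕ) (x y : Fin d → ℝ) : ℝ :=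
  ∑ i, cellInd d k i x * cellInd d k i y

theorem sameCell_nonneg (x y : Fin d → ℝ) : 0 ≤ sameCell d k x y :=
  Finset.sum_nonneg fun i _ => mul_nonneg (cellInd_nonneg i x) (cellInd_nonneg i y)

theorem sameCell_eq_zero_or (x y : Fin d → ℝ) :
    sameCell d k x y = 0 ∨
      sameCell d k x y = 1 ∧ ∃ i, x ∈ gridCell d k i ∧ y ∈ gridCell d k i := by
  by_cases h : ∃ i, x ∈ gridCell d k i ∧ y ∈ gridCell d k i
  · right
    refine ⟨?_, h⟩
    obtain ⟨i, hx, hy⟩ := h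
    rw [sameCell, Finset.sum_eq_single i]
    · simp [cellInd, hx, hy]
    · intro i' _ h
      have : x ∉ gridCell d k i' := fun h' => h (gridCell_inj h' hx)
      simp [cellInd, this]
    · simp
  · left
    refine Finset.sum_eq_zero fun i _ => ?_
    by_cases hx : x ∈ gridCell d k i
    · have : y ∉ gridCell d k i := fun hy => h ⟨i, hx, hy⟩
      simp [cellInd, this]
    · simp [cellInd, hx]

theorem sameCell_le_one (x y : Fin d → ℝ) : sameCell d k x y ≤ 1 := by
  rcases sameCell_eq_zero_or (k := k) x y with h | ⟨h, -⟩ <;> rw [h]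
  exact zero_le_one

/-- Pinching produces the square of the off-block mask; since the mask takes only the values 0 and
1, the square disappears. -/
theorem one_sub_sameCell_sq (x y : Fin d → ℝ) :
    (1 - sameCell d k x y) ^ 2 = 1 - sameCell d k x y := by
  rcases sameCell_eq_zero_or (k := k) x y with h | ⟨h, -⟩ <;> rw [h] <;> norm_num

theorem measurable_sameCell :
    Measurable fun p : (Fin d → ℝ) × (Fin d → ℝ) => sameCell d k p.1 p.2 := by
  unfold sameCell
  exact Finset.measurable_fun_sum _ fun i _ =>
    ((measurable_cellInd i).comp measurable_fst).mul ((measurable_cellInd i).comp measurable_snd)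

/-- Points at distance at least `ρ = δ / k` from both ends fill a length `(1 - 2δ) / k`. From each
of them, all but `1 / (2ρ) = k / (2δ)` of the kernel mass stays inside the interval. -/
theorem integral_gridInterval_ge {δ : ℝ} (h0 : 0 < δ) (h1 : δ < 1 / 2) (i : Fin k) :
    (1 - 2 * δ) / k * (n - k / (2 * δ))
      ≤ ∫ x in gridInterval k i, ∫ y in gridInterval k i, ‖dirichletSum n (y - x)‖ ^ 2 := by
  have hk : (0 : ℝ) < k := by exact_mod_cast (Fin.pos i)
  have hk1 : (1 : ℝ) ≤ k := by exact_mod_cast (Fin.pos i)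
  set a : ℝ := -1 / 2 + (i : ℕ) / (k : ℝ) with ha
  set ρ : ℝ := δ / k with hρ
  have hρ0 : 0 < ρ := by positivity
  have hρ1 : ρ ≤ 1 / 2 := by
    rw [hρ, div_le_iff₀ hk]; nlinarith
  have hc : Continuous fun u => ‖dirichletSum n u‖ ^ 2 := continuous_dirichletSum.norm.pow 2
  have hcx : ∀ x, Continuous fun y => ‖dirichletSum n (y - x)‖ ^ 2 := fun x => hc.comp (by fun_prop)
  have hfin : volume (gridInterval k i) ≠ ⊤ := by simp [gridInterval]
  have hint : ∀ x, IntegrableOn (fun y => ‖dirichletSum n (y - x)‖ ^ 2) (gridInterval k i) :=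
    fun x => (hcx x).integrableOn_Icc.mono_set Set.Ico_subset_Icc_self
  have hnn : ∀ x, 0 ≤ ∫ y in gridInterval k i, ‖dirichletSum n (y - x)‖ ^ 2 :=
    fun x => integral_nonneg fun y => by positivity
  have hsub : Set.Ico (a + ρ) (a + 1 / k - ρ) ⊆ gridInterval k i := by
    intro x hx
    exact ⟨by linarith [hx.1], by linarith [hx.2]⟩
  have hinner : ∀ x ∈ Set.Ico (a + ρ) (a + 1 / k - ρ),
      n - k / (2 * δ) ≤ ∫ y in gridInterval k i, ‖dirichletSum n (y - x)‖ ^ 2 := by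
    intro x hx
    have hsub' : Set.Ico (x - ρ) (x + ρ) ⊆ gridInterval k i := by
      intro y hy
      exact ⟨by linarith [hx.1, hy.1], by linarith [hx.2, hy.2]⟩
    refine le_trans ?_ (setIntegral_mono_set (hint x)
      (Eventually.of_forall fun y => by positivity) hsub'.eventuallyLE)
    rw [integral_Ico_eq_integral_Ioc, ← intervalIntegral.integral_of_le (by linarith),
      intervalIntegral.integral_comp_sub_right (fun u => ‖dirichletSum n u‖ ^ 2)]
    have := integral_norm_sq_dirichletSum_near (n := n) hρ0 hρ1
    have e : (2 * ρ)⁻¹ = k / (2 * δ) := by rw [hρ]; field_simp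
    rw [e] at this
    simpa using this
  have hmeas : StronglyMeasurable fun x => ∫ y in gridInterval k i, ‖dirichletSum n (y - x)‖ ^ 2 := by
    refine StronglyMeasurable.integral_prod_right'
      (f := fun p : ℝ × ℝ => ‖dirichletSum n (p.2 - p.1)‖ ^ 2) ?_
    exact (hc.comp (by fun_prop : Continuous fun p : ℝ × ℝ => p.2 - p.1)).stronglyMeasurable
  have hbound : ∀ x, ‖∫ y in gridInterval k i, ‖dirichletSum n (y - x)‖ ^ 2‖
      ≤ (n : ℝ) ^ 2 * volume.real (gridInterval k i) := by
    intro x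
    refine norm_setIntegral_le_of_norm_le_const hfin.lt_top fun y _ => ?_
    rw [norm_pow, norm_norm]
    gcongr
    exact norm_dirichletSum_le _
  have hintx : IntegrableOn (fun x => ∫ y in gridInterval k i, ‖dirichletSum n (y - x)‖ ^ 2)
      (gridInterval k i) := by
    refine Measure.integrableOn_of_bounded hfin hmeas.aestronglyMeasurable
      (Eventually.of_forall hbound)
  refine le_trans ?_ (setIntegral_mono_set hintx (Eventually.of_forall hnn) hsub.eventuallyLE)
  have hvol : volume.real (Set.Ico (a + ρ) (a + 1 / k - ρ)) = (1 - 2 * δ) / k := by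
    rw [Real.volume_real_Ico_of_le]
    · rw [hρ]; ring
    · have : 2 * ρ ≤ 1 / k := by rw [hρ, ← mul_div_assoc]; gcongr; linarith
      linarith
  rw [← hvol]
  have := setIntegral_mono_on (μ := volume) (s := Set.Ico (a + ρ) (a + 1 / k - ρ))
    (f := fun _ => (n - k / (2 * δ) : ℝ)) (integrableOn_const (by simp))
    (hintx.mono_set hsub) measurableSet_Ico hinner
  rwa [setIntegral_const, smul_eq_mul] at this

theorem integral_gridCell_prod (i : Fin d → Fin k) (g : Fin d → ℝ → ℝ) :
    ∫ y in gridCell d k i, ∏ j, g j (y j) = ∏ j, ∫ t in gridInterval k (i j), g j t := by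
  rw [gridCell, volume_pi, Measure.restrict_pi_pi]
  exact integral_fintype_prod_eq_prod g

theorem integrable_hypercube_of_bounded {g : (Fin d → ℝ) → ℝ} (hg : Measurable g) {C : ℝ}
    (hC : ∀ x, |g x| ≤ C) : IntegrableOn g (hypercube d) :=
  Integrable.of_bound hg.aestronglyMeasurable C (Eventually.of_forall hC)

theorem measurable_norm_sq_fourierKernel :
    Measurable fun p : (Fin d → ℝ) × (Fin d → ℝ) => ‖fourierKernel d n p.1 p.2‖ ^ 2 :=
  (continuous_fourierKernel.norm.pow 2).measurable

theorem measurable_norm_sq_fourierKernel_right (x : Fin d → ℝ) :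
    Measurable fun y => ‖fourierKernel d n x y‖ ^ 2 :=
  ((continuous_fourierKernel.comp (Continuous.prodMk_right x)).norm.pow 2).measurable

theorem measurable_sameCell_right (x : Fin d → ℝ) : Measurable fun y => sameCell d k x y := by
  unfold sameCell
  exact Finset.measurable_fun_sum _ fun i _ => measurable_const.mul (measurable_cellInd i)

theorem norm_sq_fourierKernel_le (x y : Fin d → ℝ) :
    ‖fourierKernel d n x y‖ ^ 2 ≤ ((n : ℝ) ^ d) ^ 2 := by
  gcongr
  exact norm_fourierKernel_le x y

/-- Cells and squared kernel both factor over the coordinates, which reduces the mass inside cells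
to the one-dimensional estimate. -/
theorem integral_integral_sameCell :
    ∫ x in hypercube d, ∫ y in hypercube d, sameCell d k x y * ‖fourierKernel d n x y‖ ^ 2
      = ∑ i : Fin d → Fin k, ∏ j, ∫ x in gridInterval k (i j), ∫ y in gridInterval k (i j),
        ‖dirichletSum n (y - x)‖ ^ 2 := by
  have hmeasx : ∀ x : Fin d → ℝ, Measurable fun y => ‖fourierKernel d n x y‖ ^ 2 :=
    measurable_norm_sq_fourierKernel_right
  have h1 : ∀ x : Fin d → ℝ,
      ∫ y in hypercube d, sameCell d k x y * ‖fourierKernel d n x y‖ ^ 2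
      = ∑ i, cellInd d k i x * ∏ j, ∫ t in gridInterval k (i j),
        ‖dirichletSum n (t - x j)‖ ^ 2 := by
    intro x
    simp only [sameCell, Finset.sum_mul]
    rw [integral_finsetSum]
    · refine Finset.sum_congr rfl fun i _ => ?_
      simp only [mul_assoc]
      rw [integral_const_mul]
      congr 1
      rw [← integral_gridCell_prod i (fun j t => ‖dirichletSum n (t - x j)‖ ^ 2)]
      simp only [← norm_sq_fourierKernel]
      have e : ∀ y, cellInd d k i y * ‖fourierKernel d n x y‖ ^ 2
          = (gridCell d k i).indicator (fun y => ‖fourierKernel d n x y‖ ^ 2) y := by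
        intro y
        by_cases hy : y ∈ gridCell d k i <;> simp [cellInd, hy]
      simp only [e]
      rw [setIntegral_indicator (measurableSet_gridCell i),
        Set.inter_eq_self_of_subset_right (gridCell_subset i)]
    · intro i _
      refine integrable_hypercube_of_bounded (C := ((n : ℝ) ^ d) ^ 2)
        ((measurable_const.mul (measurable_cellInd i)).mul (hmeasx x)) fun y => ?_
      rw [abs_of_nonneg (mul_nonneg (mul_nonneg (cellInd_nonneg _ _) (cellInd_nonneg _ _))
        (by positivity))]
      calc _ ≤ 1 * ‖fourierKernel d n x y‖ ^ 2 := by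
            gcongr
            exact mul_le_one₀ (cellInd_le_one _ _) (cellInd_nonneg _ _) (cellInd_le_one _ _)
        _ ≤ _ := by rw [one_mul]; exact norm_sq_fourierKernel_le _ _
  simp only [h1]
  have hm1 : ∀ i' : Fin k, Measurable fun x : ℝ =>
      ∫ t in gridInterval k i', ‖dirichletSum n (t - x)‖ ^ 2 := by
    intro i'
    refine (StronglyMeasurable.integral_prod_right'
      (f := fun p : ℝ × ℝ => ‖dirichletSum n (p.2 - p.1)‖ ^ 2) ?_).measurable
    exact (((continuous_dirichletSum (n := n)).norm.pow 2).comp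
      (by fun_prop : Continuous fun p : ℝ × ℝ => p.2 - p.1)).stronglyMeasurable
  have hb1 : ∀ (i' : Fin k) (x : ℝ),
      ‖∫ t in gridInterval k i', ‖dirichletSum n (t - x)‖ ^ 2‖
        ≤ (n : ℝ) ^ 2 * volume.real (gridInterval k i') := by
    intro i' x
    refine norm_setIntegral_le_of_norm_le_const (by simp [gridInterval]) fun y _ => ?_
    rw [norm_pow, norm_norm]
    gcongr
    exact norm_dirichletSum_le _
  rw [integral_finsetSum]
  · refine Finset.sum_congr rfl fun i _ => ?_
    rw [← integral_gridCell_prod i (fun j x => ∫ t in gridInterval k (i j),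
        ‖dirichletSum n (t - x)‖ ^ 2)]
    have e : ∀ x, cellInd d k i x * ∏ j, ∫ t in gridInterval k (i j), ‖dirichletSum n (t - x j)‖ ^ 2
        = (gridCell d k i).indicator (fun x => ∏ j, ∫ t in gridInterval k (i j),
          ‖dirichletSum n (t - x j)‖ ^ 2) x := by
      intro x
      by_cases hx : x ∈ gridCell d k i <;> simp [cellInd, hx]
    simp only [e]
    rw [setIntegral_indicator (measurableSet_gridCell i),
      Set.inter_eq_self_of_subset_right (gridCell_subset i)]
  · intro i _
    refine integrable_hypercube_of_bounded
      (C := ∏ j, ((n : ℝ) ^ 2 * volume.real (gridInterval k (i j))))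
      ((measurable_cellInd i).mul (Finset.measurable_fun_prod _ fun j _ =>
        (hm1 (i j)).comp (measurable_pi_apply j))) fun x => ?_
    rw [abs_mul, Finset.abs_prod, abs_of_nonneg (cellInd_nonneg i x)]
    exact (mul_le_of_le_one_left (Finset.prod_nonneg fun _ _ => abs_nonneg _)
      (cellInd_le_one _ _)).trans
      (Finset.prod_le_prod (fun _ _ => abs_nonneg _) fun j _ => hb1 _ _)

theorem offCell_mass_eq :
    ∫ x in hypercube d, ∫ y in hypercube d,
        (1 - sameCell d k x y) * ‖fourierKernel d n x y‖ ^ 2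
      = (n : ℝ) ^ d - ∫ x in hypercube d, ∫ y in hypercube d,
        sameCell d k x y * ‖fourierKernel d n x y‖ ^ 2 := by
  have hmK : ∀ x : Fin d → ℝ, Measurable fun y => ‖fourierKernel d n x y‖ ^ 2 :=
    measurable_norm_sq_fourierKernel_right
  have hmS : ∀ x : Fin d → ℝ, Measurable fun y => sameCell d k x y :=
    measurable_sameCell_right
  have hbS : ∀ x y : Fin d → ℝ, |sameCell d k x y * ‖fourierKernel d n x y‖ ^ 2|
      ≤ ((n : ℝ) ^ d) ^ 2 := by
    intro x y
    rw [abs_of_nonneg (mul_nonneg (sameCell_nonneg _ _) (by positivity))]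
    exact (mul_le_of_le_one_left (by positivity) (sameCell_le_one _ _)).trans
      (norm_sq_fourierKernel_le _ _)
  have hinner : ∀ x : Fin d → ℝ, ∫ y in hypercube d,
      (1 - sameCell d k x y) * ‖fourierKernel d n x y‖ ^ 2
      = (n : ℝ) ^ d - ∫ y in hypercube d, sameCell d k x y * ‖fourierKernel d n x y‖ ^ 2 := by
    intro x
    simp only [sub_mul, one_mul]
    rw [integral_sub, integral_norm_sq_fourierKernel]
    · exact integrable_hypercube_of_bounded (hmK x) (C := ((n : ℝ) ^ d) ^ 2) fun y => by
        rw [abs_of_nonneg (by positivity)]; exact norm_sq_fourierKernel_le _ _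
    · exact integrable_hypercube_of_bounded ((hmS x).mul (hmK x)) (hbS x)
  simp only [hinner]
  rw [integral_sub (integrable_const _), integral_const]
  · simp only [probReal_univ, one_smul]
  · refine integrable_hypercube_of_bounded (C := ((n : ℝ) ^ d) ^ 2) ?_ fun x => ?_
    · refine (StronglyMeasurable.integral_prod_right' (f := fun p : (Fin d → ℝ) × (Fin d → ℝ) =>
        sameCell d k p.1 p.2 * ‖fourierKernel d n p.1 p.2‖ ^ 2) ?_).measurable
      exact (measurable_sameCell.mul measurable_norm_sq_fourierKernel).stronglyMeasurable
    · rw [← Real.norm_eq_abs]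
      refine (norm_integral_le_of_norm_le_const (Eventually.of_forall (hbS x))).trans ?_
      rw [probReal_univ, mul_one]

/-- When `k ≤ δ² n` the tail loss `k / (2δ)` is at most `δ n / 2`, so each coordinate keeps the
fraction `(1 - 2δ)(1 - δ/2) ≥ 1 - 3δ`. Bernoulli's inequality handles the `d`-th power. -/
theorem offCell_mass_le {δ : ℝ} (hδ0 : 0 < δ) (hδ1 : δ < 1 / 3) (hk : 0 < k)
    (hR : (k : ℝ) ≤ δ ^ 2 * n) :
    ∫ x in hypercube d, ∫ y in hypercube d,
        (1 - sameCell d k x y) * ‖fourierKernel d n x y‖ ^ 2 ≤ d * (3 * δ) * (n : ℝ) ^ d := by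
  have hk' : (0 : ℝ) < k := by exact_mod_cast hk
  have hkd : (k : ℝ) / (2 * δ) ≤ δ / 2 * n := by
    rw [div_le_iff₀ (by positivity)]
    calc (k : ℝ) ≤ δ ^ 2 * n := hR
      _ = δ / 2 * n * (2 * δ) := by ring
  have hn0 : (0 : ℝ) ≤ n := Nat.cast_nonneg n
  have hq : ∀ i : Fin k, (1 - 3 * δ) * n / k
      ≤ ∫ x in gridInterval k i, ∫ y in gridInterval k i, ‖dirichletSum n (y - x)‖ ^ 2 := by
    intro i
    refine le_trans ?_ (integral_gridInterval_ge hδ0 (by linarith) i)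
    rw [div_mul_eq_mul_div]
    refine div_le_div_of_nonneg_right ?_ hk'.le
    calc (1 - 3 * δ) * n ≤ (1 - 2 * δ) * ((1 - δ / 2) * n) := by
          nlinarith [mul_nonneg (by positivity : (0 : ℝ) ≤ δ / 2 + δ * δ) hn0]
      _ ≤ (1 - 2 * δ) * (n - k / (2 * δ)) :=
          mul_le_mul_of_nonneg_left (by linarith) (by linarith)
  have h3 : 0 ≤ 1 - 3 * δ := by linarith
  have hsame : (1 - 3 * δ) ^ d * (n : ℝ) ^ d
      ≤ ∫ x in hypercube d, ∫ y in hypercube d,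
        sameCell d k x y * ‖fourierKernel d n x y‖ ^ 2 := by
    rw [integral_integral_sameCell]
    calc (1 - 3 * δ) ^ d * (n : ℝ) ^ d
        = ∑ i : Fin d → Fin k, ∏ j : Fin d, ((1 - 3 * δ) * n / k) := by
          rw [Finset.sum_const, Finset.prod_const, Finset.card_univ, Finset.card_univ,
            Fintype.card_pi, Finset.prod_const, Finset.card_univ, Fintype.card_fin,
            Fintype.card_fin, nsmul_eq_mul, Nat.cast_pow, ← mul_pow, ← mul_pow]
          congr 1
          field_simp
      _ ≤ _ := Finset.sum_le_sum fun i _ => Finset.prod_le_prod (fun j _ => by positivity)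
          fun j _ => hq _
  have hbern : 1 - d * (3 * δ) ≤ (1 - 3 * δ) ^ d := by
    have := one_add_mul_le_pow (a := -(3 * δ)) (by linarith) d
    rw [← sub_eq_add_neg] at this
    linarith
  rw [offCell_mass_eq]
  have : (1 - d * (3 * δ)) * (n : ℝ) ^ d ≤ (1 - 3 * δ) ^ d * (n : ℝ) ^ d :=
    mul_le_mul_of_nonneg_right hbern (by positivity)
  linarith

/-- The mass of the squared kernel off the diagonal cells is a small fraction of its total mass
once the cells are large with respect to `1/n`. -/
theorem exists_offCell_mass_le (d : ℕ) {ε : ℝ} (hε : 0 < ε) :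
    ∃ R : ℕ, 0 < R ∧ ∀ n k : ℕ, 0 < k → R * k ≤ n →
      ∫ x in hypercube d, ∫ y in hypercube d,
        (1 - sameCell d k x y) * ‖fourierKernel d n x y‖ ^ 2 ≤ ε * (n : ℝ) ^ d := by
  obtain ⟨δ, hδ0, hδ1, hδε⟩ : ∃ δ : ℝ, 0 < δ ∧ δ < 1 / 3 ∧ d * (3 * δ) ≤ ε := by
    refine ⟨min (1 / 4) (ε / (3 * (d + 1))), by positivity,
      (min_le_left _ _).trans_lt (by norm_num), ?_⟩
    calc (d : ℝ) * (3 * min (1 / 4) (ε / (3 * (d + 1))))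
        ≤ d * (3 * (ε / (3 * (d + 1)))) := by gcongr; exact min_le_right _ _
      _ = d / (d + 1) * ε := by field_simp
      _ ≤ 1 * ε := by gcongr; rw [div_le_one (by positivity)]; linarith
      _ = ε := one_mul ε
  -- With `R ≥ 1 / δ²`, the condition `R k ≤ n` implies the requirement `k ≤ δ² n`.
  obtain ⟨R, hR⟩ := exists_nat_ge (1 / δ ^ 2)
  have hR0 : (0 : ℝ) < R := (by positivity : 0 < 1 / δ ^ 2).trans_le hR
  refine ⟨R, by exact_mod_cast hR0, fun n k hk hnk => ?_⟩
  have h2 : (R : ℝ) * k ≤ n := by exact_mod_cast hnk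
  have h3 : 1 / δ ^ 2 * k ≤ n := (mul_le_mul_of_nonneg_right hR (Nat.cast_nonneg k)).trans h2
  rw [div_mul_eq_mul_div, one_mul, div_le_iff₀ (by positivity)] at h3
  exact (offCell_mass_le hδ0 hδ1 hk (by linarith)).trans
    (mul_le_mul_of_nonneg_right hδε (by positivity))

end FourierKernel

/-! ### Expectations over i.i.d. points. -/

section PiIntegrals

variable {E : Type*} [MeasurableSpace E]

theorem integrable_of_measurable_bounded {μ : Measure E} [IsFiniteMeasure μ] {g : E → ℝ}
    (hg : Measurable g) {C : ℝ} (hC : ∀ x, |g x| ≤ C) : Integrable g μ :=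
  Integrable.of_bound hg.aestronglyMeasurable C (Eventually.of_forall hC)

theorem measurable_fin_cons (m : ℕ) :
    Measurable fun p : E × (Fin m → E) => (Fin.cons p.1 p.2 : Fin (m + 1) → E) := by
  refine measurable_pi_iff.2 fun i => ?_
  refine Fin.cases ?_ (fun j => ?_) i
  · simpa using measurable_fst
  · simpa only [Fin.cons_succ] using
      (by fun_prop : Measurable fun p : E × (Fin m → E) => p.2 j)

theorem integral_pi_succ (μ : Measure E) [IsFiniteMeasure μ] {m : ℕ} {Φ : (Fin (m + 1) → E) → ℝ}
    (hΦ : Measurable Φ) {C : ℝ} (hC : ∀ x, |Φ x| ≤ C) :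
    ∫ x, Φ x ∂(Measure.pi fun _ => μ)
      = ∫ y, ∫ x, Φ (Fin.cons y x) ∂(Measure.pi fun _ => μ) ∂μ := by
  have h := (measurePreserving_piFinSuccAbove (fun _ : Fin (m + 1) => μ) 0).symm.integral_comp'
    (g := Φ)
  rw [← h]
  have e : ∀ p : E × (Fin m → E), (MeasurableEquiv.piFinSuccAbove (fun _ => E) 0).symm p
      = (Fin.cons p.1 p.2 : Fin (m + 1) → E) := by
    intro p
    simp [MeasurableEquiv.piFinSuccAbove, Fin.insertNthEquiv]
  simp only [e]
  rw [integral_prod]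
  exact integrable_of_measurable_bounded (hΦ.comp (measurable_fin_cons m)) fun _ => hC _

theorem integral_pi_zero (μ : Measure E) [SigmaFinite μ] (Φ : (Fin 0 → E) → ℝ) :
    ∫ x, Φ x ∂(Measure.pi fun _ => μ) = Φ (fun i => i.elim0) := by
  rw [Measure.pi_of_empty _ (fun i => i.elim0), integral_dirac]

/-- Comparison of the expectations, under two product laws, of a function that changes by at most
one when one coordinate is changed. -/
theorem abs_integral_pi_sub_le (μ ν : Measure E) [IsProbabilityMeasure μ] [IsProbabilityMeasure ν]
    {ε : ℝ} (hε : ∀ g : E → ℝ, Measurable g → (∀ x, |g x| ≤ 1) →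
      |∫ x, g x ∂μ - ∫ x, g x ∂ν| ≤ ε) (m : ℕ) {Φ : (Fin m → E) → ℝ} (hΦ : Measurable Φ)
    {C : ℝ} (hC : ∀ x, |Φ x| ≤ C)
    (hosc : ∀ x q y, |Φ (Function.update x q y) - Φ x| ≤ 1) :
    |∫ x, Φ x ∂(Measure.pi fun _ => μ) - ∫ x, Φ x ∂(Measure.pi fun _ => ν)| ≤ m * ε := by
  induction m with
  | zero => simp [integral_pi_zero]
  | succ m ih =>
    rw [integral_pi_succ μ hΦ hC, integral_pi_succ ν hΦ hC]
    have hmeas : ∀ y, Measurable fun x : Fin m → E => Φ (Fin.cons y x) := fun y =>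
      hΦ.comp ((measurable_fin_cons m).comp (measurable_const.prodMk measurable_id))
    have hA : ∀ (ρ : Measure E) [IsProbabilityMeasure ρ],
        Measurable fun y => ∫ x, Φ (Fin.cons y x) ∂(Measure.pi fun _ : Fin m => ρ) := by
      intro ρ _
      exact (StronglyMeasurable.integral_prod_right'
        (f := fun p : E × (Fin m → E) => Φ (Fin.cons p.1 p.2))
        (hΦ.comp (measurable_fin_cons m)).stronglyMeasurable).measurable
    have hAb : ∀ (ρ : Measure E) [IsProbabilityMeasure ρ] (y : E),
        |∫ x, Φ (Fin.cons y x) ∂(Measure.pi fun _ : Fin m => ρ)| ≤ C := by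
      intro ρ _ y
      rw [← Real.norm_eq_abs]
      refine (norm_integral_le_of_norm_le_const (C := C)
        (Eventually.of_forall fun x => hC _)).trans ?_
      simp
    -- Hybrid argument: the last `m` coordinates change law by induction with the first one frozen;
    -- `h2` then changes the law of the first.
    have h1 : |∫ y, ∫ x, Φ (Fin.cons y x) ∂(Measure.pi fun _ => μ) ∂μ
        - ∫ y, ∫ x, Φ (Fin.cons y x) ∂(Measure.pi fun _ => ν) ∂μ| ≤ m * ε := by
      rw [← integral_sub (integrable_of_measurable_bounded (hA μ) (hAb μ))
        (integrable_of_measurable_bounded (hA ν) (hAb ν)), ← Real.norm_eq_abs]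
      refine (norm_integral_le_of_norm_le_const (C := m * ε)
        (Eventually.of_forall fun y => ?_)).trans (by simp)
      refine ih (hmeas y) (fun x => hC _) fun x q z => ?_
      rw [Fin.cons_update]
      exact hosc _ _ _
    have h2 : |∫ y, ∫ x, Φ (Fin.cons y x) ∂(Measure.pi fun _ => ν) ∂μ
        - ∫ y, ∫ x, Φ (Fin.cons y x) ∂(Measure.pi fun _ => ν) ∂ν| ≤ ε := by
      -- Only the oscillation of `G` is bounded by one. Subtracting `G y0` makes `hε` applicable and
      -- leaves the difference of the two integrals unchanged.
      obtain ⟨y0⟩ : Nonempty E := nonempty_of_isProbabilityMeasure μ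
      set G : E → ℝ := fun y => ∫ x, Φ (Fin.cons y x) ∂(Measure.pi fun _ : Fin m => ν) with hG
      have hG1 : ∀ y, |G y - G y0| ≤ 1 := by
        intro y
        have hi : ∀ y, Integrable (fun x => Φ (Fin.cons y x)) (Measure.pi fun _ : Fin m => ν) :=
          fun y => integrable_of_measurable_bounded (hmeas y) fun _ => hC _
        rw [hG]
        simp only
        rw [← integral_sub (hi y) (hi y0), ← Real.norm_eq_abs]
        refine (norm_integral_le_of_norm_le_const (C := 1)
          (Eventually.of_forall fun x => ?_)).trans (by simp)
        have := hosc (Fin.cons y0 x) 0 y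
        rwa [Fin.update_cons_zero] at this
      have := hε (fun y => G y - G y0) ((hA ν).sub measurable_const) hG1
      rw [integral_sub (integrable_of_measurable_bounded (hA ν) (hAb ν)) (integrable_const _),
        integral_sub (integrable_of_measurable_bounded (hA ν) (hAb ν)) (integrable_const _)] at this
      simpa using this
    calc _ ≤ m * ε + ε := (abs_sub_le _ _ _).trans (add_le_add h1 h2)
      _ = _ := by push_cast; ring

/-- The law of two distinct coordinates under a product law. -/
theorem integral_pi_eval_two (μ : Measure E) [IsProbabilityMeasure μ] {m : ℕ} {q r : Fin m}
    (hqr : q ≠ r) {g : E → E → ℝ} (hg : Measurable (Function.uncurry g)) {C : ℝ}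
    (hC : ∀ x y, |g x y| ≤ C) :
    ∫ x, g (x q) (x r) ∂(Measure.pi fun _ => μ) = ∫ x, ∫ y, g x y ∂μ ∂μ := by
  have hind := ((ProbabilityTheory.iIndepFun_pi (μ := fun _ : Fin m => μ)
    (X := fun _ => id) fun _ => aemeasurable_id).indepFun hqr)
  have hmap := (ProbabilityTheory.indepFun_iff_map_prod_eq_prod_map_map
    (measurable_pi_apply q).aemeasurable (measurable_pi_apply r).aemeasurable).1 hind
  have e1 : (Measure.pi fun _ : Fin m => μ).map (fun x => x q) = μ :=
    (measurePreserving_eval _ q).map_eq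
  have e2 : (Measure.pi fun _ : Fin m => μ).map (fun x => x r) = μ :=
    (measurePreserving_eval _ r).map_eq
  have hmap' : (Measure.pi fun _ : Fin m => μ).map (fun x => (x q, x r)) = μ.prod μ := by
    rw [e1, e2] at hmap
    exact hmap
  have hp : Measurable fun x : Fin m → E => (x q, x r) :=
    (measurable_pi_apply q).prodMk (measurable_pi_apply r)
  rw [← integral_prod (fun p : E × E => g p.1 p.2)
    (integrable_of_measurable_bounded hg fun p => hC _ _), ← hmap',
    integral_map hp.aemeasurable (f := fun p : E × E => g p.1 p.2) hg.aestronglyMeasurable]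

theorem integral_pi_eval (μ : Measure E) [IsProbabilityMeasure μ] {m : ℕ} (q : Fin m)
    {g : E → ℝ} (hg : Measurable g) :
    ∫ x, g (x q) ∂(Measure.pi fun _ => μ) = ∫ x, g x ∂μ := by
  have e1 : (Measure.pi fun _ : Fin m => μ).map (fun x => x q) = μ :=
    (measurePreserving_eval _ q).map_eq
  conv_rhs => rw [← e1]
  rw [integral_map (measurable_pi_apply q).aemeasurable hg.aestronglyMeasurable]

end PiIntegrals

/-! ### Laws of sampling points given by a density. -/

section Density

variable {d : ℕ}

/-- `f` is a probability density on the hypercube. -/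
structure IsDensity (d : ℕ) (f : (Fin d → ℝ) → ℝ) : Prop where
  measurable : Measurable f
  nonneg : ∀ z ∈ hypercube d, 0 ≤ f z
  integral_eq_one : ∫ z in hypercube d, f z = 1

variable {f g : (Fin d → ℝ) → ℝ}

/-- The integral of a nonintegrable function is 0 by convention, so the value 1 forces
integrability. -/
theorem IsDensity.integrableOn (hf : IsDensity d f) : IntegrableOn f (hypercube d) := by
  by_contra h
  have := integral_undef h
  rw [hf.integral_eq_one] at this
  exact one_ne_zero this

theorem IsDensity.ae_nonneg (hf : IsDensity d f) :
    0 ≤ᵐ[volume.restrict (hypercube d)] f :=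
  (ae_restrict_iff' (measurableSet_hypercube d)).2 (Eventually.of_forall hf.nonneg)

theorem IsDensity.isProbabilityMeasure (hf : IsDensity d f) :
    IsProbabilityMeasure (pointLaw d f) := by
  constructor
  rw [pointLaw, withDensity_apply _ MeasurableSet.univ, Measure.restrict_univ,
    ← ofReal_integral_eq_lintegral_ofReal hf.integrableOn hf.ae_nonneg, hf.integral_eq_one,
    ENNReal.ofReal_one]

theorem IsDensity.integral_pointLaw (hf : IsDensity d f) (g : (Fin d → ℝ) → ℝ) :
    ∫ x, g x ∂(pointLaw d f) = ∫ x in hypercube d, f x * g x := by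
  rw [pointLaw, integral_withDensity_eq_integral_toReal_smul hf.measurable.ennreal_ofReal
    (Eventually.of_forall fun _ => ENNReal.ofReal_lt_top)]
  refine setIntegral_congr_fun (measurableSet_hypercube d) fun x hx => ?_
  simp only [smul_eq_mul]
  rw [ENNReal.toReal_ofReal (hf.nonneg x hx)]

theorem IsDensity.integrableOn_mul (hf : IsDensity d f) {g : (Fin d → ℝ) → ℝ} (hg : Measurable g)
    {C : ℝ} (hC : ∀ x, |g x| ≤ C) : IntegrableOn (fun x => f x * g x) (hypercube d) :=
  hf.integrableOn.mul_bdd (c := C) hg.aestronglyMeasurable (Eventually.of_forall hC)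

theorem ae_pointLaw_mem_hypercube (d : ℕ) (f : (Fin d → ℝ) → ℝ) :
    ∀ᵐ x ∂(pointLaw d f), x ∈ hypercube d :=
  (withDensity_absolutelyContinuous _ _).ae_le (ae_restrict_mem (measurableSet_hypercube d))

theorem IsDensity.ae_mem_points (hf : IsDensity d f) (m : ℕ) :
    ∀ᵐ x ∂(pointsLaw d m f), ∀ q, x q ∈ hypercube d := by
  have := hf.isProbabilityMeasure
  rw [ae_all_iff]
  intro q
  exact (measurePreserving_eval (fun _ : Fin m => pointLaw d f) q).quasiMeasurePreserving.ae
    (ae_pointLaw_mem_hypercube d f)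

theorem IsDensity.isProbabilityMeasure_points (hf : IsDensity d f) (m : ℕ) :
    IsProbabilityMeasure (pointsLaw d m f) := by
  have := hf.isProbabilityMeasure
  unfold pointsLaw
  infer_instance

/-- The total variation bound in the form required by `abs_integral_pi_sub_le`. -/
theorem abs_integral_pointLaw_sub_le (hf : IsDensity d f) (hg : IsDensity d g)
    (h : (Fin d → ℝ) → ℝ) (hh : Measurable h) (h1 : ∀ x, |h x| ≤ 1) :
    |∫ x, h x ∂(pointLaw d f) - ∫ x, h x ∂(pointLaw d g)|
      ≤ ∫ x in hypercube d, |f x - g x| := by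
  rw [hf.integral_pointLaw, hg.integral_pointLaw, ← integral_sub (hf.integrableOn_mul hh h1)
    (hg.integrableOn_mul hh h1)]
  refine (abs_integral_le_integral_abs).trans ?_
  refine integral_mono_of_nonneg (Eventually.of_forall fun _ => abs_nonneg _)
    (hf.integrableOn.sub hg.integrableOn).abs (Eventually.of_forall fun x => ?_)
  simp only
  rw [← sub_mul, abs_mul]
  exact mul_le_of_le_one_right (abs_nonneg _) (h1 x)

end Density

/-! ### The resolvent trace as a function of the sampling points. -/

section ResolventTrace

open Matrix

open scoped ComplexOrder

variable {d n m : ℕ}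

/-- The matrix whose columns are the exponentials at the sampling points, weighted by `w`. -/
noncomputable def expMatrix (d n : ℕ) (w : (Fin d → ℝ) → ℝ) (x : Fin m → Fin d → ℝ) :
    Matrix (Fin d → Fin n) (Fin m) ℂ :=
  Matrix.of fun l q => (w (x q) : ℂ) * fourierVec d n (x q) l

/-- The trace of the resolvent `(1 + τ A Aᴴ)⁻¹` of the weighted matrix of exponentials. -/
noncomputable def resolventTrace (d n : ℕ) (w : (Fin d → ℝ) → ℝ) (τ : ℝ)
    (x : Fin m → Fin d → ℝ) : ℝ :=
  ((1 + (τ : ℂ) • (expMatrix d n w x * (expMatrix d n w x)ᴴ))⁻¹).trace.re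

variable {w : (Fin d → ℝ) → ℝ} {τ : ℝ}

theorem posSemidef_smul_mul_conjTranspose {ι κ : Type*} [Fintype κ] [Finite ι] (A : Matrix ι κ ℂ)
    (hτ : 0 ≤ τ) : ((τ : ℂ) • (A * Aᴴ)).PosSemidef :=
  (posSemidef_self_mul_conjTranspose A).smul (by exact_mod_cast hτ)

theorem resolventTrace_nonneg (hτ : 0 ≤ τ) (x : Fin m → Fin d → ℝ) :
    0 ≤ resolventTrace d n w τ x :=
  trace_resolvent_nonneg (posSemidef_smul_mul_conjTranspose _ hτ)

theorem card_frequencies : (Fintype.card (Fin d → Fin n) : ℝ) = (n : ℝ) ^ d := by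
  simp

theorem resolventTrace_le (hτ : 0 ≤ τ) (x : Fin m → Fin d → ℝ) :
    resolventTrace d n w τ x ≤ (n : ℝ) ^ d := by
  rw [← card_frequencies]
  exact trace_resolvent_le_card (posSemidef_smul_mul_conjTranspose _ hτ)

theorem abs_resolventTrace_le (hτ : 0 ≤ τ) (x : Fin m → Fin d → ℝ) :
    |resolventTrace d n w τ x| ≤ (n : ℝ) ^ d := by
  rw [abs_of_nonneg (resolventTrace_nonneg hτ x)]
  exact resolventTrace_le hτ x

theorem measurable_det {α ι : Type*} [MeasurableSpace α] [Fintype ι] [DecidableEq ι]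
    {M : α → Matrix ι ι ℂ} (hM : ∀ i j, Measurable fun a => M a i j) :
    Measurable fun a => (M a).det := by
  simp only [det_apply]
  exact Finset.measurable_fun_sum _ fun σ _ =>
    (Finset.measurable_fun_prod _ fun i _ => hM _ _).const_smul _

/-- The total matrix inverse is the adjugate divided by the determinant, also in the singular case,
so no invertibility is required. -/
theorem measurable_inv_trace {α ι : Type*} [MeasurableSpace α] [Fintype ι] [DecidableEq ι]
    {M : α → Matrix ι ι ℂ} (hM : ∀ i j, Measurable fun a => M a i j) :
    Measurable fun a => ((M a)⁻¹).trace := by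
  simp only [inv_def, trace_smul, smul_eq_mul, Ring.inverse_eq_inv']
  simp only [trace, diag_apply]
  refine (measurable_det hM).inv.mul (Finset.measurable_fun_sum _ fun i _ => ?_)
  simp only [adjugate_apply]
  refine measurable_det fun j k => ?_
  by_cases h : j = i
  · subst h; simp [updateRow_self]
  · simp only [updateRow_ne h]; exact hM j k

theorem measurable_resolventTrace (hw : Measurable w) :
    Measurable (resolventTrace (m := m) d n w τ) := by
  refine Complex.measurable_re.comp (measurable_inv_trace fun l l' => ?_)
  have hA : ∀ l q, Measurable fun x : Fin m → Fin d → ℝ => expMatrix d n w x l q := by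
    intro l q
    simp only [expMatrix, of_apply]
    exact (Complex.measurable_ofReal.comp (hw.comp (measurable_pi_apply q))).mul
      ((continuous_fourierVec l).measurable.comp (measurable_pi_apply q))
  simp only [Matrix.add_apply, Matrix.smul_apply, mul_apply, conjTranspose_apply]
  simp only [smul_eq_mul]
  refine measurable_const.add (measurable_const.mul (Finset.measurable_fun_sum _ fun q _ => ?_))
  exact (hA l q).mul (Complex.continuous_conj.measurable.comp (hA l' q))

theorem expMatrix_mul_conjTranspose (x : Fin m → Fin d → ℝ) :
    expMatrix d n w x * (expMatrix d n w x)ᴴ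
      = ∑ q, ((w (x q) ^ 2 : ℝ) : ℂ) •
        vecMulVec (fourierVec d n (x q)) (star (fourierVec d n (x q))) := by
  ext l l'
  rw [mul_apply, Matrix.sum_apply]
  refine Finset.sum_congr rfl fun q _ => ?_
  simp only [expMatrix, conjTranspose_apply, of_apply, Matrix.smul_apply, vecMulVec_apply, star_mul',
    Complex.star_def, Complex.conj_ofReal, smul_eq_mul, Pi.star_apply]
  push_cast; ring

/-- Gram matrix of the exponentials at the sampling points. -/
noncomputable def gramMatrix (d n : ℕ) (x : Fin m → Fin d → ℝ) : Matrix (Fin m) (Fin m) ℂ :=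
  Matrix.of fun q r => fourierKernel d n (x q) (x r)

theorem conjTranspose_mul_expMatrix (x : Fin m → Fin d → ℝ) :
    (expMatrix d n w x)ᴴ * expMatrix d n w x
      = diagonal (fun q => (w (x q) : ℂ)) * gramMatrix d n x * diagonal (fun q => (w (x q) : ℂ)) := by
  ext q r
  rw [mul_apply, mul_diagonal, diagonal_mul]
  simp only [expMatrix, conjTranspose_apply, of_apply, gramMatrix, fourierKernel, dotProduct,
    Finset.mul_sum, Finset.sum_mul]
  refine Finset.sum_congr rfl fun l _ => ?_
  simp only [star_mul', Complex.star_def, Complex.conj_ofReal, Pi.star_apply]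
  ring

theorem conjTranspose_mul_expMatrix_one (x : Fin m → Fin d → ℝ) :
    (expMatrix d n (fun _ => 1) x)ᴴ * expMatrix d n (fun _ => 1) x = gramMatrix d n x := by
  rw [conjTranspose_mul_expMatrix]
  simp

theorem smul_gramMatrix_posSemidef (hτ : 0 ≤ τ) (x : Fin m → Fin d → ℝ) :
    ((τ : ℂ) • gramMatrix d n x).PosSemidef := by
  rw [← conjTranspose_mul_expMatrix_one]
  have := posSemidef_smul_mul_conjTranspose (expMatrix d n (fun _ => 1) x)ᴴ hτ
  rwa [conjTranspose_conjTranspose] at this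

/-- The trace of the resolvent in terms of the Gram matrix. -/
theorem resolventTrace_eq_gram (hτ : 0 ≤ τ) (x : Fin m → Fin d → ℝ) :
    (n : ℝ) ^ d - resolventTrace d n w τ x = m - ((1 + (τ : ℂ) •
      (diagonal (fun q => (w (x q) : ℂ)) * gramMatrix d n x *
        diagonal (fun q => (w (x q) : ℂ))))⁻¹).trace.re := by
  have h := congrArg Complex.re (trace_resolvent_comm (expMatrix d n w x) hτ)
  rw [conjTranspose_mul_expMatrix, Complex.sub_re, Complex.sub_re, Complex.natCast_re,
    Complex.natCast_re, card_frequencies, Fintype.card_fin] at h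
  rw [resolventTrace]
  linarith

/-- One more point is a rank-one update, regardless of the position at which it is inserted. -/
theorem expMatrix_insertNth (q : Fin (m + 1)) (y : Fin d → ℝ) (x : Fin m → Fin d → ℝ) :
    expMatrix d n w (q.insertNth y x : Fin (m + 1) → Fin d → ℝ) *
        (expMatrix d n w (q.insertNth y x : Fin (m + 1) → Fin d → ℝ))ᴴ
      = expMatrix d n w x * (expMatrix d n w x)ᴴ +
        ((w y ^ 2 : ℝ) : ℂ) • vecMulVec (fourierVec d n y) (star (fourierVec d n y)) := by
  rw [expMatrix_mul_conjTranspose, expMatrix_mul_conjTranspose, Fin.sum_univ_succAbove _ q]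
  simp only [Fin.insertNth_apply_same, Fin.insertNth_apply_succAbove]
  rw [add_comm]

theorem resolventTrace_insertNth (hτ : 0 ≤ τ) (q : Fin (m + 1)) (y : Fin d → ℝ)
    (x : Fin m → Fin d → ℝ) :
    resolventTrace d n w τ (q.insertNth y x : Fin (m + 1) → Fin d → ℝ) ≤ resolventTrace d n w τ x ∧
    resolventTrace d n w τ x
      ≤ resolventTrace d n w τ (q.insertNth y x : Fin (m + 1) → Fin d → ℝ) + 1 := by
  have h := trace_resolvent_rank_one (posSemidef_smul_mul_conjTranspose (expMatrix d n w x) hτ)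
    (fourierVec d n y) (mul_nonneg hτ (sq_nonneg (w y)))
  unfold resolventTrace
  rw [expMatrix_insertNth, smul_add, smul_smul]
  rwa [Complex.ofReal_mul] at h

/-- A point where the weight vanishes is invisible. With the indicator of a cell as weight, this
permits the expansion by the number of points in the cell. -/
theorem resolventTrace_insertNth_of_eq_zero (q : Fin (m + 1)) {y : Fin d → ℝ} (hy : w y = 0)
    (x : Fin m → Fin d → ℝ) :
    resolventTrace d n w τ (q.insertNth y x : Fin (m + 1) → Fin d → ℝ)
      = resolventTrace d n w τ x := by
  unfold resolventTrace
  rw [expMatrix_insertNth, hy]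
  simp

/-- Both configurations insert one point into the same remaining points, so both traces lie in one
interval of length 1. This gives the constant 1 rather than 2. -/
theorem abs_resolventTrace_update_sub_le (hτ : 0 ≤ τ) (x : Fin m → Fin d → ℝ) (q : Fin m)
    (y : Fin d → ℝ) :
    |resolventTrace d n w τ (Function.update x q y) - resolventTrace d n w τ x| ≤ 1 := by
  cases m with
  | zero => exact q.elim0
  | succ m =>
    have h1 := resolventTrace_insertNth (n := n) (w := w) hτ q y (q.removeNth x)
    have h2 := resolventTrace_insertNth (n := n) (w := w) hτ q (x q) (q.removeNth x)
    rw [Fin.insertNth_removeNth] at h1 h2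
    rw [Function.update_eq_self] at h2
    rw [abs_le]
    constructor <;> linarith [h1.1, h1.2, h2.1, h2.2]

theorem trace_expMatrix_mul_conjTranspose (x : Fin m → Fin d → ℝ) :
    (expMatrix d n (fun _ => 1) x * (expMatrix d n (fun _ => 1) x)ᴴ).trace = m * (n : ℂ) ^ d := by
  rw [trace_mul_comm, conjTranspose_mul_expMatrix_one]
  simp [trace, gramMatrix, fourierKernel_self]

end ResolventTrace

/-! ### Stability of the finite transform in the density and in the parameter. -/

section EtaFinite

open Matrix

variable {d n m : ℕ} {f g : (Fin d → ℝ) → ℝ}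

theorem vandermondeFold_eq (x : Fin m → Fin d → ℝ) :
    vandermondeFold d n m x = (((Real.sqrt m)⁻¹ : ℝ) : ℂ) • expMatrix d n (fun _ => 1) x := by
  ext l q
  simp [vandermondeFold, expMatrix, fourierVec]

theorem vandermondeFold_mul_conjTranspose (x : Fin m → Fin d → ℝ) :
    vandermondeFold d n m x * (vandermondeFold d n m x)ᴴ
      = (((m : ℝ)⁻¹ : ℝ) : ℂ) •
        (expMatrix d n (fun _ => 1) x * (expMatrix d n (fun _ => 1) x)ᴴ) := by
  rw [vandermondeFold_eq, conjTranspose_smul, Matrix.smul_mul, Matrix.mul_smul, smul_smul]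
  congr 1
  rw [Complex.star_def, Complex.conj_ofReal, ← Complex.ofReal_mul, ← mul_inv,
    Real.mul_self_sqrt (Nat.cast_nonneg m)]

theorem etaFinite_eq (s : ℝ) :
    etaFinite d n m f s
      = ∫ x, resolventTrace d n (fun _ => 1) (s / m) x / (n : ℝ) ^ d ∂(pointsLaw d m f) := by
  unfold etaFinite resolventTrace
  congr 1
  ext x
  rw [vandermondeFold_mul_conjTranspose, smul_smul, ← Complex.ofReal_mul, add_comm, div_eq_mul_inv s]

theorem integrable_resolventTrace_div (hf : IsDensity d f) {τ : ℝ} (hτ : 0 ≤ τ)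
    {w : (Fin d → ℝ) → ℝ} (hw : Measurable w) :
    Integrable (fun x => resolventTrace d n w τ x / (n : ℝ) ^ d) (pointsLaw d m f) := by
  have := hf.isProbabilityMeasure_points m
  refine (integrable_of_measurable_bounded (measurable_resolventTrace hw)
    fun x => abs_resolventTrace_le hτ x).div_const _

/-- Bounded differences over `m` points, normalized by `n^d`. In the growth regime the factor `m /
n^d` stays bounded, so L¹ approximation of the density is enough. -/
theorem abs_etaFinite_sub_density_le (hf : IsDensity d f) (hg : IsDensity d g) {s : ℝ}
    (hs : 0 ≤ s) :
    |etaFinite d n m f s - etaFinite d n m g s|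
      ≤ m / (n : ℝ) ^ d * ∫ x in hypercube d, |f x - g x| := by
  have := hf.isProbabilityMeasure
  have := hg.isProbabilityMeasure
  have hτ : 0 ≤ s / m := by positivity
  have h := abs_integral_pi_sub_le (pointLaw d f) (pointLaw d g)
    (abs_integral_pointLaw_sub_le hf hg) m
    (measurable_resolventTrace (n := n) (w := fun _ => 1) (τ := s / m) measurable_const)
    (fun x => abs_resolventTrace_le hτ x) (fun x q y => abs_resolventTrace_update_sub_le hτ x q y)
  rw [etaFinite_eq, etaFinite_eq, integral_div, integral_div, ← sub_div, abs_div,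
    abs_of_nonneg (by positivity : 0 ≤ (n : ℝ) ^ d), div_mul_eq_mul_div]
  exact div_le_div_of_nonneg_right h (by positivity)

/-- The Lipschitz constant is 1 because `Tr A Aᴴ = m n^d`: the `m` cancels against `τ = s / m` and
the `n^d` against the normalization. -/
theorem abs_etaFinite_sub_param_le (hf : IsDensity d f) {s s' : ℝ} (hs : 0 ≤ s) (hs' : 0 ≤ s')
    (hn : 0 < n) (hm : 0 < m) :
    |etaFinite d n m f s - etaFinite d n m f s'| ≤ |s - s'| := by
  have := hf.isProbabilityMeasure_points m
  have hτ : 0 ≤ s / m := by positivity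
  have hτ' : 0 ≤ s' / m := by positivity
  rw [etaFinite_eq, etaFinite_eq, ← integral_sub
    (integrable_resolventTrace_div hf hτ measurable_const)
    (integrable_resolventTrace_div hf hτ' measurable_const), ← Real.norm_eq_abs]
  refine (norm_integral_le_of_norm_le_const (C := |s - s'|)
    (Eventually.of_forall fun x => ?_)).trans (by simp)
  have h := abs_trace_resolvent_smul_sub_le (expMatrix d n (fun _ => 1) x) hτ hτ'
  rw [trace_expMatrix_mul_conjTranspose] at h
  have hre : ((m : ℂ) * (n : ℂ) ^ d).re = m * (n : ℝ) ^ d := by norm_cast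
  have hn' : (0 : ℝ) < (n : ℝ) ^ d := by positivity
  have hm' : (0 : ℝ) < m := by exact_mod_cast hm
  rw [hre] at h
  rw [Real.norm_eq_abs, ← sub_div, abs_div, abs_of_pos hn', div_le_iff₀ hn']
  refine h.trans (le_of_eq ?_)
  rw [← sub_div, abs_div, abs_of_pos hm']
  field_simp

end EtaFinite

/-! ### Upper bound from the estimator weighted by the inverse density. -/

section UpperBound

variable {d n m : ℕ} {f : (Fin d → ℝ) → ℝ}

/-- The inverse of the density where the density exceeds `δ`, and zero elsewhere. -/
noncomputable def truncInv (f : (Fin d → ℝ) → ℝ) (δ : ℝ) : (Fin d → ℝ) → ℝ :=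
  {z | δ < f z}.indicator fun z => (f z)⁻¹

theorem measurable_truncInv (hf : Measurable f) (δ : ℝ) : Measurable (truncInv f δ) :=
  hf.inv.indicator (measurableSet_lt measurable_const hf)

theorem truncInv_nonneg {δ : ℝ} (hδ : 0 < δ) (x : Fin d → ℝ) : 0 ≤ truncInv f δ x := by
  refine Set.indicator_nonneg (fun z hz => ?_) x
  exact inv_nonneg.2 (hδ.trans hz).le

theorem truncInv_le {δ : ℝ} (hδ : 0 < δ) (x : Fin d → ℝ) : truncInv f δ x ≤ δ⁻¹ := by
  refine Set.indicator_le' (fun z hz => ?_) (fun z _ => inv_nonneg.2 hδ.le) x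
  exact inv_anti₀ hδ (le_of_lt hz)

theorem mul_truncInv {δ : ℝ} (hδ : 0 < δ) (x : Fin d → ℝ) :
    f x * truncInv f δ x = {z | δ < f z}.indicator (fun _ => (1 : ℝ)) x := by
  by_cases hx : δ < f x
  · have : f x ≠ 0 := (hδ.trans hx).ne'
    simp [truncInv, hx, this]
  · simp [truncInv, hx]

theorem abs_truncInv_le {δ : ℝ} (hδ : 0 < δ) (x : Fin d → ℝ) : |truncInv f δ x| ≤ δ⁻¹ := by
  rw [abs_of_nonneg (truncInv_nonneg hδ x)]; exact truncInv_le hδ x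

variable {δ : ℝ}

/-- The weight cancels the density on `{f > δ}`, leaving Lebesgue measure there. -/
theorem integral_truncInv (hf : IsDensity d f) (hδ : 0 < δ) :
    ∫ x, truncInv f δ x ∂(pointLaw d f) = volume.real (hypercube d ∩ {z | δ < f z}) := by
  rw [hf.integral_pointLaw]
  simp only [mul_truncInv hδ]
  rw [setIntegral_indicator (measurableSet_lt measurable_const hf.measurable), setIntegral_const,
    smul_eq_mul, mul_one]

/-- One factor cancels the density; the other is at most `1 / δ`. This is the price of the noise and
of the repeated indices. -/
theorem integral_truncInv_sq_le (hf : IsDensity d f) (hδ : 0 < δ) :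
    ∫ x, truncInv f δ x ^ 2 ∂(pointLaw d f) ≤ δ⁻¹ := by
  rw [hf.integral_pointLaw]
  have : ∀ x, f x * truncInv f δ x ^ 2 ≤ δ⁻¹ := by
    intro x
    rw [sq, ← mul_assoc, mul_truncInv hδ]
    refine (mul_le_of_le_one_left (truncInv_nonneg hδ x) ?_).trans (truncInv_le hδ x)
    exact Set.indicator_le_self' (fun _ _ => zero_le_one) x
  have hi : IntegrableOn (fun x => f x * truncInv f δ x ^ 2) (hypercube d) :=
    hf.integrableOn_mul ((measurable_truncInv hf.measurable δ).pow_const 2) (C := δ⁻¹ ^ 2)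
      fun x => by rw [abs_pow]; exact pow_le_pow_left₀ (abs_nonneg _) (abs_truncInv_le hδ x) 2
  refine (integral_mono hi (integrable_const _) this).trans ?_
  simp

/-- Both weights cancel a density; extending the inner integral to the whole cube gives the full
kernel mass `n^d`. -/
theorem integral_truncInv_kernel_le (hf : IsDensity d f) (hδ : 0 < δ) :
    ∫ x, ∫ y, truncInv f δ x * truncInv f δ y * ‖fourierKernel d n x y‖ ^ 2
      ∂(pointLaw d f) ∂(pointLaw d f)
      ≤ (n : ℝ) ^ d * volume.real (hypercube d ∩ {z | δ < f z}) := by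
  have := hf.isProbabilityMeasure
  have hinner : ∀ x, ∫ y, truncInv f δ x * truncInv f δ y * ‖fourierKernel d n x y‖ ^ 2
      ∂(pointLaw d f) ≤ truncInv f δ x * (n : ℝ) ^ d := by
    intro x
    simp only [mul_assoc]
    rw [integral_const_mul]
    refine mul_le_mul_of_nonneg_left ?_ (truncInv_nonneg hδ x)
    rw [hf.integral_pointLaw, ← integral_norm_sq_fourierKernel (n := n) x]
    refine integral_mono_of_nonneg (Eventually.of_forall fun y => ?_)
      (integrable_hypercube_of_bounded (measurable_norm_sq_fourierKernel_right x)
        (C := ((n : ℝ) ^ d) ^ 2) fun y => by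
          rw [abs_of_nonneg (by positivity)]; exact norm_sq_fourierKernel_le _ _)
      (Eventually.of_forall fun y => ?_)
    · simp only [Pi.zero_apply]
      rw [← mul_assoc, mul_truncInv hδ]
      exact mul_nonneg (Set.indicator_nonneg (fun _ _ => zero_le_one) _) (by positivity)
    · simp only
      rw [← mul_assoc, mul_truncInv hδ]
      exact mul_le_of_le_one_left (by positivity)
        (Set.indicator_le_self' (fun _ _ => zero_le_one) _)
  have hnn : ∀ x y, 0 ≤ truncInv f δ x * truncInv f δ y * ‖fourierKernel d n x y‖ ^ 2 :=
    fun x y => mul_nonneg (mul_nonneg (truncInv_nonneg hδ x) (truncInv_nonneg hδ y)) (by positivity)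
  calc _ ≤ ∫ x, truncInv f δ x * (n : ℝ) ^ d ∂(pointLaw d f) := by
        refine integral_mono_of_nonneg (Eventually.of_forall fun x => integral_nonneg (hnn x)) ?_
          (Eventually.of_forall hinner)
        exact (integrable_of_measurable_bounded (measurable_truncInv hf.measurable δ)
          (abs_truncInv_le hδ)).mul_const _
    _ = _ := by rw [integral_mul_const, integral_truncInv hf hδ, mul_comm]

theorem resolventTrace_le_estimator (hn : 0 < n) (hm : 0 < m) {γ : ℝ} (hγ : 0 < γ)
    (w : (Fin d → ℝ) → ℝ) (x : Fin m → Fin d → ℝ) :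
    resolventTrace d n (fun _ => 1) (γ / (n : ℝ) ^ d) x ≤ (n : ℝ) ^ d
      - 2 * ((n : ℝ) ^ d / m * ∑ q, w (x q))
      + ((m : ℝ) ^ 2)⁻¹ * ∑ q, ∑ r, w (x q) * w (x r) * ‖fourierKernel d n (x q) (x r)‖ ^ 2
      + ((n : ℝ) ^ d) ^ 2 / (γ * (m : ℝ) ^ 2) * ∑ q, w (x q) ^ 2 := by
  have hN : (0 : ℝ) < (n : ℝ) ^ d := by positivity
  have hm' : (0 : ℝ) < m := by exact_mod_cast hm
  -- The weight `n^d w / (γ m)` is chosen so that `τ A D Aᴴ = (1/m) ∑ w(x_q) e e^H`. For the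
  -- truncated inverse density its mean is the integral of `e_z e_z^H` over `{f > δ}`.
  have h := trace_resolvent_le_estimator (expMatrix d n (fun _ => 1) x)
    (τ := γ / (n : ℝ) ^ d) (by positivity) (fun q => (n : ℝ) ^ d / (γ * m) * w (x q))
  rw [conjTranspose_mul_expMatrix_one, card_frequencies] at h
  have hdiag : ∀ q, (gramMatrix d n x q q).re = (n : ℝ) ^ d := by
    intro q
    rw [gramMatrix, Matrix.of_apply, fourierKernel_self]
    norm_cast
  simp only [hdiag] at h
  refine h.trans (le_of_eq ?_)
  have e1 : ∑ q, (n : ℝ) ^ d / (γ * m) * w (x q) * (n : ℝ) ^ d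
      = ((n : ℝ) ^ d) ^ 2 / (γ * m) * ∑ q, w (x q) := by
    rw [Finset.mul_sum]; exact Finset.sum_congr rfl fun q _ => by ring
  have e2 : ∑ q, ∑ r, (n : ℝ) ^ d / (γ * m) * w (x q) * ((n : ℝ) ^ d / (γ * m) * w (x r)) *
      ‖gramMatrix d n x q r‖ ^ 2 = ((n : ℝ) ^ d / (γ * m)) ^ 2 *
        ∑ q, ∑ r, w (x q) * w (x r) * ‖fourierKernel d n (x q) (x r)‖ ^ 2 := by
    rw [Finset.mul_sum]
    refine Finset.sum_congr rfl fun q _ => ?_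
    rw [Finset.mul_sum]
    refine Finset.sum_congr rfl fun r _ => ?_
    rw [gramMatrix, Matrix.of_apply]; ring
  have e3 : ∑ q, ((n : ℝ) ^ d / (γ * m) * w (x q)) ^ 2 * (n : ℝ) ^ d
      = ((n : ℝ) ^ d) ^ 3 / (γ * m) ^ 2 * ∑ q, w (x q) ^ 2 := by
    rw [Finset.mul_sum]; exact Finset.sum_congr rfl fun q _ => by ring
  rw [e1, e2, e3]
  field_simp

/-- Nonasymptotic bound: the error is at most the measure of the region where the density is at
most `δ`, up to a multiple of the aspect ratio. -/
theorem etaFinite_le (hf : IsDensity d f) (hδ : 0 < δ) (hn : 0 < n) (hm : 0 < m) {γ : ℝ}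
    (hγ : 0 < γ) :
    etaFinite d n m f (γ / aspectRatio d n m)
      ≤ 1 - volume.real (hypercube d ∩ {z | δ < f z})
        + aspectRatio d n m * ((1 + γ⁻¹) * δ⁻¹) := by
  have := hf.isProbabilityMeasure
  have := hf.isProbabilityMeasure_points m
  have hN : (0 : ℝ) < (n : ℝ) ^ d := by positivity
  have hm' : (0 : ℝ) < m := by exact_mod_cast hm
  set a := volume.real (hypercube d ∩ {z | δ < f z}) with ha
  set w := truncInv f δ with hw
  have hwm : Measurable w := measurable_truncInv hf.measurable δ
  have hwb : ∀ x, |w x| ≤ δ⁻¹ := abs_truncInv_le hδ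
  have hδ' : 0 < δ⁻¹ := inv_pos.2 hδ
  -- The number of points drops out: the resolvent parameter depends on `n` only.
  have hτ : γ / aspectRatio d n m / m = γ / (n : ℝ) ^ d := by
    rw [aspectRatio]; field_simp
  have hi1 : ∀ q : Fin m, Integrable (fun x : Fin m → Fin d → ℝ => w (x q)) (pointsLaw d m f) :=
    fun q => integrable_of_measurable_bounded (hwm.comp (measurable_pi_apply q)) fun x => hwb _
  have hi3 : ∀ q : Fin m, Integrable (fun x : Fin m → Fin d → ℝ => w (x q) ^ 2)
      (pointsLaw d m f) :=
    fun q => integrable_of_measurable_bounded ((hwm.comp (measurable_pi_apply q)).pow_const 2)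
      (C := δ⁻¹ ^ 2) fun x => by
        rw [abs_pow]; exact pow_le_pow_left₀ (abs_nonneg _) (hwb _) 2
  have hgm : Measurable (Function.uncurry fun x y : Fin d → ℝ =>
      w x * w y * ‖fourierKernel d n x y‖ ^ 2) :=
    ((hwm.comp measurable_fst).mul (hwm.comp measurable_snd)).mul measurable_norm_sq_fourierKernel
  have hgb : ∀ x y : Fin d → ℝ, |w x * w y * ‖fourierKernel d n x y‖ ^ 2|
      ≤ δ⁻¹ * δ⁻¹ * ((n : ℝ) ^ d) ^ 2 := by
    intro x y
    rw [abs_mul, abs_mul, abs_of_nonneg (by positivity : 0 ≤ ‖fourierKernel d n x y‖ ^ 2)]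
    exact mul_le_mul (mul_le_mul (hwb _) (hwb _) (abs_nonneg _) hδ'.le)
      (norm_sq_fourierKernel_le _ _) (by positivity) (by positivity)
  have hi2 : ∀ q r : Fin m, Integrable (fun x : Fin m → Fin d → ℝ =>
      w (x q) * w (x r) * ‖fourierKernel d n (x q) (x r)‖ ^ 2) (pointsLaw d m f) := by
    intro q r
    have hp : Measurable fun x : Fin m → Fin d → ℝ => (x q, x r) :=
      (measurable_pi_apply q).prodMk (measurable_pi_apply r)
    have h := hgm.comp hp
    exact integrable_of_measurable_bounded h fun x => hgb _ _
  have E1 : ∀ q : Fin m, ∫ x, w (x q) ∂(pointsLaw d m f) = a := by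
    intro q
    rw [pointsLaw, integral_pi_eval _ q hwm, integral_truncInv hf hδ]
  have E3 : ∀ q : Fin m, ∫ x, w (x q) ^ 2 ∂(pointsLaw d m f) ≤ δ⁻¹ := by
    intro q
    rw [pointsLaw, integral_pi_eval _ q (hwm.pow_const 2)]
    exact integral_truncInv_sq_le hf hδ
  -- Distinct indices are independent points and give the kernel integral. Repeated ones have the
  -- kernel value `n^d` and cost the extra `n^{2d} / δ`.
  have E2 : ∀ q r : Fin m, ∫ x, w (x q) * w (x r) * ‖fourierKernel d n (x q) (x r)‖ ^ 2
      ∂(pointsLaw d m f) ≤ (n : ℝ) ^ d * a + if q = r then ((n : ℝ) ^ d) ^ 2 * δ⁻¹ else 0 := by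
    intro q r
    split_ifs with h
    · subst h
      have e : ∀ x : Fin m → Fin d → ℝ, w (x q) * w (x q) * ‖fourierKernel d n (x q) (x q)‖ ^ 2
          = ((n : ℝ) ^ d) ^ 2 * w (x q) ^ 2 := by
        intro x
        rw [fourierKernel_self, norm_pow, Complex.norm_natCast]; ring
      simp only [e]
      rw [integral_const_mul]
      have := mul_le_mul_of_nonneg_left (E3 q) (by positivity : 0 ≤ ((n : ℝ) ^ d) ^ 2)
      have h0 : 0 ≤ (n : ℝ) ^ d * a := mul_nonneg hN.le measureReal_nonneg
      linarith
    · rw [add_zero, pointsLaw, integral_pi_eval_two _ h hgm hgb]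
      exact integral_truncInv_kernel_le hf hδ
  rw [etaFinite_eq, integral_div, hτ, div_le_iff₀ hN]
  have hiA : Integrable (fun x : Fin m → Fin d → ℝ => (n : ℝ) ^ d
      - 2 * ((n : ℝ) ^ d / m * ∑ q, w (x q))) (pointsLaw d m f) :=
    (integrable_const _).sub (((integrable_finsetSum _ fun q _ => hi1 q).const_mul _).const_mul _)
  have hiB : Integrable (fun x : Fin m → Fin d → ℝ => ((m : ℝ) ^ 2)⁻¹ *
      ∑ q, ∑ r, w (x q) * w (x r) * ‖fourierKernel d n (x q) (x r)‖ ^ 2) (pointsLaw d m f) :=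
    (integrable_finsetSum _ fun q _ => integrable_finsetSum _ fun r _ => hi2 q r).const_mul _
  have hiC : Integrable (fun x : Fin m → Fin d → ℝ =>
      ((n : ℝ) ^ d) ^ 2 / (γ * (m : ℝ) ^ 2) * ∑ q, w (x q) ^ 2) (pointsLaw d m f) :=
    (integrable_finsetSum _ fun q _ => hi3 q).const_mul _
  have hmono : ∫ x, resolventTrace d n (fun _ => 1) (γ / (n : ℝ) ^ d) x ∂(pointsLaw d m f) ≤ _ :=
    integral_mono (integrable_of_measurable_bounded
      (measurable_resolventTrace measurable_const)
      fun x => abs_resolventTrace_le (by positivity) x) ((hiA.add hiB).add hiC)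
      fun x => resolventTrace_le_estimator hn hm hγ w x
  refine hmono.trans ?_
  rw [integral_add' (hiA.add hiB) hiC, integral_add' hiA hiB,
    integral_sub (integrable_const _)
      (((integrable_finsetSum _ fun q _ => hi1 q).const_mul _).const_mul _),
    integral_const_mul, integral_const_mul, integral_const_mul, integral_const_mul,
    integral_finsetSum _ fun q _ => hi1 q, integral_finsetSum _ fun q _ => hi3 q,
    integral_finsetSum _ fun q _ => integrable_finsetSum _ fun r _ => hi2 q r]
  have S2 : ∑ q : Fin m, ∫ x, ∑ r, w (x q) * w (x r) * ‖fourierKernel d n (x q) (x r)‖ ^ 2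
      ∂(pointsLaw d m f) ≤ (m : ℝ) ^ 2 * ((n : ℝ) ^ d * a) + m * (((n : ℝ) ^ d) ^ 2 * δ⁻¹) := by
    calc _ ≤ ∑ q : Fin m, ∑ r : Fin m,
          ((n : ℝ) ^ d * a + if q = r then ((n : ℝ) ^ d) ^ 2 * δ⁻¹ else 0) := by
          refine Finset.sum_le_sum fun q _ => ?_
          rw [integral_finsetSum _ fun r _ => hi2 q r]
          exact Finset.sum_le_sum fun r _ => E2 q r
      _ = _ := by
          simp [Finset.sum_add_distrib]
          ring
  have S3 : ∑ q : Fin m, ∫ x, w (x q) ^ 2 ∂(pointsLaw d m f) ≤ m * δ⁻¹ := by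
    refine (Finset.sum_le_sum fun q _ => E3 q).trans ?_
    simp
  simp only [E1]
  -- Divided by `n^d`, the linear term gives `-2a` and the pairs give `a`, leaving `1 - a`. Repeated
  -- indices add `aspectRatio / δ` and the noise adds `aspectRatio / (γ δ)`.
  have S2' := mul_le_mul_of_nonneg_left S2 (by positivity : 0 ≤ ((m : ℝ) ^ 2)⁻¹)
  have S3' := mul_le_mul_of_nonneg_left S3
    (by positivity : 0 ≤ ((n : ℝ) ^ d) ^ 2 / (γ * (m : ℝ) ^ 2))
  have e2 : ((m : ℝ) ^ 2)⁻¹ * ((m : ℝ) ^ 2 * ((n : ℝ) ^ d * a) + m * (((n : ℝ) ^ d) ^ 2 * δ⁻¹))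
      = (n : ℝ) ^ d * a + (n : ℝ) ^ d * (aspectRatio d n m * δ⁻¹) := by
    rw [aspectRatio]; field_simp
  have e3 : ((n : ℝ) ^ d) ^ 2 / (γ * (m : ℝ) ^ 2) * (m * δ⁻¹)
      = (n : ℝ) ^ d * (aspectRatio d n m * (γ⁻¹ * δ⁻¹)) := by
    rw [aspectRatio]; field_simp
  have e1 : (n : ℝ) ^ d / m * ∑ _q : Fin m, a = (n : ℝ) ^ d * a := by
    simp; field_simp
  rw [e1, integral_const, probReal_univ, one_smul]
  rw [e2] at S2'
  rw [e3] at S3'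
  linarith

end UpperBound

/-! ### Lower bound by integrating tangent lines over the cube. -/

section LowerBound

open Matrix

variable {d n m : ℕ} {f : (Fin d → ℝ) → ℝ}

/-- The integral of `e_z e_z^H` is the identity matrix, so a trace is an integral of diagonal
values. -/
theorem integral_quadraticForm_fourierVec (Z : Matrix (Fin d → Fin n) (Fin d → Fin n) ℂ) :
    ∫ z in hypercube d, (star (fourierVec d n z) ⬝ᵥ (Z *ᵥ fourierVec d n z)).re = Z.trace.re := by
  have hc : Continuous fun z => star (fourierVec d n z) ⬝ᵥ (Z *ᵥ fourierVec d n z) := by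
    simp only [dotProduct, mulVec, Pi.star_apply]
    refine continuous_finsetSum _ fun l _ => ((continuous_fourierVec l).star).mul ?_
    exact continuous_finsetSum _ fun l' _ => continuous_const.mul (continuous_fourierVec l')
  have hn1 : ∀ (z : Fin d → ℝ) (l : Fin d → Fin n), ‖fourierVec d n z l‖ = 1 := by
    intro z l
    rw [fourierVec, show -2 * (Real.pi : ℂ) * Complex.I * ∑ j, ((l j : ℕ) : ℂ) * ((z j : ℝ) : ℂ)
      = ((-2 * Real.pi * ∑ j, ((l j : ℕ) : ℝ) * z j : ℝ) : ℂ) * Complex.I by push_cast; ring]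
    exact Complex.norm_exp_ofReal_mul_I _
  have hterm : ∀ l l' : Fin d → Fin n, Integrable (fun z => Z l l' *
      (fourierVec d n z l' * star (fourierVec d n z l))) (volume.restrict (hypercube d)) := by
    intro l l'
    refine Integrable.of_bound (C := ‖Z l l'‖) ?_ (Eventually.of_forall fun z => ?_)
    · exact (continuous_const.mul ((continuous_fourierVec l').mul
        (continuous_fourierVec l).star)).aestronglyMeasurable
    · rw [norm_mul, norm_mul, norm_star, hn1, hn1, mul_one, mul_one]
  have e : ∀ z, star (fourierVec d n z) ⬝ᵥ (Z *ᵥ fourierVec d n z)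
      = ∑ l, ∑ l', Z l l' * (fourierVec d n z l' * star (fourierVec d n z l)) := by
    intro z
    simp only [dotProduct, mulVec, Pi.star_apply, Finset.mul_sum]
    exact Finset.sum_congr rfl fun l _ => Finset.sum_congr rfl fun l' _ => by ring
  have hint : Integrable (fun z => star (fourierVec d n z) ⬝ᵥ (Z *ᵥ fourierVec d n z))
      (volume.restrict (hypercube d)) := by
    simp only [e]
    exact integrable_finsetSum _ fun l _ => integrable_finsetSum _ fun l' _ => hterm l l'
  have h := integral_re hint
  simp only [RCLike.re_to_complex] at h
  rw [h]
  congr 1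
  simp only [e]
  rw [integral_finsetSum _ fun l _ => integrable_finsetSum _ fun l' _ => hterm l l']
  simp only [integral_finsetSum _ fun l' _ => hterm _ l', integral_const_mul,
    integral_fourierVec_mul_star]
  simp [trace]

theorem quadraticForm_fourierVec {τ : ℝ} (x : Fin m → Fin d → ℝ) (z : Fin d → ℝ) :
    (star (fourierVec d n z) ⬝ᵥ ((1 + (τ : ℂ) •
      (expMatrix d n (fun _ => 1) x * (expMatrix d n (fun _ => 1) x)ᴴ)) *ᵥ fourierVec d n z)).re
      = (n : ℝ) ^ d + τ * ∑ q, ‖fourierKernel d n z (x q)‖ ^ 2 := by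
  have e : ∀ q, star (fourierVec d n z) ⬝ᵥ
      (vecMulVec (fourierVec d n (x q)) (star (fourierVec d n (x q))) *ᵥ fourierVec d n z)
      = ((‖fourierKernel d n z (x q)‖ ^ 2 : ℝ) : ℂ) := by
    intro q
    rw [vecMulVec_mulVec, dotProduct_smul]
    change MulOpposite.op (fourierKernel d n (x q) z) • fourierKernel d n z (x q) = _
    rw [← star_fourierKernel z (x q), op_smul_eq_mul, Complex.star_def,
      Complex.mul_conj, Complex.normSq_eq_norm_sq]
  have e0 : star (fourierVec d n z) ⬝ᵥ fourierVec d n z = ((n : ℂ)) ^ d := fourierKernel_self z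
  rw [add_mulVec, dotProduct_add, one_mulVec, e0, smul_mulVec, dotProduct_smul,
    expMatrix_mul_conjTranspose, sum_mulVec, dotProduct_sum]
  simp only [one_pow, Complex.ofReal_one, one_smul, e]
  rw [← Complex.ofReal_sum, smul_eq_mul, ← Complex.ofReal_mul, Complex.add_re, Complex.ofReal_re]
  congr 1
  norm_cast

/-- The bound `resolvent_quadratic_lower` at `u = e_z`, integrated over `z`. The slope `ψ` may vary
with position but not with the sampling points, so expectations become explicit. -/
theorem resolventTrace_ge {τ : ℝ} (hτ : 0 ≤ τ) (x : Fin m → Fin d → ℝ) {ψ : (Fin d → ℝ) → ℝ}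
    (hψ : Measurable ψ) (hψ1 : ∀ z, |ψ z| ≤ 1) :
    (n : ℝ) ^ d * (∫ z in hypercube d, (2 * ψ z - ψ z ^ 2))
      - τ * ∑ q, ∫ z in hypercube d, ψ z ^ 2 * ‖fourierKernel d n z (x q)‖ ^ 2
      ≤ resolventTrace d n (fun _ => 1) τ x := by
  have hT := posSemidef_smul_mul_conjTranspose (expMatrix d n (fun _ => 1) x) hτ
  have hlow := fun z => resolvent_quadratic_lower hT (fourierVec d n z) (ψ z)
  simp only [quadraticForm_fourierVec] at hlow
  have e0 : ∀ z : Fin d → ℝ, (star (fourierVec d n z) ⬝ᵥ fourierVec d n z).re = (n : ℝ) ^ d := by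
    intro z
    have : star (fourierVec d n z) ⬝ᵥ fourierVec d n z = ((n : ℂ)) ^ d := fourierKernel_self z
    rw [this]; norm_cast
  simp only [e0] at hlow
  have hψ2 : ∀ z, |ψ z ^ 2| ≤ 1 := fun z => by
    rw [abs_pow]; exact pow_le_one₀ (abs_nonneg _) (hψ1 z)
  have hi1 : IntegrableOn ψ (hypercube d) := integrable_hypercube_of_bounded hψ hψ1
  have hi2 : IntegrableOn (fun z => ψ z ^ 2) (hypercube d) :=
    integrable_hypercube_of_bounded (hψ.pow_const 2) hψ2
  have hmK : ∀ q, Measurable fun z => ‖fourierKernel d n z (x q)‖ ^ 2 := by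
    intro q
    simp only [norm_fourierKernel_comm _ (x q)]
    exact measurable_norm_sq_fourierKernel_right _
  have hi3 : ∀ q, IntegrableOn (fun z => ψ z ^ 2 * ‖fourierKernel d n z (x q)‖ ^ 2)
      (hypercube d) := by
    intro q
    refine integrable_hypercube_of_bounded ((hψ.pow_const 2).mul (hmK q))
      (C := ((n : ℝ) ^ d) ^ 2) fun z => ?_
    rw [abs_mul, abs_of_nonneg (by positivity : 0 ≤ ‖fourierKernel d n z (x q)‖ ^ 2)]
    exact (mul_le_of_le_one_left (by positivity) (hψ2 z)).trans (norm_sq_fourierKernel_le _ _)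
  have hiL : IntegrableOn (fun z => (n : ℝ) ^ d * (2 * ψ z - ψ z ^ 2)) (hypercube d) :=
    ((hi1.const_mul 2).sub hi2).const_mul _
  have hiR : IntegrableOn (fun z => τ * ∑ q, ψ z ^ 2 * ‖fourierKernel d n z (x q)‖ ^ 2)
      (hypercube d) := (integrable_finsetSum _ fun q _ => hi3 q).const_mul _
  have hZi : IntegrableOn (fun z => (star (fourierVec d n z) ⬝ᵥ ((1 + (τ : ℂ) •
      (expMatrix d n (fun _ => 1) x * (expMatrix d n (fun _ => 1) x)ᴴ))⁻¹ *ᵥ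
        fourierVec d n z)).re) (hypercube d) := by
    have hc : Continuous fun z => (star (fourierVec d n z) ⬝ᵥ ((1 + (τ : ℂ) •
      (expMatrix d n (fun _ => 1) x * (expMatrix d n (fun _ => 1) x)ᴴ))⁻¹ *ᵥ
        fourierVec d n z)).re := by
      simp only [dotProduct, mulVec, Pi.star_apply]
      refine Complex.continuous_re.comp
        (continuous_finsetSum _ fun l _ => ((continuous_fourierVec l).star).mul ?_)
      exact continuous_finsetSum _ fun l' _ => continuous_const.mul (continuous_fourierVec l')
    have hK : IsCompact (Set.univ.pi fun _ : Fin d => Set.Icc (-1 / 2 : ℝ) (1 / 2)) :=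
      isCompact_univ_pi fun _ => isCompact_Icc
    exact (hc.continuousOn.integrableOn_compact hK).mono_set
      (Set.pi_mono fun _ _ => Set.Ico_subset_Icc_self)
  rw [resolventTrace, ← integral_quadraticForm_fourierVec, ← integral_const_mul,
    ← integral_finsetSum _ fun q _ => hi3 q, ← integral_const_mul, ← integral_sub hiL hiR]
  refine integral_mono (hiL.sub hiR) hZi fun z => le_trans (le_of_eq ?_) (hlow z)
  rw [← Finset.mul_sum]
  ring

/-- Lower bound for the expected normalized trace, in terms of the leakage of the squared kernel
from the points into a set `U`. -/
theorem etaFinite_ge (hf : IsDensity d f) (hn : 0 < n) (hm : 0 < m) {s : ℝ} (hs : 0 ≤ s)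
    {U : Set (Fin d → ℝ)} (hU : MeasurableSet U) {t : ℝ} (ht0 : 0 ≤ t) (ht1 : t ≤ 1) :
    volume.real (hypercube d ∩ U) + (1 - volume.real (hypercube d ∩ U)) * (2 * t - t ^ 2)
      - s * t ^ 2 - s * ((∫ y in hypercube d, f y *
        ∫ z in hypercube d, U.indicator (fun _ => 1) z * ‖fourierKernel d n z y‖ ^ 2) / (n : ℝ) ^ d)
      ≤ etaFinite d n m f s := by
  have := hf.isProbabilityMeasure
  have := hf.isProbabilityMeasure_points m
  have hN : (0 : ℝ) < (n : ℝ) ^ d := by positivity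
  have hm' : (0 : ℝ) < m := by exact_mod_cast hm
  have hτ : 0 ≤ s / m := by positivity
  set iU : (Fin d → ℝ) → ℝ := U.indicator fun _ => 1 with hiU
  have hiUm : Measurable iU := measurable_const.indicator hU
  have hiU01 : ∀ z, iU z = 0 ∨ iU z = 1 := fun z => by
    by_cases h : z ∈ U <;> simp [hiU, h]
  -- Slope 1 on `U`, where few points are felt and the diagonal value should be nearly maximal;
  -- slope `t` elsewhere.
  set ψ : (Fin d → ℝ) → ℝ := fun z => t + (1 - t) * iU z with hψd
  have hψm : Measurable ψ := measurable_const.add (measurable_const.mul hiUm)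
  have hψ1 : ∀ z, |ψ z| ≤ 1 := by
    intro z
    rcases hiU01 z with h | h <;> simp only [hψd, h]
    · simpa [abs_of_nonneg ht0] using ht1
    · simp
  -- Splits the penalty into the leakage into `U` and `t²` times the whole kernel mass, which is
  -- exactly `n^d`.
  have hψ2 : ∀ z, ψ z ^ 2 ≤ iU z + t ^ 2 := by
    intro z
    rcases hiU01 z with h | h <;> simp only [hψd, h]
    · simp
    · nlinarith [sq_nonneg t]
  set κ : (Fin d → ℝ) → ℝ := fun y => ∫ z in hypercube d, ψ z ^ 2 * ‖fourierKernel d n z y‖ ^ 2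
    with hκ
  set κU : (Fin d → ℝ) → ℝ := fun y => ∫ z in hypercube d, iU z * ‖fourierKernel d n z y‖ ^ 2
    with hκU
  have hmKz : ∀ y : Fin d → ℝ, Measurable fun z => ‖fourierKernel d n z y‖ ^ 2 := by
    intro y
    simp only [norm_fourierKernel_comm _ y]
    exact measurable_norm_sq_fourierKernel_right _
  have hiK : ∀ y : Fin d → ℝ, IntegrableOn (fun z => ‖fourierKernel d n z y‖ ^ 2) (hypercube d) :=
    fun y => integrable_hypercube_of_bounded (hmKz y) (C := ((n : ℝ) ^ d) ^ 2) fun z => by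
      rw [abs_of_nonneg (by positivity)]; exact norm_sq_fourierKernel_le _ _
  have hbd : ∀ (φ : (Fin d → ℝ) → ℝ), Measurable φ → (∀ z, |φ z| ≤ 1) → ∀ y,
      IntegrableOn (fun z => φ z * ‖fourierKernel d n z y‖ ^ 2) (hypercube d) := by
    intro φ hφ hφ1 y
    refine integrable_hypercube_of_bounded (hφ.mul (hmKz y)) (C := ((n : ℝ) ^ d) ^ 2) fun z => ?_
    rw [abs_mul, abs_of_nonneg (by positivity : 0 ≤ ‖fourierKernel d n z y‖ ^ 2)]
    exact (mul_le_of_le_one_left (by positivity) (hφ1 z)).trans (norm_sq_fourierKernel_le _ _)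
  have hmeas : ∀ (φ : (Fin d → ℝ) → ℝ), Measurable φ →
      Measurable fun y => ∫ z in hypercube d, φ z * ‖fourierKernel d n z y‖ ^ 2 := by
    intro φ hφ
    refine (StronglyMeasurable.integral_prod_right' (ν := volume.restrict (hypercube d))
      (f := fun p : (Fin d → ℝ) × (Fin d → ℝ) => φ p.2 * ‖fourierKernel d n p.2 p.1‖ ^ 2)
      ?_).measurable
    have h1 : Measurable fun p : (Fin d → ℝ) × (Fin d → ℝ) => ‖fourierKernel d n p.2 p.1‖ ^ 2 := by
      simp only [fun p : (Fin d → ℝ) × (Fin d → ℝ) => norm_fourierKernel_comm (n := n) p.2 p.1]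
      exact measurable_norm_sq_fourierKernel
    exact ((hφ.comp measurable_snd).mul h1).stronglyMeasurable
  have hκb : ∀ (φ : (Fin d → ℝ) → ℝ), (∀ z, |φ z| ≤ 1) → ∀ y,
      |∫ z in hypercube d, φ z * ‖fourierKernel d n z y‖ ^ 2| ≤ (n : ℝ) ^ d := by
    intro φ hφ y
    rw [← integral_norm_sq_fourierKernel' (n := n) y]
    refine abs_integral_le_integral_abs.trans ?_
    refine integral_mono_of_nonneg (Eventually.of_forall fun _ => abs_nonneg _) (hiK y)
      (Eventually.of_forall fun z => ?_)
    simp only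
    rw [abs_mul, abs_of_nonneg (by positivity : 0 ≤ ‖fourierKernel d n z y‖ ^ 2)]
    exact mul_le_of_le_one_left (by positivity) (hφ z)
  have hψ2a : ∀ z, |ψ z ^ 2| ≤ 1 := fun z => by
    rw [abs_pow]; exact pow_le_one₀ (abs_nonneg _) (hψ1 z)
  have hiUa : ∀ z, |iU z| ≤ 1 := fun z => by
    rcases hiU01 z with h | h <;> simp [h]
  have hκle : ∀ y, κ y ≤ κU y + t ^ 2 * (n : ℝ) ^ d := by
    intro y
    simp only [hκ, hκU]
    rw [← integral_norm_sq_fourierKernel' (n := n) y, ← integral_const_mul, ← integral_add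
      (hbd _ hiUm hiUa y) ((hiK y).const_mul _)]
    refine integral_mono (hbd _ (hψm.pow_const 2) hψ2a y)
      ((hbd _ hiUm hiUa y).add ((hiK y).const_mul _)) fun z => ?_
    simp only
    rw [← add_mul]
    exact mul_le_mul_of_nonneg_right (hψ2 z) (by positivity)
  have hψint : ∫ z in hypercube d, (2 * ψ z - ψ z ^ 2)
      = volume.real (hypercube d ∩ U)
        + (1 - volume.real (hypercube d ∩ U)) * (2 * t - t ^ 2) := by
    have e : ∀ z, 2 * ψ z - ψ z ^ 2 = (2 * t - t ^ 2) + (1 - (2 * t - t ^ 2)) * iU z := by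
      intro z
      rcases hiU01 z with h | h <;> simp only [hψd, h] <;> ring
    simp only [e]
    rw [integral_add (integrable_const _)
      ((integrable_hypercube_of_bounded hiUm hiUa).const_mul _), integral_const, probReal_univ,
      one_smul, integral_const_mul, hiU, setIntegral_indicator hU, setIntegral_const, smul_eq_mul]
    ring
  have hpt := fun x : Fin m → Fin d → ℝ => resolventTrace_ge (n := n) hτ x hψm hψ1
  have hκm : Measurable κ := hmeas _ (hψm.pow_const 2)
  have hiκ : ∀ q : Fin m, Integrable (fun x : Fin m → Fin d → ℝ => κ (x q)) (pointsLaw d m f) :=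
    fun q => integrable_of_measurable_bounded (hκm.comp (measurable_pi_apply q))
      fun x => hκb _ hψ2a _
  have hE : ∫ y, κ y ∂(pointLaw d f)
      ≤ (∫ y in hypercube d, f y * κU y) + t ^ 2 * (n : ℝ) ^ d := by
    rw [hf.integral_pointLaw]
    have h1 : IntegrableOn (fun y => f y * κU y) (hypercube d) :=
      hf.integrableOn_mul (hmeas _ hiUm) (hκb _ hiUa)
    have h2 : IntegrableOn (fun y => f y * (t ^ 2 * (n : ℝ) ^ d)) (hypercube d) :=
      hf.integrableOn.mul_const _
    calc _ ≤ ∫ y in hypercube d, (f y * κU y + f y * (t ^ 2 * (n : ℝ) ^ d)) := by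
          refine setIntegral_mono_on (hf.integrableOn_mul hκm (hκb _ hψ2a)) (h1.add h2)
            (measurableSet_hypercube d) fun y hy => ?_
          rw [← mul_add]
          exact mul_le_mul_of_nonneg_left (hκle y) (hf.nonneg y hy)
      _ = _ := by
          rw [integral_add h1 h2, integral_mul_const, hf.integral_eq_one, one_mul]
  rw [etaFinite_eq, integral_div, le_div_iff₀ hN]
  have hmono := integral_mono (μ := pointsLaw d m f)
    ((integrable_const _).sub ((integrable_finsetSum _ fun q _ => hiκ q).const_mul (s / m)))
    (integrable_of_measurable_bounded (measurable_resolventTrace measurable_const)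
      fun x => abs_resolventTrace_le hτ x) hpt
  refine le_trans ?_ hmono
  simp only [Pi.sub_apply]
  rw [integral_sub (integrable_const _) ((integrable_finsetSum _ fun q _ => hiκ q).const_mul _),
    integral_const, probReal_univ, one_smul, integral_const_mul,
    integral_finsetSum _ fun q _ => hiκ q, hψint]
  have e1 : ∀ q : Fin m, ∫ x, κ (x q) ∂(pointsLaw d m f) = ∫ y, κ y ∂(pointLaw d f) :=
    fun q => integral_pi_eval _ q hκm
  simp only [e1]
  -- The `m` identical expectations cancel the `1/m` in the resolvent parameter.
  rw [Finset.sum_const, Finset.card_univ, Fintype.card_fin, nsmul_eq_mul, ← mul_assoc,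
    div_mul_cancel₀ _ hm'.ne']
  have hE' := mul_le_mul_of_nonneg_left hE hs
  have e2 : s * ((∫ y in hypercube d, f y * κU y) / (n : ℝ) ^ d) * (n : ℝ) ^ d
      = s * ∫ y in hypercube d, f y * κU y := by field_simp
  nlinarith [hE', e2]

end LowerBound

/-! ### Continuous approximation of densities and negligibility of the leakage. -/

section Approximation

variable {d n m k : ℕ} {f g : (Fin d → ℝ) → ℝ}

theorem integrableOn_integral_hypercube {h : (Fin d → ℝ) → (Fin d → ℝ) → ℝ}
    (hm : Measurable (Function.uncurry h)) {C : ℝ} (hC : ∀ y z, |h y z| ≤ C) :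
    IntegrableOn (fun y => ∫ z in hypercube d, h y z) (hypercube d) := by
  refine integrable_hypercube_of_bounded (C := C) ?_ fun y => ?_
  · exact (StronglyMeasurable.integral_prod_right' (ν := volume.restrict (hypercube d))
      (f := Function.uncurry h) hm.stronglyMeasurable).measurable
  · rw [← Real.norm_eq_abs]
    refine (norm_integral_le_of_norm_le_const (C := C)
      (Eventually.of_forall fun z => hC y z)).trans ?_
    simp

/-- Approximation of a density by a nonnegative continuous function with compact support. -/
theorem IsDensity.exists_continuous_approx (hf : IsDensity d f) {ε : ℝ} (hε : 0 < ε) :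
    ∃ g : (Fin d → ℝ) → ℝ, Continuous g ∧ HasCompactSupport g ∧ (∀ z, 0 ≤ g z) ∧
      ∫ z in hypercube d, |f z - g z| ≤ ε := by
  obtain ⟨g, hgc, hgε, hgcont, hgi⟩ := hf.integrableOn.exists_hasCompactSupport_integral_sub_le hε
  -- Taking the positive part does not move away from `f`, since `f` is nonnegative on the cube.
  refine ⟨fun z => max (g z) 0, hgcont.max continuous_const,
    hgc.comp_left (g := fun t => max t 0) (by simp), fun z => le_max_right _ _, ?_⟩
  refine le_trans ?_ hgε
  refine setIntegral_mono_on ?_ (hf.integrableOn.sub hgi).norm (measurableSet_hypercube d) ?_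
  · exact (hf.integrableOn.sub hgi.pos_part).abs
  · intro z hz
    have h0 := hf.nonneg z hz
    rw [Real.norm_eq_abs]
    have h1 : f z = max (f z) 0 := (max_eq_left h0).symm
    conv_lhs => rw [h1]
    exact abs_max_sub_max_le_abs _ _ _

/-- Approximation of a density by a continuous bounded density. -/
theorem IsDensity.exists_continuous_density (hf : IsDensity d f) {ε : ℝ} (hε : 0 < ε) :
    ∃ (g : (Fin d → ℝ) → ℝ) (M : ℝ), IsDensity d g ∧ Continuous g ∧ 0 ≤ M ∧
      (∀ z, 0 ≤ g z ∧ g z ≤ M) ∧ ∫ z in hypercube d, |f z - g z| ≤ ε := by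
  -- The bound `1/2` keeps the normalizing constant positive; approximation and renormalization each
  -- cost at most `ε / 2`.
  set δ := min (1 / 2) (ε / 2) with hδ
  have hδ0 : 0 < δ := by positivity
  obtain ⟨g, hgc, hgs, hg0, hgε⟩ := hf.exists_continuous_approx hδ0
  obtain ⟨M, hM⟩ := hgc.bounded_above_of_compact_support hgs
  have hgi : IntegrableOn g (hypercube d) := integrable_hypercube_of_bounded hgc.measurable hM
  set c := ∫ z in hypercube d, g z with hc
  have hc1 : |1 - c| ≤ δ := by
    rw [← hf.integral_eq_one, hc, ← integral_sub hf.integrableOn hgi]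
    exact abs_integral_le_integral_abs.trans hgε
  have hcpos : 0 < c := by
    have := (abs_le.1 hc1).2
    have : δ ≤ 1 / 2 := min_le_left _ _
    linarith
  have hM0 : 0 ≤ M := (norm_nonneg _).trans (hM 0)
  refine ⟨fun z => g z / c, M / c, ⟨hgc.measurable.div_const c, fun z _ => by
    have := hg0 z; positivity, ?_⟩, hgc.div_const c, by positivity, fun z => ⟨by
    have := hg0 z; positivity, ?_⟩, ?_⟩
  · rw [integral_div, ← hc, div_self hcpos.ne']
  · exact div_le_div_of_nonneg_right ((le_abs_self _).trans (hM z)) hcpos.le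
  · have h2 : ∫ z in hypercube d, |g z - g z / c| ≤ δ := by
      have e : ∀ z, |g z - g z / c| = g z * (|1 - c| / c) := by
        intro z
        have : g z - g z / c = -(g z * ((1 - c) / c)) := by field_simp; ring
        rw [this, abs_neg, abs_mul, abs_of_nonneg (hg0 z), abs_div, abs_of_pos hcpos]
      simp only [e]
      rw [integral_mul_const, ← hc]
      field_simp
      exact hc1
    have hi2 : IntegrableOn (fun z => g z / c) (hypercube d) := hgi.div_const c
    calc ∫ z in hypercube d, |f z - g z / c|
        ≤ ∫ z in hypercube d, (|f z - g z| + |g z - g z / c|) := by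
          refine integral_mono (hf.integrableOn.sub hi2).abs
            ((hf.integrableOn.sub hgi).abs.add (hgi.sub hi2).abs) fun z => ?_
          exact abs_sub_le _ _ _
      _ ≤ δ + δ := by
          have i1 : IntegrableOn (fun z => |f z - g z|) (hypercube d) :=
            (hf.integrableOn.sub hgi).abs
          have i2 : IntegrableOn (fun z => |g z - g z / c|) (hypercube d) := (hgi.sub hi2).abs
          rw [integral_add i1 i2]
          exact add_le_add hgε h2
      _ ≤ ε := by
          have : δ ≤ ε / 2 := min_le_right _ _
          linarith

theorem dist_le_of_mem_gridCell {i : Fin d → Fin k} {x y : Fin d → ℝ}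
    (hx : x ∈ gridCell d k i) (hy : y ∈ gridCell d k i) : dist x y ≤ 1 / k := by
  refine (dist_pi_le_iff (by positivity)).2 fun j => ?_
  have h1 := hx j (Set.mem_univ j)
  have h2 := hy j (Set.mem_univ j)
  rw [Real.dist_eq, abs_le]
  constructor <;> linarith [h1.1, h1.2, h2.1, h2.2]

/-- A continuous function of compact support varies little within the cells of a fine grid. -/
theorem exists_grid_oscillation_le (hgc : Continuous g) (hgs : HasCompactSupport g) {ε : ℝ}
    (hε : 0 < ε) : ∃ k : ℕ, 0 < k ∧ ∀ (i : Fin d → Fin k) (x y : Fin d → ℝ),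
      x ∈ gridCell d k i → y ∈ gridCell d k i → |g x - g y| ≤ ε := by
  have huc := hgs.uniformContinuous_of_continuous hgc
  obtain ⟨ρ, hρ, h⟩ := Metric.uniformContinuous_iff.1 huc ε hε
  obtain ⟨k, hk⟩ := exists_nat_gt (1 / ρ)
  have hk0 : (0 : ℝ) < k := (by positivity : 0 < 1 / ρ).trans hk
  refine ⟨k, by exact_mod_cast hk0, fun i x y hx hy => ?_⟩
  rw [← Real.dist_eq]
  refine (h ((dist_le_of_mem_gridCell hx hy).trans_lt ?_)).le
  rw [div_lt_iff₀ hk0]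
  rw [div_lt_iff₀ hρ] at hk
  linarith

/-- The mass that the squared kernel transports from the density to the set where the density
vanishes is asymptotically negligible. -/
theorem IsDensity.leakage_le (hf : IsDensity d f) {ε : ℝ} (hε : 0 < ε) :
    ∃ n₀ : ℕ, ∀ n ≥ n₀, ∫ y in hypercube d, f y * ∫ z in hypercube d,
      {z | f z = 0}.indicator (fun _ => 1) z * ‖fourierKernel d n z y‖ ^ 2
      ≤ ε * (n : ℝ) ^ d := by
  -- Four errors of `ε / 4`: replacing `f` by `g`, the mass of `g` on the zero set of `f`, the
  -- oscillation of `g` within a cell, and the off-cell kernel mass. Dividing by `M + 1` avoids the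
  -- case `M = 0`.
  obtain ⟨g, hgc, hgs, hg0, hgε⟩ := hf.exists_continuous_approx (by positivity : 0 < ε / 4)
  obtain ⟨M, hM⟩ := hgc.bounded_above_of_compact_support hgs
  have hM' : ∀ z, g z ≤ M := fun z => (le_abs_self _).trans (hM z)
  have hM0 : 0 ≤ M := (norm_nonneg _).trans (hM 0)
  obtain ⟨k, hk, hosc⟩ := exists_grid_oscillation_le hgc hgs (by positivity : 0 < ε / 4)
  obtain ⟨R, -, hR⟩ := exists_offCell_mass_le d (by positivity : 0 < ε / 4 / (M + 1))
  refine ⟨R * k, fun n hn => ?_⟩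
  have hoff := hR n k hk hn
  have hN : (0 : ℝ) ≤ (n : ℝ) ^ d := by positivity
  have hgi : IntegrableOn g (hypercube d) := integrable_hypercube_of_bounded hgc.measurable hM
  simp only [fun z y => norm_fourierKernel_comm (d := d) (n := n) z y]
  set U : Set (Fin d → ℝ) := {z | f z = 0} with hU
  have hUm : MeasurableSet U := hf.measurable (measurableSet_singleton 0)
  set iU : (Fin d → ℝ) → ℝ := U.indicator fun _ => 1 with hiU
  have hiUm : Measurable iU := measurable_const.indicator hUm
  have hiU0 : ∀ z, 0 ≤ iU z := fun z => Set.indicator_nonneg (fun _ _ => zero_le_one) z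
  have hiU1 : ∀ z, iU z ≤ 1 := fun z => Set.indicator_le_self' (fun _ _ => zero_le_one) z
  have hKb : ∀ y z : Fin d → ℝ, |‖fourierKernel d n y z‖ ^ 2| ≤ ((n : ℝ) ^ d) ^ 2 := fun y z => by
    rw [abs_of_nonneg (by positivity)]; exact norm_sq_fourierKernel_le _ _
  have hbound : ∀ {φ : (Fin d → ℝ) → (Fin d → ℝ) → ℝ} {C : ℝ}, (∀ y z, |φ y z| ≤ C) →
      ∀ y z : Fin d → ℝ, |φ y z * ‖fourierKernel d n y z‖ ^ 2| ≤ C * ((n : ℝ) ^ d) ^ 2 := by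
    intro φ C hφ y z
    rw [abs_mul]
    exact mul_le_mul (hφ y z) (hKb y z) (abs_nonneg _) ((abs_nonneg _).trans (hφ y z))
  have hKm := measurable_norm_sq_fourierKernel (d := d) (n := n)
  have hint : ∀ {φ : (Fin d → ℝ) → (Fin d → ℝ) → ℝ} {C : ℝ}, Measurable (Function.uncurry φ) →
      (∀ y z, |φ y z| ≤ C) → ∀ y,
      IntegrableOn (fun z => φ y z * ‖fourierKernel d n y z‖ ^ 2) (hypercube d) := by
    intro φ C hφm hφ y
    exact integrable_hypercube_of_bounded
      ((hφm.comp (measurable_const.prodMk measurable_id)).mul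
        (measurable_norm_sq_fourierKernel_right y)) (hbound hφ y)
  have hint2 : ∀ {φ : (Fin d → ℝ) → (Fin d → ℝ) → ℝ} {C : ℝ}, Measurable (Function.uncurry φ) →
      (∀ y z, |φ y z| ≤ C) → IntegrableOn (fun y => ∫ z in hypercube d,
        φ y z * ‖fourierKernel d n y z‖ ^ 2) (hypercube d) := by
    intro φ C hφm hφ
    exact integrableOn_integral_hypercube (hφm.mul hKm) (hbound hφ)
  -- the four functions that occur
  have m0 : Measurable (Function.uncurry fun (_ z : Fin d → ℝ) => iU z) := hiUm.comp measurable_snd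
  have b0 : ∀ _ z : Fin d → ℝ, |iU z| ≤ 1 := fun _ z => by rw [abs_of_nonneg (hiU0 z)]; exact hiU1 z
  have m1 : Measurable (Function.uncurry fun (_ z : Fin d → ℝ) => iU z * g z) :=
    (hiUm.mul hgc.measurable).comp measurable_snd
  have b1 : ∀ _ z : Fin d → ℝ, |iU z * g z| ≤ M := fun _ z => by
    rw [abs_of_nonneg (mul_nonneg (hiU0 z) (hg0 z))]
    exact (mul_le_of_le_one_left (hg0 z) (hiU1 z)).trans (hM' z)
  have m2 : Measurable (Function.uncurry fun (_ _ : Fin d → ℝ) => ε / 4) := measurable_const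
  have b2 : ∀ _ _ : Fin d → ℝ, |ε / 4| ≤ ε / 4 := fun _ _ => by rw [abs_of_pos (by positivity)]
  have m3 : Measurable (Function.uncurry fun (y z : Fin d → ℝ) => M * (1 - sameCell d k y z)) :=
    measurable_const.mul (measurable_const.sub measurable_sameCell)
  have b3 : ∀ y z : Fin d → ℝ, |M * (1 - sameCell d k y z)| ≤ M := fun y z => by
    rw [abs_of_nonneg (mul_nonneg hM0 (sub_nonneg.2 (sameCell_le_one _ _)))]
    exact mul_le_of_le_one_right hM0 (by linarith [sameCell_nonneg (k := k) y z])
  have hκ1 : ∀ y, |∫ z in hypercube d, iU z * ‖fourierKernel d n y z‖ ^ 2| ≤ (n : ℝ) ^ d := by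
    intro y
    rw [abs_of_nonneg (integral_nonneg fun z => mul_nonneg (hiU0 z) (by positivity)),
      ← integral_norm_sq_fourierKernel (n := n) y]
    refine integral_mono (hint m0 b0 y) (integrable_hypercube_of_bounded
      (measurable_norm_sq_fourierKernel_right y) (hKb y)) fun z => ?_
    exact mul_le_of_le_one_left (by positivity) (hiU1 z)
  have hκm : Measurable fun y => ∫ z in hypercube d, iU z * ‖fourierKernel d n y z‖ ^ 2 :=
    (StronglyMeasurable.integral_prod_right' (ν := volume.restrict (hypercube d))
      (f := fun p : (Fin d → ℝ) × (Fin d → ℝ) => iU p.2 * ‖fourierKernel d n p.1 p.2‖ ^ 2)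
      (m0.mul hKm).stronglyMeasurable).measurable
  -- replacing `f` by `g`
  have hgκ : IntegrableOn (fun y => g y * ∫ z in hypercube d,
      iU z * ‖fourierKernel d n y z‖ ^ 2) (hypercube d) :=
    hgi.mul_bdd (c := (n : ℝ) ^ d) hκm.aestronglyMeasurable (Eventually.of_forall hκ1)
  have hfg : IntegrableOn (fun y => |f y - g y| * (n : ℝ) ^ d) (hypercube d) :=
    (hf.integrableOn.sub hgi).abs.mul_const _
  have step1 : ∫ y in hypercube d, f y * ∫ z in hypercube d, iU z * ‖fourierKernel d n y z‖ ^ 2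
      ≤ ε / 4 * (n : ℝ) ^ d + ∫ y in hypercube d, g y * ∫ z in hypercube d,
        iU z * ‖fourierKernel d n y z‖ ^ 2 := by
    calc _ ≤ ∫ y in hypercube d, (|f y - g y| * (n : ℝ) ^ d + g y * ∫ z in hypercube d,
        iU z * ‖fourierKernel d n y z‖ ^ 2) := by
          refine integral_mono (hf.integrableOn_mul hκm hκ1) (hfg.add hgκ) fun y => ?_
          simp only
          have h1 := hκ1 y
          set κ := ∫ z in hypercube d, iU z * ‖fourierKernel d n y z‖ ^ 2
          have h2 : (f y - g y) * κ ≤ |f y - g y| * (n : ℝ) ^ d := by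
            refine (le_abs_self _).trans ?_
            rw [abs_mul]
            exact mul_le_mul_of_nonneg_left h1 (abs_nonneg _)
          linarith
      _ ≤ _ := by
          rw [integral_add hfg hgκ, integral_mul_const]
          have := mul_le_mul_of_nonneg_right hgε hN
          linarith
  -- the continuous case
  have hpt : ∀ y ∈ hypercube d, ∀ z ∈ hypercube d,
      g y * iU z ≤ iU z * g z + ε / 4 + M * (1 - sameCell d k y z) := by
    intro y hy z hz
    rcases sameCell_eq_zero_or (k := k) y z with h | ⟨h, i, hyi, hzi⟩
    · rw [h]
      have := mul_le_of_le_one_right (hg0 y) (hiU1 z)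
      have := mul_nonneg (hiU0 z) (hg0 z)
      have := hM' y
      linarith
    · rw [h]
      have h1 := (abs_le.1 (hosc i y z hyi hzi)).2
      have h2 : iU z * (g y - g z) ≤ ε / 4 := by
        calc iU z * (g y - g z) ≤ iU z * (ε / 4) := mul_le_mul_of_nonneg_left h1 (hiU0 z)
          _ ≤ ε / 4 := mul_le_of_le_one_left (by positivity) (hiU1 z)
      linarith
  have step2 : ∀ y ∈ hypercube d, g y * ∫ z in hypercube d, iU z * ‖fourierKernel d n y z‖ ^ 2
      ≤ (∫ z in hypercube d, iU z * g z * ‖fourierKernel d n y z‖ ^ 2)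
        + (∫ z in hypercube d, ε / 4 * ‖fourierKernel d n y z‖ ^ 2)
        + ∫ z in hypercube d, M * (1 - sameCell d k y z) * ‖fourierKernel d n y z‖ ^ 2 := by
    intro y hy
    have i1 := hint m1 b1 y
    have i2 := hint m2 b2 y
    have i3 := hint m3 b3 y
    have i12 : IntegrableOn (fun z => iU z * g z * ‖fourierKernel d n y z‖ ^ 2
        + ε / 4 * ‖fourierKernel d n y z‖ ^ 2) (hypercube d) := i1.add i2
    rw [← integral_add i1 i2, ← integral_add i12 i3, ← integral_const_mul]
    refine setIntegral_mono_on ((hint m0 b0 y).const_mul _) (i12.add i3)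
      (measurableSet_hypercube d) fun z hz => ?_
    have := mul_le_mul_of_nonneg_right (hpt y hy z hz)
      (by positivity : 0 ≤ ‖fourierKernel d n y z‖ ^ 2)
    linarith
  have step3 : ∫ y in hypercube d, g y * ∫ z in hypercube d, iU z * ‖fourierKernel d n y z‖ ^ 2
      ≤ (∫ y in hypercube d, ∫ z in hypercube d, iU z * g z * ‖fourierKernel d n y z‖ ^ 2)
        + (∫ y in hypercube d, ∫ z in hypercube d, ε / 4 * ‖fourierKernel d n y z‖ ^ 2)
        + ∫ y in hypercube d, ∫ z in hypercube d,
          M * (1 - sameCell d k y z) * ‖fourierKernel d n y z‖ ^ 2 := by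
    have i12 : IntegrableOn (fun y =>
        (∫ z in hypercube d, iU z * g z * ‖fourierKernel d n y z‖ ^ 2)
        + ∫ z in hypercube d, ε / 4 * ‖fourierKernel d n y z‖ ^ 2) (hypercube d) :=
      (hint2 m1 b1).add (hint2 m2 b2)
    rw [← integral_add (hint2 m1 b1) (hint2 m2 b2), ← integral_add i12 (hint2 m3 b3)]
    exact setIntegral_mono_on hgκ (i12.add (hint2 m3 b3))
      (measurableSet_hypercube d) step2
  have T1 : ∫ y in hypercube d, ∫ z in hypercube d, iU z * g z * ‖fourierKernel d n y z‖ ^ 2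
      ≤ ε / 4 * (n : ℝ) ^ d := by
    have hm : Measurable (Function.uncurry fun y z : Fin d → ℝ =>
        iU z * g z * ‖fourierKernel d n y z‖ ^ 2) := m1.mul hKm
    -- Integrating out `y` first leaves `n^d` times the mass of `g` on the zero set of `f`, where `g
    -- = |f - g|`.
    rw [integral_integral_swap (f := fun y z => iU z * g z * ‖fourierKernel d n y z‖ ^ 2)
      (integrable_of_measurable_bounded hm fun p => hbound b1 p.1 p.2)]
    simp only [integral_const_mul, integral_norm_sq_fourierKernel']
    rw [integral_mul_const]
    refine mul_le_mul_of_nonneg_right (le_trans ?_ hgε) hN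
    refine setIntegral_mono_on (integrable_hypercube_of_bounded (hiUm.mul hgc.measurable) (b1 0))
      (hf.integrableOn.sub hgi).abs (measurableSet_hypercube d) fun z _ => ?_
    by_cases hz : z ∈ U
    · have hz' : f z = 0 := hz
      simp only [hiU, Set.indicator_of_mem hz, hz', one_mul, zero_sub, abs_neg]
      exact le_abs_self _
    · simp only [hiU, Set.indicator_of_notMem hz, zero_mul]
      exact abs_nonneg _
  have T2 : ∫ y in hypercube d, ∫ z in hypercube d, ε / 4 * ‖fourierKernel d n y z‖ ^ 2
      = ε / 4 * (n : ℝ) ^ d := by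
    simp only [integral_const_mul, integral_norm_sq_fourierKernel]
    simp
  have T3 : ∫ y in hypercube d, ∫ z in hypercube d,
      M * (1 - sameCell d k y z) * ‖fourierKernel d n y z‖ ^ 2 ≤ ε / 4 * (n : ℝ) ^ d := by
    simp only [mul_assoc, integral_const_mul]
    calc _ ≤ M * (ε / 4 / (M + 1) * (n : ℝ) ^ d) := mul_le_mul_of_nonneg_left hoff hM0
      _ = M / (M + 1) * (ε / 4 * (n : ℝ) ^ d) := by ring
      _ ≤ _ := mul_le_of_le_one_left (by positivity) ((div_le_one (by positivity)).2 (by linarith))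
  linarith

end Approximation

/-! ### Splitting the transform into contributions of cells. -/

section Blocks

open scoped ComplexOrder

variable {d n m k : ℕ} {f g : (Fin d → ℝ) → ℝ}

/-- The pinching is applied to the Gram matrix, where the cells partition the indices.
`resolventTrace_eq_gram` carries the result back to the frequency side. -/
theorem abs_resolventTrace_sub_cells_le {τ : ℝ} (hτ : 0 ≤ τ) (hk : 0 < k)
    {x : Fin m → Fin d → ℝ} (hx : ∀ q, x q ∈ hypercube d) :
    |resolventTrace d n (fun _ => 1) τ x
      - ((n : ℝ) ^ d - ∑ i, ((n : ℝ) ^ d - resolventTrace d n (cellInd d k i) τ x))|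
      ≤ τ ^ 2 * ∑ q, ∑ r, (1 - sameCell d k (x q) (x r)) * ‖fourierKernel d n (x q) (x r)‖ ^ 2 := by
  have hT : ((τ : ℂ) • gramMatrix d n x).PosSemidef := smul_gramMatrix_posSemidef hτ x
  have h := abs_trace_resolvent_sub_blocks_le hT (fun (i : Fin d → Fin k) q => cellInd d k i (x q))
    (fun i j q => cellInd_mul_cellInd i j (x q)) fun q => sum_cellInd hk (hx q)
  have h1 := resolventTrace_eq_gram (n := n) (w := fun _ => 1) hτ x
  have h2 := fun i : Fin d → Fin k => resolventTrace_eq_gram (n := n) (w := cellInd d k i) hτ x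
  simp only [Complex.ofReal_one, Matrix.diagonal_one, one_mul, mul_one] at h1
  simp only [h2]
  simp only [Matrix.mul_smul, Matrix.smul_mul, Fintype.card_fin] at h
  have e1 : ((1 + (τ : ℂ) • gramMatrix d n x)⁻¹).trace.re
      = m - ((n : ℝ) ^ d - resolventTrace d n (fun _ => 1) τ x) := by linarith
  rw [e1] at h
  refine le_trans (le_of_eq ?_) (h.trans (le_of_eq ?_))
  · congr 1; ring
  · rw [Finset.mul_sum]
    refine Finset.sum_congr rfl fun q _ => ?_
    rw [Finset.mul_sum]
    refine Finset.sum_congr rfl fun r _ => ?_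
    rw [← sameCell, one_sub_sameCell_sq, Matrix.smul_apply, norm_smul, Complex.norm_real,
      Real.norm_eq_abs, mul_pow, sq_abs, gramMatrix, Matrix.of_apply]
    ring

/-- The expected number of degrees of freedom captured by the points of one cell. -/
noncomputable def cellTrace (d n m : ℕ) (f : (Fin d → ℝ) → ℝ) (s : ℝ) (k : ℕ)
    (i : Fin d → Fin k) : ℝ :=
  ∫ x, ((n : ℝ) ^ d - resolventTrace d n (cellInd d k i) (s / m) x) ∂(pointsLaw d m f)

theorem integral_pointLaw_le_of_bounded (hg : IsDensity d g) {M : ℝ} (hM : ∀ z, g z ≤ M)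
    {h : (Fin d → ℝ) → ℝ} (hm : Measurable h) (h0 : ∀ x, 0 ≤ h x) {C : ℝ} (hC : ∀ x, h x ≤ C) :
    ∫ x, h x ∂(pointLaw d g) ≤ M * ∫ x in hypercube d, h x := by
  have hb : ∀ x, |h x| ≤ C := fun x => by rw [abs_of_nonneg (h0 x)]; exact hC x
  rw [hg.integral_pointLaw, ← integral_const_mul]
  exact integral_mono (hg.integrableOn_mul hm hb)
    ((integrable_hypercube_of_bounded hm hb).const_mul _)
    fun x => mul_le_mul_of_nonneg_right (hM x) (h0 x)

/-- Needs a bounded density: the off-cell kernel mass is known only for Lebesgue measure, and is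
compared with the law of two points at the cost of `M²`. -/
theorem integral_pointLaw_pair_le (hg : IsDensity d g) {M : ℝ} (hM0 : 0 ≤ M) (hM : ∀ z, g z ≤ M)
    {h : (Fin d → ℝ) → (Fin d → ℝ) → ℝ} (hmeas : Measurable (Function.uncurry h))
    (hmx : ∀ x, Measurable (h x)) (h0 : ∀ x y, 0 ≤ h x y) {C : ℝ} (hb : ∀ x y, h x y ≤ C) :
    ∫ x, ∫ y, h x y ∂(pointLaw d g) ∂(pointLaw d g)
      ≤ M ^ 2 * ∫ x in hypercube d, ∫ y in hypercube d, h x y := by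
  have := hg.isProbabilityMeasure
  have hin : ∀ x, ∫ y, h x y ∂(pointLaw d g) ≤ M * ∫ y in hypercube d, h x y := fun x =>
    integral_pointLaw_le_of_bounded hg hM (hmx x) (h0 x) (hb x)
  have hIm : Measurable fun x => ∫ y in hypercube d, h x y :=
    (StronglyMeasurable.integral_prod_right' (ν := volume.restrict (hypercube d))
      (f := Function.uncurry h) hmeas.stronglyMeasurable).measurable
  have hI0 : ∀ x, 0 ≤ ∫ y in hypercube d, h x y := fun x => integral_nonneg (h0 x)
  have hI1 : ∀ x, ∫ y in hypercube d, h x y ≤ C := fun x => by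
    have h1 : ∀ y, ‖h x y‖ ≤ C := fun y => by
      rw [Real.norm_eq_abs, abs_of_nonneg (h0 x y)]; exact hb x y
    have := norm_integral_le_of_norm_le_const (μ := volume.restrict (hypercube d))
      (Eventually.of_forall h1)
    rw [probReal_univ, mul_one] at this
    exact (le_abs_self _).trans this
  have hI2 : Integrable (fun x => M * ∫ y in hypercube d, h x y) (pointLaw d g) :=
    (integrable_of_measurable_bounded hIm (C := C) fun x => by
      rw [abs_of_nonneg (hI0 x)]; exact hI1 x).const_mul _
  have e1 : ∫ x, ∫ y, h x y ∂(pointLaw d g) ∂(pointLaw d g)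
      ≤ ∫ x, (M * ∫ y in hypercube d, h x y) ∂(pointLaw d g) :=
    integral_mono_of_nonneg (Eventually.of_forall fun x => integral_nonneg (h0 x)) hI2
      (Eventually.of_forall hin)
  have e2 : ∫ x, (∫ y in hypercube d, h x y) ∂(pointLaw d g)
      ≤ M * ∫ x in hypercube d, ∫ y in hypercube d, h x y :=
    integral_pointLaw_le_of_bounded hg hM hIm hI0 hI1
  rw [integral_const_mul] at e1
  refine e1.trans ((mul_le_mul_of_nonneg_left e2 hM0).trans (le_of_eq ?_))
  ring

/-- For a bounded density, the finite transform is the sum of the contributions of the cells, up to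
the off-cell mass of the squared kernel. -/
theorem abs_etaFinite_sub_cells_le (hg : IsDensity d g) {M : ℝ} (hM0 : 0 ≤ M) (hM : ∀ z, g z ≤ M)
    (hn : 0 < n) (hm : 0 < m) (hk : 0 < k) {s : ℝ} (hs : 0 ≤ s) {ε : ℝ}
    (hoff : ∫ x in hypercube d, ∫ y in hypercube d,
        (1 - sameCell d k x y) * ‖fourierKernel d n x y‖ ^ 2 ≤ ε * (n : ℝ) ^ d) :
    |etaFinite d n m g s - (1 - (∑ i, cellTrace d n m g s k i) / (n : ℝ) ^ d)|
      ≤ s ^ 2 * M ^ 2 * ε := by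
  have := hg.isProbabilityMeasure
  have := hg.isProbabilityMeasure_points m
  have hN : (0 : ℝ) < (n : ℝ) ^ d := by positivity
  have hm' : (0 : ℝ) < m := by exact_mod_cast hm
  have hτ : 0 ≤ s / m := by positivity
  obtain ⟨h, hh⟩ : ∃ h : (Fin d → ℝ) → (Fin d → ℝ) → ℝ, ∀ x y,
      h x y = (1 - sameCell d k x y) * ‖fourierKernel d n x y‖ ^ 2 := ⟨_, fun _ _ => rfl⟩
  simp only [← hh] at hoff
  have hmeas : Measurable (Function.uncurry h) := by
    have e : Function.uncurry h = fun p : (Fin d → ℝ) × (Fin d → ℝ) =>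
        (1 - sameCell d k p.1 p.2) * ‖fourierKernel d n p.1 p.2‖ ^ 2 := funext fun p => hh _ _
    rw [e]
    exact (measurable_const.sub measurable_sameCell).mul measurable_norm_sq_fourierKernel
  have hmx : ∀ x, Measurable (h x) := fun x => by
    have e : h x = fun y => (1 - sameCell d k x y) * ‖fourierKernel d n x y‖ ^ 2 := funext (hh x)
    rw [e]
    exact (measurable_const.sub (measurable_sameCell_right x)).mul
      (measurable_norm_sq_fourierKernel_right x)
  have h0 : ∀ x y, 0 ≤ h x y := fun x y => by
    rw [hh]
    exact mul_nonneg (sub_nonneg.2 (sameCell_le_one _ _)) (by positivity)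
  have hb : ∀ x y, h x y ≤ ((n : ℝ) ^ d) ^ 2 := fun x y => by
    rw [hh]
    exact (mul_le_of_le_one_left (by positivity) (by linarith [sameCell_nonneg (k := k) x y])).trans
      (norm_sq_fourierKernel_le _ _)
  have hab : ∀ x y, |h x y| ≤ ((n : ℝ) ^ d) ^ 2 := fun x y => by
    rw [abs_of_nonneg (h0 x y)]; exact hb x y
  have hpair : ∫ x, ∫ y, h x y ∂(pointLaw d g) ∂(pointLaw d g) ≤ M ^ 2 * (ε * (n : ℝ) ^ d) :=
    (integral_pointLaw_pair_le hg hM0 hM hmeas hmx h0 hb).trans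
      (mul_le_mul_of_nonneg_left hoff (sq_nonneg M))
  have hi2 : ∀ q r : Fin m, Integrable (fun x : Fin m → Fin d → ℝ => h (x q) (x r))
      (pointsLaw d m g) := by
    intro q r
    have hp : Measurable fun x : Fin m → Fin d → ℝ => (x q, x r) :=
      (measurable_pi_apply q).prodMk (measurable_pi_apply r)
    exact integrable_of_measurable_bounded (hmeas.comp hp) fun x => hab _ _
  have hε0 : 0 ≤ M ^ 2 * (ε * (n : ℝ) ^ d) :=
    (integral_nonneg fun x => integral_nonneg (h0 x)).trans hpair
  have E2 : ∀ q r : Fin m, ∫ x, h (x q) (x r) ∂(pointsLaw d m g) ≤ M ^ 2 * (ε * (n : ℝ) ^ d) := by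
    intro q r
    by_cases hqr : q = r
    · subst hqr
      -- Almost surely a point lies in the cube and hence shares a cell with itself, so repeated
      -- indices contribute nothing.
      have : ∫ x, h (x q) (x q) ∂(pointsLaw d m g) = 0 := by
        refine integral_eq_zero_of_ae ?_
        filter_upwards [hg.ae_mem_points m] with x hx
        have h1 : sameCell d k (x q) (x q) = 1 := by
          have : ∀ i, cellInd d k i (x q) * cellInd d k i (x q) = cellInd d k i (x q) := fun i => by
            rw [cellInd_mul_cellInd, if_pos rfl]
          rw [sameCell]
          simp only [this]
          exact sum_cellInd hk (hx q)
        simp [hh, h1]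
      rw [this]; exact hε0
    · rw [pointsLaw, integral_pi_eval_two _ hqr hmeas hab]
      exact hpair
  have hiR : ∀ w : (Fin d → ℝ) → ℝ, Measurable w → Integrable
      (fun x : Fin m → Fin d → ℝ => resolventTrace d n w (s / m) x) (pointsLaw d m g) := fun w hw =>
    integrable_of_measurable_bounded (measurable_resolventTrace hw)
      fun x => abs_resolventTrace_le hτ x
  have hi3 : ∀ i : Fin d → Fin k, Integrable (fun x : Fin m → Fin d → ℝ =>
      (n : ℝ) ^ d - resolventTrace d n (cellInd d k i) (s / m) x) (pointsLaw d m g) := fun i =>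
    (integrable_const _).sub (hiR _ (measurable_cellInd i))
  have hiC : Integrable (fun x : Fin m → Fin d → ℝ =>
      (n : ℝ) ^ d - ∑ i : Fin d → Fin k, ((n : ℝ) ^ d - resolventTrace d n (cellInd d k i) (s / m) x))
      (pointsLaw d m g) :=
    (integrable_const _).sub (integrable_finsetSum _ fun i _ => hi3 i)
  have key : |∫ x, resolventTrace d n (fun _ => 1) (s / m) x ∂(pointsLaw d m g)
      - ((n : ℝ) ^ d - ∑ i, cellTrace d n m g s k i)| ≤ s ^ 2 * M ^ 2 * ε * (n : ℝ) ^ d := by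
    have e : (n : ℝ) ^ d - ∑ i, cellTrace d n m g s k i
        = ∫ x, ((n : ℝ) ^ d - ∑ i : Fin d → Fin k,
          ((n : ℝ) ^ d - resolventTrace d n (cellInd d k i) (s / m) x)) ∂(pointsLaw d m g) := by
      rw [integral_sub (integrable_const _) (integrable_finsetSum _ fun i _ => hi3 i),
        integral_const, probReal_univ, one_smul, integral_finsetSum _ fun i _ => hi3 i]
      rfl
    rw [e, ← integral_sub (hiR _ measurable_const) hiC]
    refine abs_integral_le_integral_abs.trans ?_
    have hle : ∫ x, |resolventTrace d n (fun _ => 1) (s / m) x - ((n : ℝ) ^ d -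
        ∑ i : Fin d → Fin k, ((n : ℝ) ^ d - resolventTrace d n (cellInd d k i) (s / m) x))|
        ∂(pointsLaw d m g)
        ≤ ∫ x, (s / m) ^ 2 * ∑ q, ∑ r, h (x q) (x r) ∂(pointsLaw d m g) := by
      refine integral_mono_ae ((hiR _ measurable_const).sub hiC).abs
        ((integrable_finsetSum _ fun q _ => integrable_finsetSum _ fun r _ => hi2 q r).const_mul _) ?_
      filter_upwards [hg.ae_mem_points m] with x hx
      simp only [hh]
      exact abs_resolventTrace_sub_cells_le hτ hk hx
    refine hle.trans ?_
    rw [integral_const_mul,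
      integral_finsetSum _ fun q _ => integrable_finsetSum _ fun r _ => hi2 q r]
    have hsum : ∑ q : Fin m, ∫ x, ∑ r, h (x q) (x r) ∂(pointsLaw d m g)
        ≤ (m : ℝ) ^ 2 * (M ^ 2 * (ε * (n : ℝ) ^ d)) := by
      calc _ ≤ ∑ q : Fin m, ∑ r : Fin m, M ^ 2 * (ε * (n : ℝ) ^ d) := by
            refine Finset.sum_le_sum fun q _ => ?_
            rw [integral_finsetSum _ fun r _ => hi2 q r]
            exact Finset.sum_le_sum fun r _ => E2 q r
        _ = _ := by
            rw [Finset.sum_const, Finset.sum_const, Finset.card_univ, Fintype.card_fin,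
              nsmul_eq_mul, nsmul_eq_mul]
            ring
    refine (mul_le_mul_of_nonneg_left hsum (by positivity)).trans (le_of_eq ?_)
    field_simp
  have e1 : etaFinite d n m g s - (1 - (∑ i, cellTrace d n m g s k i) / (n : ℝ) ^ d)
      = (∫ x, resolventTrace d n (fun _ => 1) (s / m) x ∂(pointsLaw d m g)
      - ((n : ℝ) ^ d - ∑ i, cellTrace d n m g s k i)) / (n : ℝ) ^ d := by
    rw [etaFinite_eq, integral_div]
    field_simp
  rw [e1, abs_div, abs_of_pos hN, div_le_iff₀ hN]
  exact key

end Blocks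

/-! ### Expansion by the number of points in a set, and change of variables. -/

section Expansion

theorem Fin.cons_insertNth_succ {E : Type*} {m : ℕ} (q : Fin (m + 1)) (a y : E) (x : Fin m → E) :
    (Fin.cons y (q.insertNth a x : Fin (m + 1) → E) : Fin (m + 2) → E)
      = q.succ.insertNth a (Fin.cons y x : Fin (m + 1) → E) := by
  rw [Fin.eq_insertNth_iff]
  refine ⟨by simp, ?_⟩
  ext j
  refine Fin.cases ?_ (fun j => ?_) j
  · simp [Fin.removeNth]
  · simp [Fin.removeNth]

variable {E : Type*} [MeasurableSpace E]

/-- Expansion of an expectation over `m` i.i.d. points according to the number of points in a set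
`C`, for a family of functions that ignores the points outside of `C`. -/
theorem integral_pi_expansion (μ : Measure E) [IsProbabilityMeasure μ] {C : Set E}
    (hC : MeasurableSet C) (m : ℕ) {Φ : ∀ j, (Fin j → E) → ℝ} (hΦ : ∀ j, Measurable (Φ j))
    {K : ℝ} (hK : ∀ j x, |Φ j x| ≤ K)
    (hrem : ∀ j (q : Fin (j + 1)) (y : E) (x : Fin j → E), y ∉ C →
      Φ (j + 1) (q.insertNth y x) = Φ j x) :
    ∫ x, Φ m x ∂(Measure.pi fun _ => μ)
      = ∑ j ∈ Finset.range (m + 1), (m.choose j : ℝ) * μ.real Cᶜ ^ (m - j) *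
        ∫ x, Φ j x ∂(Measure.pi fun _ => μ.restrict C) := by
  induction m generalizing Φ with
  | zero => simp [integral_pi_zero]
  | succ m ih =>
    have hcm : ∀ j, Measurable fun p : E × (Fin j → E) => Φ (j + 1) (Fin.cons p.1 p.2) :=
      fun j => (hΦ (j + 1)).comp (measurable_fin_cons j)
    have hmy : ∀ (y : E) j, Measurable fun x : Fin j → E => Φ (j + 1) (Fin.cons y x) :=
      fun y j => (hcm j).comp (measurable_const.prodMk measurable_id)
    rw [integral_pi_succ μ (hΦ (m + 1)) (hK (m + 1))]
    have hint : ∀ j (ρ ρ' : Measure E) [IsFiniteMeasure ρ] [IsFiniteMeasure ρ'], Integrable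
        (fun y => ∫ x, Φ (j + 1) (Fin.cons y x) ∂(Measure.pi fun _ : Fin j => ρ)) ρ' := by
      intro j ρ ρ' _ _
      refine integrable_of_measurable_bounded
        (C := K * (Measure.pi fun _ : Fin j => ρ).real Set.univ)
        (StronglyMeasurable.integral_prod_right'
          (f := fun p : E × (Fin j → E) => Φ (j + 1) (Fin.cons p.1 p.2))
          (hcm j).stronglyMeasurable).measurable fun y => ?_
      rw [← Real.norm_eq_abs]
      exact norm_integral_le_of_norm_le_const (Eventually.of_forall fun x => hK _ _)
    -- Condition on the first point. Inside `C` it is kept and the induction runs on the functions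
    -- with that point prepended; outside `C` it is dropped.
    rw [← integral_add_compl hC (hint m μ μ)]
    have h1 : ∫ y in C, ∫ x, Φ (m + 1) (Fin.cons y x) ∂(Measure.pi fun _ => μ) ∂μ
        = ∑ j ∈ Finset.range (m + 1), (m.choose j : ℝ) * μ.real Cᶜ ^ (m - j) *
          ∫ x, Φ (j + 1) x ∂(Measure.pi fun _ => μ.restrict C) := by
      have : ∀ y, ∫ x, Φ (m + 1) (Fin.cons y x) ∂(Measure.pi fun _ => μ)
          = ∑ j ∈ Finset.range (m + 1), (m.choose j : ℝ) * μ.real Cᶜ ^ (m - j) *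
            ∫ x, Φ (j + 1) (Fin.cons y x) ∂(Measure.pi fun _ => μ.restrict C) := by
        intro y
        refine ih (Φ := fun j x => Φ (j + 1) (Fin.cons y x)) (fun j => hmy y j)
          (fun j x => hK _ _) fun j q a x ha => ?_
        rw [Fin.cons_insertNth_succ]
        exact hrem _ _ _ _ ha
      simp only [this]
      rw [integral_finsetSum]
      · refine Finset.sum_congr rfl fun j _ => ?_
        rw [integral_const_mul, integral_pi_succ (μ.restrict C) (hΦ (j + 1)) (hK (j + 1))]
      · exact fun j _ => (hint j _ _).const_mul _
    have h2 : ∫ y in Cᶜ, ∫ x, Φ (m + 1) (Fin.cons y x) ∂(Measure.pi fun _ => μ) ∂μ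
        = ∑ j ∈ Finset.range (m + 1), (m.choose j : ℝ) * μ.real Cᶜ ^ (m + 1 - j) *
          ∫ x, Φ j x ∂(Measure.pi fun _ => μ.restrict C) := by
      have : ∀ y ∈ Cᶜ, ∫ x, Φ (m + 1) (Fin.cons y x) ∂(Measure.pi fun _ => μ)
          = ∫ x, Φ m x ∂(Measure.pi fun _ => μ) := by
        intro y hy
        congr 1
        ext x
        have := hrem m 0 y x hy
        rwa [Fin.insertNth_zero'] at this
      rw [setIntegral_congr_fun hC.compl this, setIntegral_const, ih hΦ hK hrem, smul_eq_mul,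
        Finset.mul_sum]
      refine Finset.sum_congr rfl fun j hj => ?_
      have hj' : m + 1 - j = (m - j) + 1 := by
        have := Finset.mem_range.1 hj
        omega
      rw [hj', pow_succ]
      ring
    rw [h1, h2, Finset.sum_range_succ' _ (m + 1)]
    have h3 : ∑ j ∈ Finset.range (m + 1), (m.choose j : ℝ) * μ.real Cᶜ ^ (m + 1 - j) *
          ∫ x, Φ j x ∂(Measure.pi fun _ => μ.restrict C)
        = ∑ j ∈ Finset.range (m + 1), (m.choose (j + 1) : ℝ) * μ.real Cᶜ ^ (m - j) *
          ∫ x, Φ (j + 1) x ∂(Measure.pi fun _ => μ.restrict C)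
          + μ.real Cᶜ ^ (m + 1) * ∫ x, Φ 0 x ∂(Measure.pi fun _ => μ.restrict C) := by
      rw [Finset.sum_range_succ' _ m, Finset.sum_range_succ _ m, Nat.choose_succ_self]
      simp
    -- Pascal's rule recombines the two cases.
    rw [h3, ← add_assoc, ← Finset.sum_add_distrib]
    congr 1
    · refine Finset.sum_congr rfl fun j _ => ?_
      rw [Nat.choose_succ_succ, Nat.add_sub_add_right]
      push_cast
      ring
    · simp

/-- Product form of an integral identity with a density and a change of variables. -/
theorem integral_pi_of_integral {E' : Type*} [MeasurableSpace E'] (ν : Measure E)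
    [IsFiniteMeasure ν] (lam : Measure E') [IsFiniteMeasure lam] {A : E' → E} (hA : Measurable A)
    {h : E' → ℝ} (hh : Measurable h) {B : ℝ} (hB : ∀ y, |h y| ≤ B)
    (H : ∀ F : E → ℝ, Measurable F → (∃ K, ∀ x, |F x| ≤ K) →
      ∫ x, F x ∂ν = ∫ y, h y * F (A y) ∂lam)
    (j : ℕ) {Ψ : (Fin j → E) → ℝ} (hΨ : Measurable Ψ) {K : ℝ} (hK : ∀ x, |Ψ x| ≤ K) :
    ∫ x, Ψ x ∂(Measure.pi fun _ => ν)
      = ∫ y, (∏ i, h (y i)) * Ψ (fun i => A (y i)) ∂(Measure.pi fun _ => lam) := by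
  induction j with
  | zero =>
    rw [integral_pi_zero, integral_pi_zero]
    simp only [Finset.univ_eq_empty, Finset.prod_empty, one_mul]
    congr 1
    ext i
    exact i.elim0
  | succ j ih =>
    have hprod : ∀ y : Fin (j + 1) → E', |∏ i, h (y i)| ≤ B ^ (j + 1) := by
      intro y
      rw [Finset.abs_prod]
      refine (Finset.prod_le_prod (fun _ _ => abs_nonneg _) fun i _ => hB (y i)).trans ?_
      simp
    have hAm : Measurable fun y : Fin (j + 1) → E' => fun i => A (y i) :=
      measurable_pi_iff.2 fun i => hA.comp (measurable_pi_apply i)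
    have hm : Measurable fun y : Fin (j + 1) → E' => (∏ i, h (y i)) * Ψ (fun i => A (y i)) :=
      (Finset.measurable_fun_prod _ fun i _ => hh.comp (measurable_pi_apply i)).mul (hΨ.comp hAm)
    rw [integral_pi_succ ν hΨ hK, integral_pi_succ lam hm (C := B ^ (j + 1) * K) fun y => by
      rw [abs_mul]
      exact mul_le_mul (hprod y) (hK _) (abs_nonneg _) ((abs_nonneg _).trans (hprod y))]
    have hmc : ∀ y : E, Measurable fun x : Fin j → E => Ψ (Fin.cons y x) := fun y =>
      hΨ.comp ((measurable_fin_cons j).comp (measurable_const.prodMk measurable_id))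
    rw [H _ (StronglyMeasurable.integral_prod_right'
        (f := fun p : E × (Fin j → E) => Ψ (Fin.cons p.1 p.2))
        (hΨ.comp (measurable_fin_cons j)).stronglyMeasurable).measurable
      ⟨K * (Measure.pi fun _ : Fin j => ν).real Set.univ, fun y => by
        rw [← Real.norm_eq_abs]
        exact norm_integral_le_of_norm_le_const (Eventually.of_forall fun x => hK _)⟩]
    congr 1
    ext y
    rw [ih (hmc (A y)) fun x => hK _, ← integral_const_mul]
    congr 1
    ext x
    rw [Fin.prod_univ_succ]
    simp only [Fin.cons_zero, Fin.cons_succ]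
    have : (fun i => A ((Fin.cons y x : Fin (j + 1) → E') i))
        = Fin.cons (A y) fun i => A (x i) := by
      ext i
      refine Fin.cases ?_ (fun i => ?_) i <;> simp
    rw [this]
    ring

end Expansion

/-! ### Scalar limits: the rescaled Dirichlet kernel and Poisson weights. -/

section ScalarLimits

variable {α : Type*} {l : Filter α}

theorem tendsto_natCast_mul_exp_div_sub_one {k : α → ℕ} (hk : Tendsto k l atTop) {c : ℂ}
    (hc : c ≠ 0) : Tendsto (fun a => (k a : ℂ) * (Complex.exp (c / k a) - 1)) l (𝓝 c) := by
  have h0 : Tendsto (fun a => c / (k a : ℂ)) l (𝓝[≠] 0) := by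
    refine tendsto_nhdsWithin_iff.2 ⟨?_, ?_⟩
    · have := (tendsto_inv_atTop_nhds_zero_nat (𝕜 := ℂ)).comp hk
      have := this.const_mul c
      rw [mul_zero] at this
      exact this.congr fun a => by simp [div_eq_mul_inv]
    · filter_upwards [hk.eventually_gt_atTop 0] with a ha
      have : (k a : ℂ) ≠ 0 := by exact_mod_cast ha.ne'
      exact div_ne_zero hc this
  have h1 := (((Complex.hasDerivAt_exp 0).tendsto_slope_zero).comp h0).const_mul c
  rw [Complex.exp_zero, mul_one] at h1
  refine h1.congr' ?_
  filter_upwards [hk.eventually_gt_atTop 0] with a ha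
  have : (k a : ℂ) ≠ 0 := by exact_mod_cast ha.ne'
  simp only [Function.comp, zero_add, smul_eq_mul]
  field_simp

/-- The limit of the normalized Dirichlet sums. -/
noncomputable def dirichletLimit (R u : ℝ) : ℂ :=
  if u = 0 then 1 else
    (Complex.exp (-2 * Real.pi * Complex.I * u * R) - 1) / (R * (-2 * Real.pi * Complex.I * u))

/-- With `c = -2πiu` the ratio is `(e^{c n/k} - 1) / ((n/k) · k (e^{c/k} - 1))`, and the denominator
tends to `R c`. The value `u = 0` is separate because the geometric sum formula fails there. -/
theorem tendsto_dirichletSum_div {n k : α → ℕ} (hk : Tendsto k l atTop) {R : ℝ} (hR : 0 < R)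
    (h : Tendsto (fun a => (n a : ℝ) / k a) l (𝓝 R)) (u : ℝ) :
    Tendsto (fun a => dirichletSum (n a) ((k a : ℝ)⁻¹ * u) / n a) l (𝓝 (dirichletLimit R u)) := by
  have hn : ∀ᶠ a in l, (n a : ℂ) ≠ 0 := by
    filter_upwards [h.eventually_const_lt hR] with a ha hn
    have : (n a : ℝ) = 0 := by exact_mod_cast hn
    rw [this] at ha
    simp at ha
  by_cases hu : u = 0
  · subst hu
    rw [dirichletLimit, if_pos rfl]
    refine tendsto_const_nhds.congr' ?_
    filter_upwards [hn] with a ha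
    simp [dirichletSum, ha]
  rw [dirichletLimit, if_neg hu]
  set c : ℂ := -2 * Real.pi * Complex.I * u with hc
  have hc0 : c ≠ 0 := by
    have : (Real.pi : ℂ) ≠ 0 := by exact_mod_cast Real.pi_ne_zero
    have : (u : ℂ) ≠ 0 := by exact_mod_cast hu
    simp [*]
  have h' : Tendsto (fun a => ((n a : ℂ) / k a)) l (𝓝 (R : ℂ)) := by
    have := (Complex.continuous_ofReal.tendsto R).comp h
    exact this.congr fun a => by simp
  have hk1 := tendsto_natCast_mul_exp_div_sub_one hk hc0
  have hR' : (R : ℂ) ≠ 0 := by exact_mod_cast hR.ne'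
  have hlim := (((Complex.continuous_exp.tendsto _).comp (h'.const_mul c)).sub_const 1).div
    (h'.mul hk1) (mul_ne_zero hR' hc0)
  refine hlim.congr' ?_
  filter_upwards [hn, hk.eventually_gt_atTop 0, hk1.eventually_ne hc0] with a hna hka hne
  have hka' : (k a : ℂ) ≠ 0 := by exact_mod_cast hka.ne'
  have hw : Complex.exp (c / k a) ≠ 1 := fun h1 => hne (by rw [h1]; simp)
  have hs : dirichletSum (n a) ((k a : ℝ)⁻¹ * u)
      = ∑ i ∈ Finset.range (n a), Complex.exp (c / k a) ^ i := by
    rw [dirichletSum, Finset.sum_range]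
    refine Finset.sum_congr rfl fun i _ => ?_
    rw [← Complex.exp_nat_mul, hc]
    congr 1
    push_cast
    field_simp
  rw [hs, geom_sum_eq hw, ← Complex.exp_nat_mul]
  simp only [Function.comp, Pi.div_apply]
  have hw' : Complex.exp (c / k a) - 1 ≠ 0 := sub_ne_zero.2 hw
  rw [show (n a : ℂ) * (c / k a) = c * (n a / k a) by ring]
  field_simp

/-- The empty-complement factor of the binomial law. Convergence of `m p` with `m → ∞` forces `p →
0`, so removing `j` from the exponent has no effect. The logarithm is squeezed between `1 - 1/y` and
`y - 1` at `y = 1 - p`. -/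
theorem tendsto_one_sub_pow {m : α → ℕ} (hm : Tendsto m l atTop) {p : α → ℝ}
    {μ : ℝ} (hp : Tendsto (fun a => m a * p a) l (𝓝 μ)) (j : ℕ) :
    Tendsto (fun a => (1 - p a) ^ (m a - j)) l (𝓝 (Real.exp (-μ))) := by
  have hm' : Tendsto (fun a => (m a : ℝ)) l atTop := tendsto_natCast_atTop_atTop.comp hm
  have hpz : Tendsto p l (𝓝 0) := by
    have := hp.mul hm'.inv_tendsto_atTop
    rw [mul_zero] at this
    refine this.congr' ?_
    filter_upwards [hm.eventually_gt_atTop 0] with a ha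
    have : (m a : ℝ) ≠ 0 := by exact_mod_cast ha.ne'
    simp only [Pi.inv_apply]
    field_simp
  have hN : Tendsto (fun a => ((m a - j : ℕ) : ℝ) * p a) l (𝓝 μ) := by
    have := hp.sub (hpz.const_mul (j : ℝ))
    rw [mul_zero, sub_zero] at this
    refine this.congr' ?_
    filter_upwards [hm.eventually_ge_atTop j] with a ha
    rw [Nat.cast_sub ha]; ring
  have hlt : ∀ᶠ a in l, p a < 1 := hpz.eventually_lt_const zero_lt_one
  have hlog : Tendsto (fun a => ((m a - j : ℕ) : ℝ) * Real.log (1 - p a)) l (𝓝 (-μ)) := by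
    have hlow : Tendsto (fun a => -(((m a - j : ℕ) : ℝ) * p a * (1 - p a)⁻¹)) l (𝓝 (-μ)) := by
      have h1 : Tendsto (fun a => (1 - p a)⁻¹) l (𝓝 1) := by
        have := (hpz.const_sub 1).inv₀ (by norm_num)
        simpa using this
      have := (hN.mul h1).neg
      simpa using this
    refine tendsto_of_tendsto_of_tendsto_of_le_of_le' hlow hN.neg ?_ ?_
    · filter_upwards [hlt] with a ha
      have h1 : 0 < 1 - p a := by linarith
      have := Real.one_sub_inv_le_log_of_pos h1
      have e : 1 - (1 - p a)⁻¹ = -(p a * (1 - p a)⁻¹) := by field_simp; ring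
      rw [mul_assoc, ← mul_neg, ← e]
      exact mul_le_mul_of_nonneg_left this (Nat.cast_nonneg _)
    · filter_upwards [hlt] with a ha
      have h1 : 0 < 1 - p a := by linarith
      have := Real.log_le_sub_one_of_pos h1
      rw [← mul_neg]
      exact mul_le_mul_of_nonneg_left (by linarith) (Nat.cast_nonneg _)
  refine ((Real.continuous_exp.tendsto _).comp hlog).congr' ?_
  filter_upwards [hlt] with a ha
  have h1 : 0 < 1 - p a := by linarith
  simp only [Function.comp]
  rw [mul_comm, Real.exp_mul, Real.exp_log h1, Real.rpow_natCast]

/-- The known limit for success probability `1/n`, rescaled by `(m q)^j`. This form also covers `Λ =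
0`. -/
theorem tendsto_choose_mul_pow {m : α → ℕ} (hm : Tendsto m l atTop) {q : α → ℝ} {Λ : ℝ}
    (h : Tendsto (fun a => m a * q a) l (𝓝 Λ)) (j : ℕ) :
    Tendsto (fun a => ((m a).choose j : ℝ) * q a ^ j) l (𝓝 (Λ ^ j / j.factorial)) := by
  have h1 : Tendsto (fun n : ℕ => (n : ℝ) * (n : ℝ)⁻¹) atTop (𝓝 1) := by
    refine tendsto_const_nhds.congr' ?_
    filter_upwards [eventually_gt_atTop 0] with n hn
    have : (n : ℝ) ≠ 0 := by exact_mod_cast hn.ne'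
    field_simp
  have h2 := (ProbabilityTheory.tendsto_choose_mul_pow_atTop j h1).comp hm
  have h3 := h2.mul (h.pow j)
  rw [one_pow, one_div_mul_eq_div] at h3
  refine h3.congr' ?_
  filter_upwards [hm.eventually_gt_atTop 0] with a ha
  have : (m a : ℝ) ≠ 0 := by exact_mod_cast ha.ne'
  simp only [Function.comp]
  rw [mul_pow, mul_assoc, ← mul_assoc (_ ^ j), ← mul_pow, inv_mul_cancel₀ this, one_pow, one_mul]

end ScalarLimits

/-! ### Continuity of the resolvent trace along positive semidefinite matrices. -/

section MatrixLimits

open Matrix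

open scoped ComplexOrder

variable {α ι : Type*} {l : Filter α} [Fintype ι]

theorem posSemidef_of_tendsto [l.NeBot] {T : α → Matrix ι ι ℂ} {T' : Matrix ι ι ℂ}
    (hT : ∀ᶠ a in l, (T a).PosSemidef) (h : Tendsto T l (𝓝 T')) : T'.PosSemidef := by
  have := Complex.orderClosedTopology
  refine .of_dotProduct_mulVec_nonneg ?_ fun x => ?_
  · have h1 : Tendsto (fun a => (T a)ᴴ) l (𝓝 T'ᴴ) :=
      ((continuous_id.matrix_conjTranspose).tendsto T').comp h
    refine tendsto_nhds_unique (h1.congr' ?_) h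
    filter_upwards [hT] with a ha
    exact ha.isHermitian
  · have hc : Continuous fun M : Matrix ι ι ℂ => star x ⬝ᵥ (M *ᵥ x) :=
      continuous_const.dotProduct (continuous_id.matrix_mulVec continuous_const)
    refine ge_of_tendsto ((hc.tendsto T').comp h) ?_
    filter_upwards [hT] with a ha
    exact ha.dotProduct_mulVec_nonneg x

/-- Positivity passes to the limit, so `1 + T'` is invertible and its inverse is continuous as
adjugate over determinant. Positivity of the limit kernel never has to be checked directly. -/
theorem tendsto_trace_resolvent [DecidableEq ι] [l.NeBot] {T : α → Matrix ι ι ℂ} {T' : Matrix ι ι ℂ}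
    (hT : ∀ᶠ a in l, (T a).PosSemidef) (h : Tendsto T l (𝓝 T')) :
    Tendsto (fun a => ((1 + T a)⁻¹).trace.re) l (𝓝 ((1 + T')⁻¹).trace.re) := by
  have hdet := (posSemidef_of_tendsto hT h).isUnit_det_one_add.ne_zero
  have h1 : Tendsto (fun a => 1 + T a) l (𝓝 (1 + T')) := h.const_add 1
  have hd : Tendsto (fun a => (1 + T a).det) l (𝓝 (1 + T').det) :=
    ((continuous_id.matrix_det).tendsto (1 + T')).comp h1
  have ha : Tendsto (fun a => (1 + T a).adjugate.trace) l (𝓝 (1 + T').adjugate.trace) :=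
    ((continuous_id.matrix_adjugate.matrix_trace).tendsto (1 + T')).comp h1
  have := (hd.inv₀ hdet).mul ha
  refine (Complex.continuous_re.tendsto _).comp ?_
  simpa only [inv_def, trace_smul, smul_eq_mul, Ring.inverse_eq_inv'] using this

end MatrixLimits

/-! ### The contribution of one cell as a series in its number of points. -/

section CellSeries

open scoped ComplexOrder

variable {d n m k j : ℕ} {g : (Fin d → ℝ) → ℝ}

/-- The center of a cell. -/
noncomputable def cellCenter (d k : ℕ) (i : Fin d → Fin k) : Fin d → ℝ := fun l =>
  -1 / 2 + ((i l : ℕ) + 1 / 2) / (k : ℝ)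

theorem mem_gridCell_iff (hk : 0 < k) (i : Fin d → Fin k) (y : Fin d → ℝ) :
    cellCenter d k i + (k : ℝ)⁻¹ • y ∈ gridCell d k i ↔ y ∈ hypercube d := by
  have hk' : (0 : ℝ) < k := by exact_mod_cast hk
  simp only [gridCell, hypercube, Set.mem_univ_pi, gridInterval, Set.mem_Ico]
  refine forall_congr' fun l => ?_
  simp only [cellCenter, Pi.add_apply, Pi.smul_apply, smul_eq_mul]
  have e : -1 / 2 + ((i l : ℕ) + 1 / 2) / (k : ℝ) + (k : ℝ)⁻¹ * y l
      = -1 / 2 + (i l : ℕ) / (k : ℝ) + (1 / 2 + y l) / k := by field_simp; ring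
  rw [e]
  constructor
  · rintro ⟨h1, h2⟩
    have h3 : 0 ≤ (1 / 2 + y l) / k := by linarith
    have h4 : (1 / 2 + y l) / k < 1 / k := by linarith
    rw [div_lt_div_iff_of_pos_right hk'] at h4
    have h5 : 0 ≤ 1 / 2 + y l := by
      by_contra hneg
      have := div_neg_of_neg_of_pos (not_le.1 hneg) hk'
      linarith
    constructor <;> linarith
  · rintro ⟨h1, h2⟩
    have h3 : 0 ≤ (1 / 2 + y l) / k := div_nonneg (by linarith) hk'.le
    have h4 : (1 / 2 + y l) / k < 1 / k := by
      rw [div_lt_div_iff_of_pos_right hk']; linarith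
    constructor <;> linarith

/-- Rescaling of a cell to the hypercube. -/
theorem setIntegral_gridCell (hk : 0 < k) (i : Fin d → Fin k) (F : (Fin d → ℝ) → ℝ) :
    ∫ x in gridCell d k i, F x
      = ((k : ℝ) ^ d)⁻¹ * ∫ y in hypercube d, F (cellCenter d k i + (k : ℝ)⁻¹ • y) := by
  have hk' : (0 : ℝ) < k := by exact_mod_cast hk
  have h1 : ∀ y, (gridCell d k i).indicator F (cellCenter d k i + (k : ℝ)⁻¹ • y)
      = (hypercube d).indicator (fun y => F (cellCenter d k i + (k : ℝ)⁻¹ • y)) y := by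
    intro y
    by_cases hy : y ∈ hypercube d
    · rw [Set.indicator_of_mem hy, Set.indicator_of_mem ((mem_gridCell_iff hk i y).2 hy)]
    · rw [Set.indicator_of_notMem hy, Set.indicator_of_notMem (mt (mem_gridCell_iff hk i y).1 hy)]
  have h2 := Measure.integral_comp_inv_smul_of_nonneg (volume : Measure (Fin d → ℝ))
    (fun x => (gridCell d k i).indicator F (cellCenter d k i + x)) hk'.le
  rw [integral_add_left_eq_self (μ := (volume : Measure (Fin d → ℝ)))
    ((gridCell d k i).indicator F)] at h2
  simp only [h1] at h2
  rw [integral_indicator (measurableSet_hypercube d),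
    integral_indicator (measurableSet_gridCell i)] at h2
  rw [h2, Module.finrank_fin_fun, smul_eq_mul, inv_mul_cancel_left₀ (by positivity)]

theorem setIntegral_pointLaw_gridCell (hg : IsDensity d g) (hk : 0 < k) (i : Fin d → Fin k)
    (F : (Fin d → ℝ) → ℝ) :
    ∫ x in gridCell d k i, F x ∂(pointLaw d g)
      = ∫ y in hypercube d, ((k : ℝ) ^ d)⁻¹ * g (cellCenter d k i + (k : ℝ)⁻¹ • y)
        * F (cellCenter d k i + (k : ℝ)⁻¹ • y) := by
  have hC := measurableSet_gridCell i
  rw [← integral_indicator hC, hg.integral_pointLaw]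
  have : ∀ x, g x * (gridCell d k i).indicator F x
      = (gridCell d k i).indicator (fun x => g x * F x) x := fun x => by
    by_cases hx : x ∈ gridCell d k i <;> simp [hx]
  simp only [this, mul_assoc]
  rw [setIntegral_indicator hC, Set.inter_eq_right.2 (gridCell_subset i),
    setIntegral_gridCell hk, integral_const_mul]

/-- The degrees of freedom captured by `j` points of a rescaled cell. -/
noncomputable def cubeTrace (d n k : ℕ) (τ : ℝ) (y : Fin j → Fin d → ℝ) : ℝ :=
  j - ((1 + (τ : ℂ) • gramMatrix d n (fun q => (k : ℝ)⁻¹ • y q))⁻¹).trace.re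

/-- The contribution of `j` points to the degrees of freedom captured by the cell of center `a`. -/
noncomputable def cellTerm (d n m : ℕ) (g : (Fin d → ℝ) → ℝ) (s : ℝ) (k : ℕ) (a : Fin d → ℝ)
    (j : ℕ) : ℝ :=
  (m.choose j : ℝ) * (((k : ℝ) ^ d)⁻¹) ^ j *
    (1 - ((k : ℝ) ^ d)⁻¹ * ∫ y in hypercube d, g (a + (k : ℝ)⁻¹ • y)) ^ (m - j) *
    ∫ y : Fin j → Fin d → ℝ, (∏ q, g (a + (k : ℝ)⁻¹ • y q)) * cubeTrace d n k (s / m) y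
      ∂(Measure.pi fun _ => volume.restrict (hypercube d))

theorem cubeTrace_nonneg {τ : ℝ} (hτ : 0 ≤ τ) (y : Fin j → Fin d → ℝ) :
    0 ≤ cubeTrace d n k τ y := by
  have := trace_resolvent_le_card (smul_gramMatrix_posSemidef (n := n) hτ
    fun q => (k : ℝ)⁻¹ • y q)
  rw [Fintype.card_fin] at this
  exact sub_nonneg.2 this

theorem cubeTrace_le {τ : ℝ} (hτ : 0 ≤ τ) (y : Fin j → Fin d → ℝ) :
    cubeTrace d n k τ y ≤ j :=
  sub_le_self _ (trace_resolvent_nonneg (smul_gramMatrix_posSemidef hτ _))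

theorem measurable_cubeTrace {τ : ℝ} :
    Measurable fun y : Fin j → Fin d → ℝ => cubeTrace d n k τ y := by
  refine measurable_const.sub (Complex.measurable_re.comp (measurable_inv_trace fun q r => ?_))
  simp only [Matrix.add_apply, Matrix.smul_apply, gramMatrix, Matrix.of_apply]
  have hc : Continuous fun y : Fin j → Fin d → ℝ =>
      fourierKernel d n ((k : ℝ)⁻¹ • y q) ((k : ℝ)⁻¹ • y r) :=
    continuous_fourierKernel.comp (f := fun y : Fin j → Fin d → ℝ =>
      ((k : ℝ)⁻¹ • y q, (k : ℝ)⁻¹ • y r)) (by fun_prop)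
  exact (continuous_const.add (hc.const_smul (τ : ℂ))).measurable

/-- Removes the cell center from the Gram matrix; afterwards the cell enters only through the
density. -/
theorem gramMatrix_add_left (a : Fin d → ℝ) (x : Fin j → Fin d → ℝ) :
    gramMatrix d n (fun q => a + x q) = gramMatrix d n x := by
  ext q r
  exact fourierKernel_eq_of_sub_eq (add_sub_add_left_eq_sub _ _ _)

theorem ae_mem_hypercube_pi (d j : ℕ) :
    ∀ᵐ y : Fin j → Fin d → ℝ ∂(Measure.pi fun _ => volume.restrict (hypercube d)),
      ∀ q, y q ∈ hypercube d := by
  rw [ae_all_iff]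
  intro q
  exact (measurePreserving_eval (fun _ : Fin j => (volume : Measure (Fin d → ℝ)).restrict
    (hypercube d)) q).quasiMeasurePreserving.ae (ae_restrict_mem (measurableSet_hypercube d))

/-- Expansion of the contribution of a cell according to the number of its points. -/
theorem cellTrace_eq_sum (hg : IsDensity d g) {M : ℝ} (hM : ∀ z, |g z| ≤ M) (hk : 0 < k) {s : ℝ}
    (hs : 0 ≤ s) (i : Fin d → Fin k) :
    cellTrace d n m g s k i
      = ∑ j ∈ Finset.range (m + 1), cellTerm d n m g s k (cellCenter d k i) j := by
  have := hg.isProbabilityMeasure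
  have hτ : 0 ≤ s / m := by positivity
  set a := cellCenter d k i with ha
  have hC := measurableSet_gridCell i
  have hb : ∀ (j : ℕ) (x : Fin j → Fin d → ℝ),
      |(n : ℝ) ^ d - resolventTrace d n (cellInd d k i) (s / m) x| ≤ (n : ℝ) ^ d := fun j x => by
    have h0 := resolventTrace_nonneg (n := n) (w := cellInd d k i) hτ x
    have h1 := resolventTrace_le (n := n) (w := cellInd d k i) hτ x
    rw [abs_of_nonneg] <;> linarith
  have hme : ∀ j : ℕ, Measurable fun x : Fin j → Fin d → ℝ =>
      (n : ℝ) ^ d - resolventTrace d n (cellInd d k i) (s / m) x := fun j =>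
    measurable_const.sub (measurable_resolventTrace (measurable_cellInd i))
  -- The trace weighted by the cell indicator ignores points outside the cell, which is the
  -- hypothesis of the expansion.
  have hexp := integral_pi_expansion (pointLaw d g) hC m
    (Φ := fun j x => (n : ℝ) ^ d - resolventTrace d n (cellInd d k i) (s / m) x)
    hme hb fun j q y x hy => by
      have hy0 : cellInd d k i y = 0 := Set.indicator_of_notMem hy _
      rw [resolventTrace_insertNth_of_eq_zero q hy0 x]
  rw [cellTrace, pointsLaw, hexp]
  refine Finset.sum_congr rfl fun j _ => ?_
  have hp : (pointLaw d g).real (gridCell d k i)ᶜ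
      = 1 - ((k : ℝ) ^ d)⁻¹ * ∫ y in hypercube d, g (a + (k : ℝ)⁻¹ • y) := by
    have h1 := setIntegral_pointLaw_gridCell hg hk i fun _ => 1
    rw [setIntegral_const, smul_eq_mul, mul_one] at h1
    simp only [mul_one] at h1
    rw [integral_const_mul] at h1
    rw [probReal_compl_eq_one_sub hC, h1]
  have hsc : Measurable fun y : Fin d → ℝ => a + (k : ℝ)⁻¹ • y :=
    (by fun_prop : Continuous fun y : Fin d → ℝ => a + (k : ℝ)⁻¹ • y).measurable
  have hint := integral_pi_of_integral ((pointLaw d g).restrict (gridCell d k i))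
    ((volume : Measure (Fin d → ℝ)).restrict (hypercube d)) hsc
    (h := fun y => ((k : ℝ) ^ d)⁻¹ * g (a + (k : ℝ)⁻¹ • y))
    ((hg.measurable.comp hsc).const_mul _) (B := ((k : ℝ) ^ d)⁻¹ * M) (fun y => by
      rw [abs_mul, abs_of_nonneg (by positivity : 0 ≤ ((k : ℝ) ^ d)⁻¹)]
      exact mul_le_mul_of_nonneg_left (hM _) (by positivity))
    (fun F _ _ => setIntegral_pointLaw_gridCell hg hk i F) j (hme j) (hb j)
  rw [hp, hint, cellTerm]
  have e : ∫ y : Fin j → Fin d → ℝ, (∏ q, ((k : ℝ) ^ d)⁻¹ * g (a + (k : ℝ)⁻¹ • y q)) *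
        ((n : ℝ) ^ d - resolventTrace d n (cellInd d k i) (s / m) fun q => a + (k : ℝ)⁻¹ • y q)
        ∂(Measure.pi fun _ => volume.restrict (hypercube d))
      = (((k : ℝ) ^ d)⁻¹) ^ j * ∫ y : Fin j → Fin d → ℝ,
        (∏ q, g (a + (k : ℝ)⁻¹ • y q)) * cubeTrace d n k (s / m) y
        ∂(Measure.pi fun _ => volume.restrict (hypercube d)) := by
    rw [← integral_const_mul]
    refine integral_congr_ae ?_
    filter_upwards [ae_mem_hypercube_pi d j] with y hy
    -- After rescaling, all `j` points lie in the cell, so the diagonal weights are 1.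
    have h1 : ∀ q, cellInd d k i (a + (k : ℝ)⁻¹ • y q) = 1 := fun q =>
      Set.indicator_of_mem ((mem_gridCell_iff hk i _).2 (hy q)) _
    rw [resolventTrace_eq_gram hτ, gramMatrix_add_left, Finset.prod_mul_distrib,
      Finset.prod_const, Finset.card_univ, Fintype.card_fin, mul_assoc]
    simp only [h1, Complex.ofReal_one, Matrix.diagonal_one, one_mul, mul_one]
    rfl
  rw [e]
  ring

/-- From `choose m j ≤ m^j / j!`, a probability factor in `[0, 1]` thanks to `hp`, and a trace of at
most `j`. The bound does not depend on the cell and is summable, as dominated convergence requires.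
-/
theorem abs_cellTerm_le {M : ℝ} (hg0 : ∀ z, 0 ≤ g z) (hM : ∀ z, g z ≤ M) {s : ℝ} (hs : 0 ≤ s)
    (a : Fin d → ℝ) (hp : ((k : ℝ) ^ d)⁻¹ * ∫ y in hypercube d, g (a + (k : ℝ)⁻¹ • y) ≤ 1) (j : ℕ) :
    |cellTerm d n m g s k a j| ≤ (m / (k : ℝ) ^ d * M) ^ j / j.factorial * j := by
  have hτ : 0 ≤ s / m := by positivity
  have hM0 : 0 ≤ M := (hg0 0).trans (hM 0)
  have hp0 : 0 ≤ ((k : ℝ) ^ d)⁻¹ * ∫ y in hypercube d, g (a + (k : ℝ)⁻¹ • y) :=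
    mul_nonneg (by positivity) (integral_nonneg fun y => hg0 _)
  have hq : |(1 - ((k : ℝ) ^ d)⁻¹ * ∫ y in hypercube d, g (a + (k : ℝ)⁻¹ • y)) ^ (m - j)| ≤ 1 := by
    rw [abs_of_nonneg (pow_nonneg (by linarith) _)]
    exact pow_le_one₀ (by linarith) (by linarith)
  have hI : |∫ y : Fin j → Fin d → ℝ, (∏ q, g (a + (k : ℝ)⁻¹ • y q)) * cubeTrace d n k (s / m) y
      ∂(Measure.pi fun _ => volume.restrict (hypercube d))| ≤ M ^ j * j := by
    rw [← Real.norm_eq_abs]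
    refine (norm_integral_le_of_norm_le_const (C := M ^ j * j)
      (Eventually.of_forall fun y => ?_)).trans (by simp)
    rw [Real.norm_eq_abs, abs_of_nonneg (mul_nonneg (Finset.prod_nonneg fun q _ => hg0 _)
      (cubeTrace_nonneg hτ y))]
    refine mul_le_mul ?_ (cubeTrace_le hτ y) (cubeTrace_nonneg hτ y) (by positivity)
    refine (Finset.prod_le_prod (fun q _ => hg0 _) fun q _ => hM _).trans ?_
    simp
  rw [cellTerm, abs_mul, abs_mul, abs_of_nonneg
    (by positivity : 0 ≤ (m.choose j : ℝ) * (((k : ℝ) ^ d)⁻¹) ^ j)]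
  have hch : (m.choose j : ℝ) ≤ (m : ℝ) ^ j / j.factorial := Nat.choose_le_pow_div j m
  calc _ ≤ ((m : ℝ) ^ j / j.factorial * (((k : ℝ) ^ d)⁻¹) ^ j) * 1 * (M ^ j * j) := by
        gcongr
    _ = _ := by rw [mul_pow, div_pow, inv_pow]; ring

end CellSeries

/-! ### Limits of the cell contributions and of their sum. -/

section CellLimits

open scoped ComplexOrder

variable {α : Type*} {l : Filter α} {d : ℕ} {g : (Fin d → ℝ) → ℝ} {n m k : α → ℕ}

/-- The limit of the degrees of freedom captured by `j` points of a rescaled cell. -/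
noncomputable def cubeTraceLimit (R σ : ℝ) {j : ℕ} (y : Fin j → Fin d → ℝ) : ℝ :=
  j - ((1 + (σ : ℂ) • (Matrix.of fun q r => ∏ t, dirichletLimit R (y r t - y q t) :
    Matrix (Fin j) (Fin j) ℂ))⁻¹).trace.re

/-- Each entry `τ` times the kernel is written as `τ n^d` times a product of normalized Dirichlet
sums, and both factors converge. -/
theorem tendsto_cubeTrace [l.NeBot] (hk : Tendsto k l atTop) {R : ℝ} (hR : 0 < R)
    (hnk : Tendsto (fun a => (n a : ℝ) / k a) l (𝓝 R)) {τ : α → ℝ} (hτ0 : ∀ a, 0 ≤ τ a) {σ : ℝ}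
    (hτ : Tendsto (fun a => τ a * (n a : ℝ) ^ d) l (𝓝 σ)) {j : ℕ} (y : Fin j → Fin d → ℝ) :
    Tendsto (fun a => cubeTrace d (n a) (k a) (τ a) y) l (𝓝 (cubeTraceLimit R σ y)) := by
  refine (tendsto_trace_resolvent (Eventually.of_forall fun a =>
    smul_gramMatrix_posSemidef (hτ0 a) _) ?_).const_sub _
  refine tendsto_pi_nhds.2 fun q => tendsto_pi_nhds.2 fun r => ?_
  have hn : ∀ᶠ a in l, (n a : ℂ) ≠ 0 := by
    filter_upwards [hnk.eventually_const_lt hR] with a ha hn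
    have : (n a : ℝ) = 0 := by exact_mod_cast hn
    rw [this] at ha
    simp at ha
  have h1 : Tendsto (fun a => ((τ a * (n a : ℝ) ^ d : ℝ) : ℂ)) l (𝓝 (σ : ℂ)) :=
    (Complex.continuous_ofReal.tendsto σ).comp hτ
  have h2 : Tendsto (fun a => ∏ t, dirichletSum (n a) ((k a : ℝ)⁻¹ * (y r t - y q t)) / n a) l
      (𝓝 (∏ t, dirichletLimit R (y r t - y q t))) :=
    tendsto_finsetProd _ fun t _ => tendsto_dirichletSum_div hk hR hnk _
  refine (h1.mul h2).congr' ?_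
  filter_upwards [hn] with a ha
  simp only [Matrix.smul_apply, gramMatrix, Matrix.of_apply, fourierKernel_eq_prod, Pi.smul_apply,
    smul_eq_mul, ← mul_sub, Finset.prod_div_distrib, Finset.prod_const, Finset.card_univ,
    Fintype.card_fin]
  push_cast
  field_simp

theorem tendsto_point {a : α → Fin d → ℝ} {z : Fin d → ℝ} (ha : Tendsto a l (𝓝 z))
    (hk : Tendsto k l atTop) (y : Fin d → ℝ) :
    Tendsto (fun t => a t + (k t : ℝ)⁻¹ • y) l (𝓝 z) := by
  have := ha.add (((tendsto_inv_atTop_nhds_zero_nat (𝕜 := ℝ)).comp hk).smul_const y)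
  simpa using this

/-- The limit of the contribution of `j` points to the degrees of freedom captured by a cell on
which the density is `γ`. -/
noncomputable def cellTermLimit (d : ℕ) (R Λ σ γ : ℝ) (j : ℕ) : ℝ :=
  Λ ^ j / j.factorial * Real.exp (-(Λ * γ)) *
    ∫ y : Fin j → Fin d → ℝ, (∏ _q : Fin j, γ) * cubeTraceLimit R σ y
      ∂(Measure.pi fun _ => volume.restrict (hypercube d))

/-- The binomial weights tend to Poisson weights. As the cells shrink to `z`, continuity of `g`
freezes the density at `g z`, and dominated convergence handles the integral over the `j` points. -/
theorem tendsto_cellTerm [l.NeBot] [l.IsCountablyGenerated] (hg : Continuous g) {M : ℝ}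
    (hg0 : ∀ z, 0 ≤ g z) (hM : ∀ z, g z ≤ M) {s : ℝ} (hs : 0 ≤ s) {R Λ σ : ℝ} (hR : 0 < R)
    (hk : Tendsto k l atTop) (hm : Tendsto m l atTop)
    (hnk : Tendsto (fun a => (n a : ℝ) / k a) l (𝓝 R))
    (hmk : Tendsto (fun a => (m a : ℝ) / (k a : ℝ) ^ d) l (𝓝 Λ))
    (hσ : Tendsto (fun a => s / m a * (n a : ℝ) ^ d) l (𝓝 σ))
    {c : α → Fin d → ℝ} {z : Fin d → ℝ} (hc : Tendsto c l (𝓝 z)) (j : ℕ) :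
    Tendsto (fun a => cellTerm d (n a) (m a) g s (k a) (c a) j) l
      (𝓝 (cellTermLimit d R Λ σ (g z) j)) := by
  have hM0 : 0 ≤ M := (hg0 0).trans (hM 0)
  have hτ0 : ∀ a, 0 ≤ s / m a := fun a => by positivity
  have hgm : ∀ a, Measurable fun y : Fin d → ℝ => g (c a + (k a : ℝ)⁻¹ • y) := fun a =>
    (hg.comp (by fun_prop)).measurable
  have hmass : Tendsto (fun a => ∫ y in hypercube d, g (c a + (k a : ℝ)⁻¹ • y)) l (𝓝 (g z)) := by
    have := tendsto_integral_filter_of_dominated_convergence (l := l)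
      (μ := volume.restrict (hypercube d)) (F := fun a y => g (c a + (k a : ℝ)⁻¹ • y))
      (f := fun _ => g z) (fun _ => M)
      (Eventually.of_forall fun a => (hgm a).aestronglyMeasurable)
      (Eventually.of_forall fun a => Eventually.of_forall fun y => by
        rw [Real.norm_eq_abs, abs_of_nonneg (hg0 _)]; exact hM _) (integrable_const _)
      (Eventually.of_forall fun y => (hg.tendsto z).comp (tendsto_point hc hk y))
    simpa using this
  have h1 : Tendsto (fun a => ((m a).choose j : ℝ) * (((k a : ℝ) ^ d)⁻¹) ^ j) l
      (𝓝 (Λ ^ j / j.factorial)) :=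
    tendsto_choose_mul_pow hm (by simpa only [div_eq_mul_inv] using hmk) j
  have h2 := tendsto_one_sub_pow hm (p := fun a => ((k a : ℝ) ^ d)⁻¹ *
    ∫ y in hypercube d, g (c a + (k a : ℝ)⁻¹ • y)) (μ := Λ * g z)
    (by simpa only [div_eq_mul_inv, mul_assoc] using hmk.mul hmass) j
  refine (h1.mul h2).mul ?_
  refine tendsto_integral_filter_of_dominated_convergence (fun _ => M ^ j * j)
    (Eventually.of_forall fun a => ?_) (Eventually.of_forall fun a => Eventually.of_forall fun y => ?_)
    (integrable_const _) (Eventually.of_forall fun y => ?_)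
  · exact ((Finset.measurable_fun_prod _ fun q _ => (hgm a).comp (measurable_pi_apply q)).mul
      measurable_cubeTrace).aestronglyMeasurable
  · rw [Real.norm_eq_abs, abs_of_nonneg (mul_nonneg (Finset.prod_nonneg fun q _ => hg0 _)
      (cubeTrace_nonneg (hτ0 a) y))]
    refine mul_le_mul ?_ (cubeTrace_le (hτ0 a) y) (cubeTrace_nonneg (hτ0 a) y) (by positivity)
    refine (Finset.prod_le_prod (fun q _ => hg0 _) fun q _ => hM _).trans ?_
    simp
  · exact (tendsto_finsetProd _ fun q _ => (hg.tendsto z).comp (tendsto_point hc hk (y q))).mul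
      (tendsto_cubeTrace hk hR hnk hτ0 hσ y)

theorem summable_pow_div_factorial_mul (x : ℝ) :
    Summable fun j : ℕ => x ^ j / j.factorial * j := by
  rw [← summable_nat_add_iff 1]
  refine ((Real.summable_pow_div_factorial x).mul_left x).congr fun j => ?_
  rw [Nat.factorial_succ]
  have : (j.factorial : ℝ) ≠ 0 := by exact_mod_cast j.factorial_ne_zero
  push_cast
  field_simp
  ring

/-- The binomial coefficient kills the terms with `j > m`, so the range of summation no longer
depends on `m`. -/
theorem cellTrace_eq_tsum {n m k : ℕ} (hg : IsDensity d g) {M : ℝ} (hM : ∀ z, |g z| ≤ M)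
    (hk : 0 < k) {s : ℝ} (hs : 0 ≤ s) (i : Fin d → Fin k) :
    cellTrace d n m g s k i = ∑' j, cellTerm d n m g s k (cellCenter d k i) j := by
  rw [cellTrace_eq_sum hg hM hk hs, tsum_eq_sum]
  intro j hj
  rw [cellTerm, Nat.choose_eq_zero_of_lt (by simpa using hj)]
  simp

/-- Stated for every `a`, not only for cell centers, where it would be a probability; hence the
requirement `M ≤ k^d`. -/
theorem mass_le_one {k : ℕ} {M : ℝ} (hg0 : ∀ z, 0 ≤ g z) (hM : ∀ z, g z ≤ M)
    (hk0 : 0 < k) (hk : M ≤ (k : ℝ) ^ d) (a : Fin d → ℝ) :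
    ((k : ℝ) ^ d)⁻¹ * ∫ y in hypercube d, g (a + (k : ℝ)⁻¹ • y) ≤ 1 := by
  have hk' : (0 : ℝ) < (k : ℝ) ^ d := by positivity
  rw [inv_mul_le_iff₀ hk', mul_one]
  refine le_trans ?_ hk
  have := norm_integral_le_of_norm_le_const (μ := volume.restrict (hypercube d))
    (f := fun y => g (a + (k : ℝ)⁻¹ • y)) (C := M) (Eventually.of_forall fun y => by
      rw [Real.norm_eq_abs, abs_of_nonneg (hg0 _)]; exact hM _)
  rw [probReal_univ, mul_one] at this
  exact (le_abs_self _).trans this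

theorem dist_cellCenter_le {k : ℕ} (hk : 0 < k) {i : Fin d → Fin k} {z : Fin d → ℝ}
    (hz : z ∈ gridCell d k i) : dist (cellCenter d k i) z ≤ (k : ℝ)⁻¹ := by
  have hk' : (0 : ℝ) < k := by exact_mod_cast hk
  refine (dist_pi_le_iff (by positivity)).2 fun t => ?_
  have h : z t ∈ Set.Ico (-1 / 2 + (i t : ℕ) / (k : ℝ)) (-1 / 2 + (i t : ℕ) / (k : ℝ) + 1 / k) :=
    hz t (Set.mem_univ t)
  rw [Set.mem_Ico, one_div] at h
  rw [Real.dist_eq, abs_le, cellCenter, add_div]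
  have : (0 : ℝ) < (k : ℝ)⁻¹ := by positivity
  have e : (1 : ℝ) / 2 / k = (k : ℝ)⁻¹ / 2 := by field_simp
  rw [e]
  constructor <;> linarith [h.1, h.2]

/-- The contribution of the cell that contains a given point. -/
noncomputable def localTrace (d n m : ℕ) (g : (Fin d → ℝ) → ℝ) (s : ℝ) (k : ℕ)
    (z : Fin d → ℝ) : ℝ :=
  ∑ i, cellInd d k i z * cellTrace d n m g s k i

theorem localTrace_of_mem {n m k : ℕ} {s : ℝ} {i : Fin d → Fin k} {z : Fin d → ℝ}
    (hz : z ∈ gridCell d k i) : localTrace d n m g s k z = cellTrace d n m g s k i := by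
  rw [localTrace, Finset.sum_eq_single i]
  · rw [cellInd, Set.indicator_of_mem hz, one_mul]
  · intro i' _ h
    have : z ∉ gridCell d k i' := fun h' => h (gridCell_inj h' hz)
    rw [cellInd, Set.indicator_of_notMem this, zero_mul]
  · exact fun h => absurd (Finset.mem_univ i) h

/-- Turns a sum over a growing number of cells into an integral over the fixed cube, where dominated
convergence applies. -/
theorem integral_localTrace {n m k : ℕ} (hk : 0 < k) {s : ℝ} :
    ∫ z in hypercube d, localTrace d n m g s k z
      = ((k : ℝ) ^ d)⁻¹ * ∑ i, cellTrace d n m g s k i := by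
  have hi : ∀ i, IntegrableOn (cellInd d k i) (hypercube d) := fun i =>
    integrable_hypercube_of_bounded (measurable_cellInd i) (C := 1) fun x => by
      rw [abs_of_nonneg (cellInd_nonneg i x)]; exact cellInd_le_one i x
  have h1 : ∀ i : Fin d → Fin k, ∫ z in hypercube d, cellInd d k i z = ((k : ℝ) ^ d)⁻¹ := by
    intro i
    have h2 := setIntegral_gridCell hk i fun _ => 1
    have h3 : ∫ _ in hypercube d, (1 : ℝ) = 1 := by rw [integral_const, probReal_univ, one_smul]
    rw [h3, mul_one] at h2
    unfold cellInd
    rw [setIntegral_indicator (measurableSet_gridCell i), Set.inter_eq_right.2 (gridCell_subset i),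
      h2]
  unfold localTrace
  rw [integral_finsetSum _ fun i _ => (hi i).mul_const _, Finset.mul_sum]
  refine Finset.sum_congr rfl fun i _ => ?_
  rw [integral_mul_const, h1]

/-- Convergence of the block approximation. -/
theorem tendsto_sum_cellTrace [l.NeBot] [l.IsCountablyGenerated] (hd : 0 < d) (hgd : IsDensity d g)
    (hg : Continuous g) {M : ℝ} (hg0 : ∀ z, 0 ≤ g z) (hM : ∀ z, g z ≤ M) {s : ℝ} (hs : 0 ≤ s)
    {R Λ σ : ℝ} (hR : 0 < R) (hk : Tendsto k l atTop) (hm : Tendsto m l atTop)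
    (hnk : Tendsto (fun a => (n a : ℝ) / k a) l (𝓝 R))
    (hmk : Tendsto (fun a => (m a : ℝ) / (k a : ℝ) ^ d) l (𝓝 Λ))
    (hσ : Tendsto (fun a => s / m a * (n a : ℝ) ^ d) l (𝓝 σ)) :
    Tendsto (fun a => (∑ i, cellTrace d (n a) (m a) g s (k a) i) / (n a : ℝ) ^ d) l
      (𝓝 ((R ^ d)⁻¹ * ∫ z in hypercube d, ∑' j, cellTermLimit d R Λ σ (g z) j)) := by
  have hM0 : 0 ≤ M := (hg0 0).trans (hM 0)
  have hMabs : ∀ z, |g z| ≤ M := fun z => by rw [abs_of_nonneg (hg0 z)]; exact hM z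
  have hkM : ∀ᶠ a in l, M ≤ (k a : ℝ) ^ d :=
    ((tendsto_pow_atTop hd.ne').comp (tendsto_natCast_atTop_atTop.comp hk)).eventually_ge_atTop M
  have hΛ : ∀ᶠ a in l, (m a : ℝ) / (k a : ℝ) ^ d < Λ + 1 :=
    hmk.eventually_lt_const (by linarith)
  -- Any number above the limit `Λ` of the mean number of points works; `Λ + 1` makes the domination
  -- uniform in the cells.
  set bound : ℕ → ℝ := fun j => ((Λ + 1) * M) ^ j / j.factorial * j with hbd
  have hsum : Summable bound := summable_pow_div_factorial_mul _
  have hterm : ∀ᶠ a in l, ∀ c j, |cellTerm d (n a) (m a) g s (k a) c j| ≤ bound j := by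
    filter_upwards [hkM, hΛ, hk.eventually_gt_atTop 0] with a h1 h2 h3 c j
    refine (abs_cellTerm_le hg0 hM hs c (mass_le_one hg0 hM h3 h1 c) j).trans ?_
    simp only [hbd]
    gcongr
  have hint : Tendsto (fun a => ∫ z in hypercube d, localTrace d (n a) (m a) g s (k a) z) l
      (𝓝 (∫ z in hypercube d, ∑' j, cellTermLimit d R Λ σ (g z) j)) := by
    refine tendsto_integral_filter_of_dominated_convergence (fun _ => ∑' j, bound j)
      (Eventually.of_forall fun a => ?_) ?_ (integrable_const _) ?_
    · exact (Finset.measurable_fun_sum _ fun i _ =>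
        (measurable_cellInd i).mul_const _).aestronglyMeasurable
    · filter_upwards [hterm, hk.eventually_gt_atTop 0] with a ha hka
      filter_upwards [ae_restrict_mem (measurableSet_hypercube d)] with z hz
      obtain ⟨i, hi⟩ := exists_mem_gridCell hka hz
      rw [localTrace_of_mem hi, cellTrace_eq_tsum hgd hMabs hka hs]
      exact tsum_of_norm_bounded hsum.hasSum fun j => ha _ j
    · filter_upwards [ae_restrict_mem (measurableSet_hypercube d)] with z hz
      -- Selects the center of the cell containing `z`, which converges to `z`. When `k a = 0` there
      -- is no cell and the value 0 is arbitrary.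
      have hex : ∀ a, ∃ c : Fin d → ℝ, 0 < k a → dist c z ≤ (k a : ℝ)⁻¹ ∧
          localTrace d (n a) (m a) g s (k a) z = ∑' j, cellTerm d (n a) (m a) g s (k a) c j := by
        intro a
        by_cases hka : 0 < k a
        · obtain ⟨i, hi⟩ := exists_mem_gridCell hka hz
          refine ⟨cellCenter d (k a) i, fun _ => ⟨dist_cellCenter_le hka hi, ?_⟩⟩
          rw [localTrace_of_mem hi, cellTrace_eq_tsum hgd hMabs hka hs]
        · exact ⟨0, fun h => absurd h hka⟩
      choose c hc using hex
      have hcz : Tendsto c l (𝓝 z) := by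
        rw [tendsto_iff_dist_tendsto_zero]
        refine squeeze_zero' (Eventually.of_forall fun a => dist_nonneg) ?_
          ((tendsto_inv_atTop_nhds_zero_nat (𝕜 := ℝ)).comp hk)
        filter_upwards [hk.eventually_gt_atTop 0] with a hka
        exact (hc a hka).1
      have := tendsto_tsum_of_dominated_convergence (𝓕 := l)
        (f := fun a j => cellTerm d (n a) (m a) g s (k a) (c a) j)
        (g := fun j => cellTermLimit d R Λ σ (g z) j) hsum
        (fun j => tendsto_cellTerm hg hg0 hM hs hR hk hm hnk hmk hσ hcz j)
        (by filter_upwards [hterm] with a ha j using ha _ j)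
      refine this.congr' ?_
      filter_upwards [hk.eventually_gt_atTop 0] with a hka
      exact (hc a hka).2.symm
  -- Normalizing by `n^d` instead of by the number `k^d` of cells produces the factor `R^{-d}`.
  have hRd : Tendsto (fun a => (((n a : ℝ) / k a) ^ d)⁻¹) l (𝓝 (R ^ d)⁻¹) :=
    (hnk.pow d).inv₀ (by positivity)
  refine (hRd.mul hint).congr' ?_
  filter_upwards [hk.eventually_gt_atTop 0] with a hka
  have hka' : ((k a : ℝ) ^ d) ≠ 0 := by positivity
  rw [integral_localTrace hka, div_pow, inv_div]
  field_simp

end CellLimits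

/-! ### Existence of the asymptotic transform. -/

section Existence

variable {α : Type*} {l : Filter α}

/-- The approximations have limits `L` that may vary with `ε`. Eventually `u` lies within `2ε/5` of
`L`, so two of its values differ by less than `ε`, and completeness finishes. -/
theorem exists_tendsto_of_approx [l.NeBot] {u : α → ℝ}
    (h : ∀ ε > 0, ∃ (v : α → ℝ) (L : ℝ), Tendsto v l (𝓝 L) ∧ ∀ᶠ a in l, |u a - v a| ≤ ε) :
    ∃ L, Tendsto u l (𝓝 L) := by
  rw [← cauchy_map_iff_exists_tendsto, Metric.cauchy_iff]
  refine ⟨map_neBot, fun ε hε => ?_⟩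
  obtain ⟨v, L, hv, huv⟩ := h (ε / 5) (by positivity)
  have hvL := (Metric.tendsto_nhds.1 hv) (ε / 5) (by positivity)
  refine ⟨{x | |x - L| ≤ 2 * (ε / 5)}, ?_, fun x hx y hy => ?_⟩
  · rw [mem_map]
    filter_upwards [huv, hvL] with a h1 h2
    rw [Real.dist_eq] at h2
    exact (abs_sub_le _ (v a) _).trans (by linarith)
  · rw [Real.dist_eq]
    have h1 := abs_sub_le x L y
    rw [abs_sub_comm L y] at h1
    have hx' : |x - L| ≤ 2 * (ε / 5) := hx
    have hy' : |y - L| ≤ 2 * (ε / 5) := hy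
    linarith

instance {d : ℕ} {β : ℝ} : (growthRegime d β).IsCountablyGenerated := by
  unfold growthRegime
  infer_instance

variable {d : ℕ} {β : ℝ} {f : (Fin d → ℝ) → ℝ}

theorem tendsto_fst_growthRegime : Tendsto (fun nm : ℕ × ℕ => nm.1) (growthRegime d β) atTop :=
  tendsto_fst.mono_left inf_le_left

theorem tendsto_snd_growthRegime : Tendsto (fun nm : ℕ × ℕ => nm.2) (growthRegime d β) atTop :=
  tendsto_snd.mono_left inf_le_left

theorem tendsto_aspectRatio_growthRegime :
    Tendsto (fun nm : ℕ × ℕ => aspectRatio d nm.1 nm.2) (growthRegime d β) (𝓝 β) :=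
  tendsto_comap.mono_left inf_le_right

theorem tendsto_nat_div_div {n : α → ℕ} (hn : Tendsto n l atTop) {R : ℕ} (hR : 0 < R) :
    Tendsto (fun a => (n a : ℝ) / (n a / R : ℕ)) l (𝓝 R) := by
  have hR' : (0 : ℝ) < R := by exact_mod_cast hR
  have h1 := ((tendsto_nat_floor_mul_div_atTop (R := ℝ) (a := (R : ℝ)⁻¹) (by positivity)).comp
    (tendsto_natCast_atTop_atTop.comp hn)).inv₀ (by positivity)
  rw [inv_inv] at h1
  refine h1.congr fun a => ?_
  simp only [Function.comp, inv_div]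
  rw [inv_mul_eq_div, Nat.floor_div_eq_div]

/-- The limit of the finite transforms exists. -/
theorem exists_tendsto_etaFinite (hd : 0 < d) (hf : IsDensity d f) (hβ : 0 < β) {s : ℝ}
    (hs : 0 ≤ s) :
    ∃ L, Tendsto (fun nm : ℕ × ℕ => etaFinite d nm.1 nm.2 f s) (growthRegime d β) (𝓝 L) := by
  have := growthRegime_neBot hd hβ
  refine exists_tendsto_of_approx fun ε hε => ?_
  -- Half of `ε` pays for the change of density, with `β⁻¹ + 1` eventually bounding `m / n^d`. The
  -- other half pays for the pinching; the bound `M`, and with it `R`, is fixed only after `g`.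
  obtain ⟨g, M, hg, hgc, hM0, hgM, hfg⟩ :=
    hf.exists_continuous_density (ε := ε / (2 * (β⁻¹ + 1))) (by positivity)
  obtain ⟨R, hR, hoff⟩ := exists_offCell_mass_le d (ε := ε / (2 * (s ^ 2 * M ^ 2 + 1)))
    (by positivity)
  have hn := tendsto_fst_growthRegime (d := d) (β := β)
  have hm := tendsto_snd_growthRegime (d := d) (β := β)
  have hr := tendsto_aspectRatio_growthRegime (d := d) (β := β)
  -- The integer quotient `k = n / R` satisfies `R k ≤ n` exactly, while `n / k` still tends to `R`.
  have hk : Tendsto (fun nm : ℕ × ℕ => nm.1 / R) (growthRegime d β) atTop :=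
    (Nat.tendsto_div_const_atTop hR.ne').comp hn
  have hnk := tendsto_nat_div_div hn hR
  have hpos : ∀ᶠ nm in growthRegime d β, 0 < nm.1 ∧ 0 < nm.2 ∧ 0 < nm.1 / R := by
    filter_upwards [hn.eventually_gt_atTop 0, hm.eventually_gt_atTop 0, hk.eventually_gt_atTop 0]
      with a h1 h2 h3 using ⟨h1, h2, h3⟩
  have hmk : Tendsto (fun nm : ℕ × ℕ => (nm.2 : ℝ) / ((nm.1 / R : ℕ) : ℝ) ^ d) (growthRegime d β)
      (𝓝 ((R : ℝ) ^ d / β)) := by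
    refine ((hnk.pow d).div hr hβ.ne').congr' ?_
    filter_upwards [hpos] with a ⟨h1, h2, h3⟩
    have h1' : (a.1 : ℝ) ≠ 0 := by exact_mod_cast h1.ne'
    have h2' : (a.2 : ℝ) ≠ 0 := by exact_mod_cast h2.ne'
    have h3' : ((a.1 / R : ℕ) : ℝ) ≠ 0 := by exact_mod_cast h3.ne'
    simp only [Pi.div_apply, aspectRatio, div_pow]
    field_simp
  have hσ : Tendsto (fun nm : ℕ × ℕ => s / nm.2 * (nm.1 : ℝ) ^ d) (growthRegime d β)
      (𝓝 (s * β)) :=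
    (hr.const_mul s).congr fun a => by rw [aspectRatio]; ring
  have hlim := tendsto_sum_cellTrace hd hg hgc (fun z => (hgM z).1) (fun z => (hgM z).2) hs
    (by exact_mod_cast hR) hk hm hnk hmk hσ
  refine ⟨_, _, hlim.const_sub 1, ?_⟩
  have hri : Tendsto (fun nm : ℕ × ℕ => (aspectRatio d nm.1 nm.2)⁻¹) (growthRegime d β) (𝓝 β⁻¹) :=
    hr.inv₀ hβ.ne'
  filter_upwards [hpos, hri.eventually_lt_const (lt_add_one _)] with a ⟨h1, h2, h3⟩ h4
  have e1 := abs_etaFinite_sub_density_le (n := a.1) (m := a.2) hf hg hs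
  have e2 := abs_etaFinite_sub_cells_le hg hM0 (fun z => (hgM z).2) h1 h2 h3 hs
    (hoff a.1 (a.1 / R) h3 (Nat.mul_div_le _ _))
  have e3 : (a.2 : ℝ) / (a.1 : ℝ) ^ d * ∫ x in hypercube d, |f x - g x| ≤ ε / 2 := by
    rw [aspectRatio, inv_div] at h4
    calc _ ≤ (β⁻¹ + 1) * (ε / (2 * (β⁻¹ + 1))) :=
          mul_le_mul h4.le hfg (integral_nonneg fun _ => abs_nonneg _) (by positivity)
      _ = _ := by field_simp
  have e4 : s ^ 2 * M ^ 2 * (ε / (2 * (s ^ 2 * M ^ 2 + 1))) ≤ ε / 2 := by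
    rw [mul_div_assoc', div_le_div_iff₀ (by positivity) (by positivity)]
    nlinarith [hε]
  refine (abs_sub_le _ (etaFinite d a.1 a.2 g s) _).trans ?_
  linarith

theorem tendsto_etaLimit (hd : 0 < d) (hf : IsDensity d f) (hβ : 0 < β) {s : ℝ} (hs : 0 ≤ s) :
    Tendsto (fun nm : ℕ × ℕ => etaFinite d nm.1 nm.2 f s) (growthRegime d β)
      (𝓝 (etaLimit d f β s)) :=
  tendsto_nhds_limUnder (exists_tendsto_etaFinite hd hf hβ hs)

end Existence

/-! ### The LMMSE error as a resolvent trace. -/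

section MeanSquareError

open Matrix

open scoped ComplexOrder

/-- The error covariance of the LMMSE estimator is `σa² (1 + γ A Aᴴ)⁻¹`. -/
theorem lmmse_error_eq {ι κ : Type*} [Fintype ι] [Fintype κ] [DecidableEq ι] [DecidableEq κ]
    (A : Matrix ι κ ℂ) {p q : ℝ} (hp : 0 < p) (hq : 0 < q) {W : Matrix ι κ ℂ}
    (hW : W = ((p : ℂ) • A) * ((p : ℂ) • (Aᴴ * A) + (q : ℂ) • 1)⁻¹) :
    (p : ℂ) • ((1 - W * Aᴴ) * (1 - W * Aᴴ)ᴴ) + (q : ℂ) • (W * Wᴴ)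
      = (p : ℂ) • (1 + ((p / q : ℝ) : ℂ) • (A * Aᴴ))⁻¹ := by
  have hq' : (q : ℂ) ≠ 0 := by exact_mod_cast hq.ne'
  have hγ : (0 : ℂ) ≤ ((p / q : ℝ) : ℂ) := by exact_mod_cast (by positivity : 0 ≤ p / q)
  have hT := (posSemidef_self_mul_conjTranspose A).smul hγ
  have hT' := (posSemidef_conjTranspose_mul_self A).smul hγ
  have hu := hT.isUnit_det_one_add
  have hu' := hT'.isUnit_det_one_add
  have hZh : ((1 + ((p / q : ℝ) : ℂ) • (A * Aᴴ))⁻¹)ᴴ = (1 + ((p / q : ℝ) : ℂ) • (A * Aᴴ))⁻¹ :=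
    (posSemidef_resolvent hT).isHermitian
  set c : ℂ := ((p / q : ℝ) : ℂ) with hc
  have hcp : c * q = p := by rw [hc]; push_cast; field_simp
  set Z := (1 + c • (A * Aᴴ))⁻¹ with hZ
  have hZ1 : Z * (1 + c • (A * Aᴴ)) = 1 := nonsing_inv_mul _ hu
  have hX : (p : ℂ) • (Aᴴ * A) + (q : ℂ) • 1 = (q : ℂ) • (1 + c • (Aᴴ * A)) := by
    rw [smul_add, smul_smul, mul_comm, hcp, add_comm]
  have hXu : IsUnit ((q : ℂ) • (1 + c • (Aᴴ * A))).det := by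
    rw [det_smul]
    exact (IsUnit.mk0 _ (pow_ne_zero _ hq')).mul hu'
  -- Push-through identity again: it rewrites the filter as `c Z A`, with the inverse on the
  -- frequency side.
  have hWX : (c • (Z * A)) * ((q : ℂ) • (1 + c • (Aᴴ * A))) = (p : ℂ) • A := by
    have e : A * (1 + c • (Aᴴ * A)) = (1 + c • (A * Aᴴ)) * A := by
      rw [Matrix.mul_add, Matrix.add_mul, Matrix.mul_one, Matrix.one_mul, Matrix.mul_smul,
        Matrix.smul_mul, Matrix.mul_assoc]
    rw [Matrix.smul_mul, Matrix.mul_smul, smul_smul, hcp, Matrix.mul_assoc, e, ← Matrix.mul_assoc,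
      hZ1, Matrix.one_mul]
  have hWZ : W = c • (Z * A) := by
    rw [hW, hX, ← hWX, mul_nonsing_inv_cancel_right _ _ hXu]
  have h1 : 1 - W * Aᴴ = Z := by
    rw [hWZ, Matrix.smul_mul, Matrix.mul_assoc, sub_eq_iff_eq_add, ← hZ1, Matrix.mul_add,
      Matrix.mul_one, Matrix.mul_smul]
  have hcc : star c = c := by rw [hc, Complex.star_def, Complex.conj_ofReal]
  have h2 : (q : ℂ) • (W * Wᴴ) = (p : ℂ) • (Z * (c • (A * Aᴴ)) * Z) := by
    rw [hWZ, conjTranspose_smul, conjTranspose_mul, hZh, hcc, Matrix.smul_mul, Matrix.mul_smul,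
      Matrix.mul_smul, Matrix.smul_mul, smul_smul, smul_smul, smul_smul, ← hcp]
    simp only [Matrix.mul_assoc]
    congr 1
    ring
  rw [h1, h2, hZh, ← smul_add]
  congr 1
  -- Bias and noise parts combine to `Z (1 + c A Aᴴ) Z = Z`.
  have h3 : Z * Z + Z * (c • (A * Aᴴ)) * Z = Z * (1 + c • (A * Aᴴ)) * Z := by
    rw [Matrix.mul_add, Matrix.mul_one, Matrix.add_mul]
  rw [h3, hZ1, Matrix.one_mul]

/-- Exact at finite size, with the actual aspect ratio in the parameter; only the limit replaces it
by `β`. -/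
theorem mseFinite_eq (d n m : ℕ) (f : (Fin d → ℝ) → ℝ) {σa σn : ℝ} (hσa : 0 < σa) (hσn : 0 < σn) :
    mseFinite d n m f σa σn = etaFinite d n m f (σa ^ 2 / σn ^ 2 / aspectRatio d n m) := by
  unfold mseFinite etaFinite
  congr 1
  ext x
  have hr : 0 ≤ aspectRatio d n m := by unfold aspectRatio; positivity
  set V := vandermondeFold d n m x with hV
  have hS : samplingMatrix d n m x
      = ((((Real.sqrt (aspectRatio d n m))⁻¹ : ℝ) : ℂ) • V)ᴴ := by
    rw [conjTranspose_smul, Complex.star_def, Complex.conj_ofReal]; rfl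
  have hA : ((((Real.sqrt (aspectRatio d n m))⁻¹ : ℝ) : ℂ) • V)
      * ((((Real.sqrt (aspectRatio d n m))⁻¹ : ℝ) : ℂ) • V)ᴴ
      = (((aspectRatio d n m)⁻¹ : ℝ) : ℂ) • (V * Vᴴ) := by
    rw [conjTranspose_smul, Matrix.smul_mul, Matrix.mul_smul, smul_smul, Complex.star_def,
      Complex.conj_ofReal, ← Complex.ofReal_mul, ← mul_inv, Real.mul_self_sqrt hr]
  set A := (((Real.sqrt (aspectRatio d n m))⁻¹ : ℝ) : ℂ) • V with hAdef
  have hp : 0 < σa ^ 2 := by positivity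
  have hq : 0 < σn ^ 2 := by positivity
  have h := lmmse_error_eq A hp hq (W := lmmseFilter d n m σa σn x) (by
    rw [lmmseFilter, hS, conjTranspose_conjTranspose])
  rw [errorCovariance, hS, h, hA, smul_smul, ← Complex.ofReal_mul, add_comm, ← div_eq_mul_inv,
    trace_smul, smul_eq_mul, Complex.re_ofReal_mul]
  field_simp

end MeanSquareError

/-! ### Bounds on the asymptotic transform and the limit of small aspect ratio. -/

section LimitBounds

variable {d : ℕ} {β γ : ℝ} {f : (Fin d → ℝ) → ℝ}

/-- The parameter moves with `n` and `m`; the Lipschitz bound reduces it to the fixed value `γ / β`.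
-/
theorem tendsto_etaFinite_div_aspectRatio (hd : 0 < d) (hf : IsDensity d f) (hβ : 0 < β)
    (hγ : 0 ≤ γ) :
    Tendsto (fun nm : ℕ × ℕ => etaFinite d nm.1 nm.2 f (γ / aspectRatio d nm.1 nm.2))
      (growthRegime d β) (𝓝 (etaLimit d f β (γ / β))) := by
  have h1 := tendsto_etaLimit hd hf hβ (div_nonneg hγ hβ.le)
  have h2 : Tendsto (fun nm : ℕ × ℕ => |γ / aspectRatio d nm.1 nm.2 - γ / β|) (growthRegime d β)
      (𝓝 0) := by
    have := (((tendsto_const_nhds (x := γ)).div (tendsto_aspectRatio_growthRegime (d := d)) hβ.ne').sub_const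
      (γ / β)).abs
    simpa using this
  have h3 : Tendsto (fun nm : ℕ × ℕ => etaFinite d nm.1 nm.2 f (γ / aspectRatio d nm.1 nm.2)
      - etaFinite d nm.1 nm.2 f (γ / β)) (growthRegime d β) (𝓝 0) := by
    refine squeeze_zero_norm' ?_ h2
    filter_upwards [tendsto_fst_growthRegime.eventually_gt_atTop 0,
      tendsto_snd_growthRegime.eventually_gt_atTop 0] with a ha1 ha2
    have : 0 ≤ aspectRatio d a.1 a.2 := by unfold aspectRatio; positivity
    exact abs_etaFinite_sub_param_le hf (by positivity) (by positivity) ha1 ha2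
  simpa using h3.add h1

theorem etaLimit_le (hd : 0 < d) (hf : IsDensity d f) (hβ : 0 < β) (hγ : 0 < γ) {δ : ℝ}
    (hδ : 0 < δ) :
    etaLimit d f β (γ / β)
      ≤ 1 - volume.real (hypercube d ∩ {z | δ < f z}) + β * ((1 + γ⁻¹) * δ⁻¹) := by
  have := growthRegime_neBot hd hβ
  refine le_of_tendsto_of_tendsto (tendsto_etaFinite_div_aspectRatio hd hf hβ hγ.le)
    ((tendsto_aspectRatio_growthRegime.mul_const _).const_add _) ?_
  filter_upwards [tendsto_fst_growthRegime.eventually_gt_atTop 0,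
    tendsto_snd_growthRegime.eventually_gt_atTop 0] with a ha1 ha2
  exact etaFinite_le hf hδ ha1 ha2 hγ

theorem uncoveredSet_eq (d : ℕ) (f : (Fin d → ℝ) → ℝ) :
    uncoveredSet d f = hypercube d ∩ {z | f z = 0} := rfl

theorem IsDensity.measurableSet_coveredSet (hf : IsDensity d f) :
    MeasurableSet (coveredSet d f) :=
  (measurableSet_hypercube d).inter (measurableSet_lt measurable_const hf.measurable)

theorem IsDensity.volume_uncoveredSet (hf : IsDensity d f) :
    volume.real (uncoveredSet d f) = 1 - volume.real (coveredSet d f) := by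
  have h1 : uncoveredSet d f = hypercube d \ coveredSet d f := by
    ext z
    simp only [uncoveredSet, coveredSet, Set.mem_ofPred_eq, Set.mem_sdiff, not_and, not_lt]
    exact ⟨fun h => ⟨h.1, fun _ => h.2.le⟩, fun h => ⟨h.1, le_antisymm (h.2 h.1) (hf.nonneg z h.1)⟩⟩
  have h2 : volume.real (hypercube d) = 1 := by rw [measureReal_def, volume_hypercube]; rfl
  have hfin : volume (hypercube d) ≠ ⊤ := by rw [volume_hypercube]; exact ENNReal.one_ne_top
  have hsub : coveredSet d f ⊆ hypercube d := fun z hz => hz.1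
  rw [h1, measureReal_sdiff hsub hf.measurableSet_coveredSet hfin,
    h2]

/-- A density of integral 1 cannot vanish almost everywhere. This positivity is the source of the
strict inequality. -/
theorem IsDensity.volume_coveredSet_pos (hf : IsDensity d f) :
    0 < volume.real (coveredSet d f) := by
  have hfin : volume (hypercube d) ≠ ⊤ := by rw [volume_hypercube]; exact ENNReal.one_ne_top
  have hfin' : volume (coveredSet d f) ≠ ⊤ := measure_ne_top_of_subset (fun z hz => hz.1) hfin
  rw [measureReal_def, ENNReal.toReal_pos_iff, lt_top_iff_ne_top]
  refine ⟨pos_iff_ne_zero.2 fun h0 => ?_, hfin'⟩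
  have h1 : ∫ z in hypercube d, f z = 0 := by
    refine integral_eq_zero_of_ae ?_
    have h2 : ∀ᵐ z ∂(volume : Measure (Fin d → ℝ)), z ∉ coveredSet d f :=
      measure_eq_zero_iff_ae_notMem.1 h0
    filter_upwards [ae_restrict_of_ae h2, ae_restrict_mem (measurableSet_hypercube d)] with z h3 h4
    exact le_antisymm (not_lt.1 fun h5 => h3 ⟨h4, h5⟩) (hf.nonneg z h4)
  rw [hf.integral_eq_one] at h1
  exact one_ne_zero h1

/-- The asymptotic transform exceeds the measure of the region without sensors. -/
theorem lt_etaLimit (hd : 0 < d) (hf : IsDensity d f) (hβ : 0 < β) {s : ℝ} (hs : 0 < s) :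
    1 - volume.real (coveredSet d f) < etaLimit d f β s := by
  have := growthRegime_neBot hd hβ
  have ha := hf.volume_coveredSet_pos
  have hu := hf.volume_uncoveredSet
  rw [uncoveredSet_eq] at hu
  set a := volume.real (coveredSet d f) with hadef
  -- Multiplied by `s`, this leakage is half of the surplus `a² / (a + s)`, so the other half
  -- survives in the limit.
  obtain ⟨n₀, hn₀⟩ := hf.leakage_le (ε := a ^ 2 / (2 * (a + s) * s)) (by positivity)
  have hU : MeasurableSet {z | f z = 0} := hf.measurable (measurableSet_singleton 0)
  have hle : 1 - a + a ^ 2 / (2 * (a + s)) ≤ etaLimit d f β s := by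
    refine ge_of_tendsto (tendsto_etaLimit hd hf hβ hs.le) ?_
    filter_upwards [tendsto_fst_growthRegime.eventually_gt_atTop 0,
      tendsto_fst_growthRegime.eventually_ge_atTop n₀,
      tendsto_snd_growthRegime.eventually_gt_atTop 0] with p hp1 hp2 hp3
    have hN : (0 : ℝ) < (p.1 : ℝ) ^ d := by positivity
    -- The value `t = a / (a + s)` maximizes `a (2t - t²) - s t²`, with maximum `a² / (a + s)`.
    have h := etaFinite_ge hf hp1 hp3 hs.le hU (t := a / (a + s)) (by positivity)
      (div_le_one_of_le₀ (by linarith) (by positivity))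
    have h2 := (div_le_iff₀ hN).2 (hn₀ p.1 hp2)
    have h3 := mul_le_mul_of_nonneg_left h2 hs.le
    rw [hu] at h
    refine le_trans ?_ h
    have e1 : s * (a ^ 2 / (2 * (a + s) * s)) = a ^ 2 / (2 * (a + s)) := by field_simp
    have e2 : (1 - (1 - a)) * (2 * (a / (a + s)) - (a / (a + s)) ^ 2) - s * (a / (a + s)) ^ 2
        = a ^ 2 / (a + s) := by field_simp; ring
    have e3 : a ^ 2 / (a + s) = a ^ 2 / (2 * (a + s)) + a ^ 2 / (2 * (a + s)) := by
      field_simp; ring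
    rw [e1] at h3
    linarith
  have : 0 < a ^ 2 / (2 * (a + s)) := by positivity
  linarith

theorem tendsto_volume_superlevel (d : ℕ) (f : (Fin d → ℝ) → ℝ) :
    Tendsto (fun k : ℕ => volume.real (hypercube d ∩ {z | 1 / ((k : ℝ) + 1) < f z})) atTop
      (𝓝 (volume.real (coveredSet d f))) := by
  have hfin : volume (hypercube d) ≠ ⊤ := by rw [volume_hypercube]; exact ENNReal.one_ne_top
  have hmono : Monotone fun k : ℕ => hypercube d ∩ {z | 1 / ((k : ℝ) + 1) < f z} := by
    intro i j hij z hz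
    have h1 : 1 / ((j : ℝ) + 1) ≤ 1 / ((i : ℝ) + 1) := Nat.one_div_le_one_div hij
    have h2 : 1 / ((i : ℝ) + 1) < f z := hz.2
    exact ⟨hz.1, h1.trans_lt h2⟩
  have hU : ⋃ k : ℕ, hypercube d ∩ {z | 1 / ((k : ℝ) + 1) < f z} = coveredSet d f := by
    ext z
    simp only [Set.mem_iUnion, Set.mem_inter_iff, Set.mem_ofPred_eq, coveredSet]
    constructor
    · rintro ⟨k, h1, h2⟩
      exact ⟨h1, (by positivity : (0 : ℝ) < 1 / ((k : ℝ) + 1)).trans h2⟩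
    · rintro ⟨h1, h2⟩
      obtain ⟨k, hk⟩ := exists_nat_one_div_lt h2
      exact ⟨k, h1, hk⟩
  have h := tendsto_measure_iUnion_atTop (μ := volume) hmono
  rw [hU] at h
  exact (ENNReal.tendsto_toReal (measure_ne_top_of_subset (fun z hz => hz.1) hfin)).comp h

/-- The limit for massively dense networks. -/
theorem tendsto_etaLimit_zero (hd : 0 < d) (hf : IsDensity d f) (hγ : 0 < γ) :
    Tendsto (fun β : ℝ => etaLimit d f β (γ / β)) (𝓝[>] 0)
      (𝓝 (1 - volume.real (coveredSet d f))) := by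
  refine tendsto_order.2 ⟨fun b hb => ?_, fun b hb => ?_⟩
  · filter_upwards [self_mem_nhdsWithin] with β hβ
    exact hb.trans (lt_etaLimit hd hf hβ (div_pos hγ hβ))
  -- The level `δ` is fixed first so that `1 - |{f > δ}|` lies below `b`. Then `β → 0` removes the
  -- term of order `β / δ`.
  · obtain ⟨k, hk⟩ := ((tendsto_volume_superlevel d f).const_sub 1
      |>.eventually_lt_const hb).exists
    set δ : ℝ := 1 / ((k : ℝ) + 1) with hδ
    have hδ0 : 0 < δ := by positivity
    have hlim : Tendsto (fun β : ℝ => 1 - volume.real (hypercube d ∩ {z | δ < f z})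
        + β * ((1 + γ⁻¹) * δ⁻¹)) (𝓝[>] 0)
        (𝓝 (1 - volume.real (hypercube d ∩ {z | δ < f z}) + 0 * ((1 + γ⁻¹) * δ⁻¹))) :=
      ((tendsto_id.mono_left nhdsWithin_le_nhds).mul_const _).const_add _
    rw [zero_mul, add_zero] at hlim
    filter_upwards [hlim.eventually_lt_const hk, self_mem_nhdsWithin] with β h1 hβ
    exact (etaLimit_le hd hf hβ hγ hδ0).trans_lt h1

end LimitBounds

theorem corollary4 (d : ℕ) (hd : 0 < d) (f : (Fin d → ℝ) → ℝ) (hf_meas : Measurable f)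
    (hf_nonneg : ∀ z ∈ hypercube d, 0 ≤ f z) (hf_int : ∫ z in hypercube d, f z = 1)
    (σa σn : ℝ) (hσa : 0 < σa) (hσn : 0 < σn) (γ : ℝ) (hγ : γ = σa ^ 2 / σn ^ 2) :
    -- the asymptotic transform exists as a limit
    (∀ β : ℝ, 0 < β → ∀ s : ℝ, 0 ≤ s →
      Tendsto (fun nm : ℕ × ℕ => etaFinite d nm.1 nm.2 f s) (growthRegime d β)
        (𝓝 (etaLimit d f β s))) ∧
    -- it gives the asymptotic mean square error
    (∀ β : ℝ, 0 < β →
      Tendsto (fun nm : ℕ × ℕ => mseFinite d nm.1 nm.2 f σa σn) (growthRegime d β)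
        (𝓝 (etaLimit d f β (γ / β)))) ∧
    -- the limit for massively dense networks
    Tendsto (fun β : ℝ => etaLimit d f β (γ / β)) (𝓝[>] 0)
      (𝓝 (1 - volume.real (coveredSet d f))) ∧
    -- this value is the measure of the region without sensors, and the best achievable one
    volume.real (uncoveredSet d f) = 1 - volume.real (coveredSet d f) ∧
    (∀ β : ℝ, 0 < β → 1 - volume.real (coveredSet d f) < etaLimit d f β (γ / β)) ∧
    IsGLB ((fun β : ℝ => etaLimit d f β (γ / β)) '' Set.Ioi 0)
      (1 - volume.real (coveredSet d f)) := by
  have hf : IsDensity d f := ⟨hf_meas, hf_nonneg, hf_int⟩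
  have hγ0 : 0 < γ := by rw [hγ]; positivity
  have hstrict : ∀ β : ℝ, 0 < β → 1 - volume.real (coveredSet d f) < etaLimit d f β (γ / β) :=
    fun β hβ => lt_etaLimit hd hf hβ (div_pos hγ0 hβ)
  have hzero := tendsto_etaLimit_zero hd hf hγ0
  refine ⟨fun β hβ s hs => tendsto_etaLimit hd hf hβ hs, fun β hβ => ?_, hzero,
    hf.volume_uncoveredSet, hstrict, ?_, fun c hc => ?_⟩
  · simp only [mseFinite_eq d _ _ f hσa hσn, ← hγ]
    exact tendsto_etaFinite_div_aspectRatio hd hf hβ hγ0.le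
  · rintro _ ⟨β, hβ, rfl⟩
    exact (hstrict β hβ).le
  -- The infimum is not attained but approached as `β → 0`, so any lower bound of the values passes
  -- to the limit.
  · refine ge_of_tendsto hzero ?_
    filter_upwards [self_mem_nhdsWithin] with β hβ
    exact hc ⟨β, hβ, rfl⟩
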